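/- **POL.** Let $\mathcal P$ be a countable set of propositional letters, $Ag=\{i,j\}$, and $\Sigma$ a finite alphabet of observations. Formulas are $\varphi ::= \top \mid p \mid \varphi\vee\varphi \mid \neg\varphi \mid \hat K_g\varphi \mid \langle\pi\rangle\varphi$ with $p\in\mathcal P$, $g\in Ag$ and $\pi$ a regular expression over $\Sigma$; $K_g=\neg\hat K_g\neg$, $[\pi]=\neg\langle\pi\rangle\neg$, $\bot=\neg\top$. A model $\mathcal M=(S,R,V,Exp)$ has a set $S\neq\emptyset$ of states, equivalence relations $R_g$ on $S$, a valuation $V:S\to 2^{\mathcal P}$, and $Exp$ assigning a regular expression over $\Sigma$ to each state. For a word $w$, $\mathcal L(\pi\backslash w)=\{u: wu\in\mathcal L(\pi)\}$, and $\mathcal M|_w$ is the restriction of $\mathcal M$ to the states $s$ with $\mathcal L(Exp(s)\backslash w)\ne\emptyset$, with $Exp(s)$ replaced by $Exp(s)\backslash w$. Truth is as usual, $\hat K_g$ being the diamond of $R_g$, and $\mathcal M,s\models\langle\pi\rangle\varphi$ iff there is $w\in\mathcal L(\pi)$ such that $s$ survives in $\mathcal M|_w$ and $\mathcal M|_w,s\models\varphi$.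 A formula is POL-satisfiable if it is true at some state of some model. **Machines.** Let $M$ be an alternating Turing machine with one one-way infinite tape over the letters $0,1,\textvisiblespace$, inputs in $\{0,1\}^*$, final states $q_{acc}\neq q_{rej}$, and two transition functions $a$ and $b$, so that each non-final configuration has an $a$-successor and a $b$-successor (possibly equal). A left move at the left-most cell leaves the head in place. Assume that the initial state $q_0$ is existential, that existential and universal (non-final) states alternate, and that whenever $M$ stops its head is on $\textvisiblespace$. Let $p$ be a polynomial with coefficients in $\mathbb N$ and $e(k)=2^{p(k)}$. Assume that $M$ runs in space $e(|x|)$ in the sense that, on each input $x$, the input and all cells visited fit into the positions $1,\dots,e(|x|)-2$ of words of length $e(|x|)$ whose positions $0$ and $e(|x|)-1$ hold the end marker $\#$. Assume finally that $M$ decides $A\subseteq\{0,1\}^*$: every computation terminates and $M$ accepts $x$ iff $x\in A$. **The formula $tr(x)$.** Put $n=p(|x|)$. A *symbol* is a letter, a pair $qc$ of a state and a letter, or $\#$; $Sym$ is the set of symbols. For three consecutive symbols $\alpha\beta\gamma$ of a configuration word (the state being attached to the letter under the head), $\mathsf{succ}_d(\alpha\beta\gamma)$ is the middle symbol after transition $d\in\{a,b\}$.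 The observations are $a,b,\exists,win$, $p_m,\bar p_m$ ($1\le m\le 3n$) and $k{:}\alpha$ ($k=1,2,3$, $\alpha\in Sym$). The propositional letters include $p_1,\dots,p_{3n}$ and $t$. Write $\langle o\rangle$ for $\langle o\rangle\top$ and - $\square\varphi = K_i(\neg t\to K_j(t\to\varphi))$, $\Diamond=\neg\square\neg$, $\boxplus\varphi=[(a\cup b)^*]\varphi$, $D=(p_1\cup\bar p_1\cup\dots\cup p_{3n}\cup\bar p_{3n})^*$; - $\mathsf K^{k}\varphi = K_iK_jK_iK_j\cdots\varphi$ with $k$ alternating modalities, starting with $K_i$. The three blocks of $n$ letters among $p_1,\dots,p_{3n}$ are the binary digits of $pos_1,pos_2,pos_3\in\{0,\dots,2^n-1\}$; $pos_k=v$, $pos_k=pos_l$ and $pos_l=pos_k+1$ (without overflow) are the evident Boolean formulas. Let $choose_k$ be the concatenation of the $p_m\cup\bar p_m$ over the $k$-th block, $\mathsf{acc}=\Diamond^{3n}\langle 1{:}q_{acc}\textvisiblespace\rangle$, $\mathsf{rej}=\Diamond^{3n}\langle 1{:}q_{rej}\textvisiblespace\rangle$, $\mathsf{final}=\mathsf{acc}\vee\mathsf{rej}$.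 Then $tr(x)$ is the conjunction of the following, for all $1\le m\le 3n$, $1\le k\le 3$, $1\le k<l\le 3$: 1. $\boxplus\bigwedge_{0\le\ell<3n}\square^{\ell}\big(\Diamond p_{\ell+1}\wedge\Diamond\neg p_{\ell+1}\wedge\bigwedge_{1\le r\le\ell}((p_r\to\square p_r)\wedge(\neg p_r\to\square\neg p_r))\big)$; 2. $\boxplus\square^{3n}[\Sigma^*](p_m\leftrightarrow\langle p_m\rangle\wedge[\bar p_m]\bot)$ and $\boxplus\square^{3n}[\Sigma^*](\neg p_m\leftrightarrow\langle\bar p_m\rangle\wedge[p_m]\bot)$; 3. $\boxplus\bigwedge_{0\le\ell<6n}\mathsf K^{\ell}[D](\langle p_m\rangle\wedge\langle\bar p_m\rangle)$; 4. $\boxplus\square^{3n}$ (exactly one of the $\langle k{:}\alpha\rangle$, $\alpha\in Sym$, holds); 5. $\boxplus\square^{3n}\bigwedge_\alpha(\langle k{:}\alpha\rangle\to[D]\langle k{:}\alpha\rangle)$ and $\boxplus\square^{3n}\bigwedge_\alpha(\neg\langle k{:}\alpha\rangle\to[D]\neg\langle k{:}\alpha\rangle)$; 6. $\boxplus[choose_k]\bigvee_\alpha\square^{3n}\langle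 k{:}\alpha\rangle$; 7. $\boxplus\square^{3n}\big(pos_k=pos_l\to\bigvee_\alpha(\langle k{:}\alpha\rangle\wedge\langle l{:}\alpha\rangle)\big)$; 8. $\boxplus(\psi\to\bigwedge_{0\le\ell\le 6n}\mathsf K^{\ell}\psi)$ for $\psi\in\{\langle a\rangle,\neg\langle a\rangle,\langle b\rangle,\neg\langle b\rangle\}$; 9. $\boxplus\square^{3n}(pos_1=0\to\langle1{:}\#\rangle)$ and $\boxplus\square^{3n}(pos_1=2^n-1\to\langle1{:}\#\rangle)$; 10. $\square^{3n}\big((pos_1=1\to\langle 1{:}q_0x_1\rangle)\wedge\bigwedge_{2\le v\le|x|}(pos_1=v\to\langle1{:}x_v\rangle)\big)$, with $\textvisiblespace$ for $x_1$ if $x$ is empty; 11. $\square^{3n}\big((pos_1>\max(|x|,1)\wedge pos_1\ne 2^n-1)\to\langle1{:}\textvisiblespace\rangle\big)$; 12. $\boxplus\Big(\neg\mathsf{final}\to\square^{3n}\big((pos_2=pos_1+1\wedge pos_3=pos_2+1)\to\bigwedge_{\alpha\beta\gamma}(\langle1{:}\alpha\rangle\wedge\langle2{:}\beta\rangle\wedge\langle3{:}\gamma\rangle\to\bigwedge_{d\in\{a,b\}}\langle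 d\rangle\langle2{:}\mathsf{succ}_d(\alpha\beta\gamma)\rangle)\big)\Big)$; 13. $\boxplus(\mathsf{final}\to[a\cup b]\bot)$; 14. $\boxplus(\langle\exists\rangle\to[a\cup b]\neg\langle\exists\rangle)$ and $\boxplus(\neg\langle\exists\rangle\to[a\cup b]\langle\exists\rangle)$; 15. $\boxplus(\mathsf{acc}\to\langle win\rangle)$ and $\boxplus(\mathsf{rej}\to\neg\langle win\rangle)$; 16. $\boxplus(\neg\mathsf{final}\wedge\neg\langle\exists\rangle\to(\langle win\rangle\leftrightarrow[a\cup b]\langle win\rangle))$ and $\boxplus(\neg\mathsf{final}\wedge\langle\exists\rangle\to(\langle win\rangle\leftrightarrow\langle a\cup b\rangle\langle win\rangle))$; 17. $\langle win\rangle\wedge\langle\exists\rangle$. **Proposition.** Let $M$, $p$, $A$ be as above, and fixed. Then $x\mapsto tr(x)$, with formulas written as strings over a finite alphabet, is computable by a Turing machine in time polynomial in $|x|$; and for every $x\in\{0,1\}^*$, $x\in A$ if and only if $tr(x)$ is POL-satisfiable. -/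

import Mathlib

/-! # Public observation logic (POL) -/

namespace POL

/-- Formulas of public observation logic over propositional letters `P`, agents `Ag` and atomic
observations `A`; observation expressions are regular expressions over `A`. -/
inductive Formula (P Ag A : Type) : Type
  | top : Formula P Ag A
  | prop (p : P) : Formula P Ag A
  | or (φ ψ : Formula P Ag A) : Formula P Ag A
  | neg (φ : Formula P Ag A) : Formula P Ag A
  /-- the agent `i` considers `φ` possible -/
  | poss (i : Ag) (φ : Formula P Ag A) : Formula P Ag A
  /-- some sequence of observations matching `π` can be observed, and `φ` holds afterwards -/
  | dia (π : RegularExpression A) (φ : Formula P Ag A) : Formula P Ag A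

/-- POL models (nonempty as soon as they are pointed). -/
structure Model (P Ag A : Type) where
  /-- the states -/
  S : Type
  /-- the epistemic relations -/
  R : Ag → S → S → Prop
  equivalence : ∀ i, Equivalence (R i)
  /-- the valuation -/
  V : S → Set P
  /-- the expected observations -/
  Exp : S → RegularExpression A

section Semantics

variable {P Ag A : Type} [DecidableEq A]

/-- The residuation of an observation expression with a word (iterated Brzozowski derivative). -/
def residual (π : RegularExpression A) (w : List A) : RegularExpression A :=
  w.foldl RegularExpression.deriv π

/-- The language of the residuation of `π` with `w` is `{u | w u ∈ L(π)}`. -/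
theorem mem_residual (π : RegularExpression A) (w u : List A) :
    u ∈ (residual π w).matches' ↔ w ++ u ∈ π.matches' := by
  induction w generalizing π with
  | nil => rfl
  | cons a w ih =>
    have h := ih (π.deriv a)
    rw [← RegularExpression.rmatch_iff_matches'] at h ⊢
    rw [← RegularExpression.rmatch_iff_matches'] at h ⊢
    exact h

/-- The update of a model by the observation of a word `w`: only the states at which `w` can be
observed survive. -/
def Model.update (M : Model P Ag A) (w : List A) : Model P Ag A where
  S := {s : M.S // ∃ u, u ∈ (residual (M.Exp s) w).matches'}
  R i s t := M.R i s.1 t.1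
  equivalence i := (M.equivalence i).comap Subtype.val
  V s := M.V s.1
  Exp s := residual (M.Exp s.1) w

/-- Truth of a formula at a state of a model. -/
def Holds : Formula P Ag A → (M : Model P Ag A) → M.S → Prop
  | .top, _, _ => True
  | .prop p, M, s => p ∈ M.V s
  | .or φ ψ, M, s => Holds φ M s ∨ Holds ψ M s
  | .neg φ, M, s => ¬ Holds φ M s
  | .poss i φ, M, s => ∃ t, M.R i s t ∧ Holds φ M t
  | .dia π φ, M, s => ∃ w ∈ π.matches', ∃ h : ∃ u, u ∈ (residual (M.Exp s) w).matches',
      Holds φ (M.update w) ⟨s, h⟩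

/-- POL-satisfiability. -/
def Satisfiable (φ : Formula P Ag A) : Prop :=
  ∃ (M : Model P Ag A) (s : M.S), Holds φ M s

end Semantics

/-! ## Derived connectives -/

namespace Formula

variable {P Ag A : Type}

/-- Falsity. -/
def bot : Formula P Ag A := neg top

/-- Conjunction. -/
def conj (φ ψ : Formula P Ag A) : Formula P Ag A := neg (or (neg φ) (neg ψ))

/-- Implication. -/
def imp (φ ψ : Formula P Ag A) : Formula P Ag A := or (neg φ) ψ

/-- Equivalence. -/
def iff (φ ψ : Formula P Ag A) : Formula P Ag A := conj (imp φ ψ) (imp ψ φ)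

/-- Finite conjunction. -/
def bigAnd (l : List (Formula P Ag A)) : Formula P Ag A := l.foldr conj top

/-- Finite disjunction. -/
def bigOr (l : List (Formula P Ag A)) : Formula P Ag A := l.foldr or bot

/-- The agent `i` knows `φ`. -/
def know (i : Ag) (φ : Formula P Ag A) : Formula P Ag A := neg (poss i (neg φ))

/-- After every observable sequence matching `π`, the formula `φ` holds. -/
def box (π : RegularExpression A) (φ : Formula P Ag A) : Formula P Ag A := neg (dia π (neg φ))

/-- The atomic observation `o` is observable now. -/
def obs (o : A) : Formula P Ag A := dia (.char o) top

end Formula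

/-- Union of finitely many observation expressions. -/
def unionOf {A : Type} (l : List (RegularExpression A)) : RegularExpression A :=
  l.foldr .plus .zero

/-- Concatenation of finitely many observation expressions. -/
def concatOf {A : Type} (l : List (RegularExpression A)) : RegularExpression A :=
  l.foldr .comp .epsilon

end POL

/-! # Alternating Turing machines -/

/-- Tape letters. -/
inductive Letter
  | zero
  | one
  | blank
  deriving DecidableEq

instance : Fintype Letter :=
  ⟨{.zero, .one, .blank}, fun l => by cases l <;> decide⟩

/-- The letter of an input bit. -/
def Letter.ofBool : Bool → Letter
  | false => .zero
  | true => .one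

/-- The names of the two transitions of a configuration. -/
inductive Branch
  | a
  | b
  deriving DecidableEq

instance : Fintype Branch :=
  ⟨{.a, .b}, fun l => by cases l <;> decide⟩

/-- Head moves. -/
inductive Move
  | left
  | stay
  | right
  deriving DecidableEq

instance : Fintype Move :=
  ⟨{.left, .stay, .right}, fun l => by cases l <;> decide⟩

/-- An alternating Turing machine with one one-way infinite tape. Every non-final configuration has
two (possibly equal) successors, given by the transitions `a` and `b`. -/
structure ATM where
  /-- the states -/
  Q : Type
  [fintypeQ : Fintype Q]
  [decEqQ : DecidableEq Q]
  /-- the initial state -/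
  q₀ : Q
  /-- the accepting state -/
  qAcc : Q
  /-- the rejecting state -/
  qRej : Q
  acc_ne_rej : qAcc ≠ qRej
  /-- whether a (non-final) state is existential, as opposed to universal -/
  isExist : Q → Bool
  /-- the two transition functions (irrelevant at final states) -/
  δ : Branch → Q → Letter → Q × Letter × Move

attribute [instance] ATM.fintypeQ ATM.decEqQ

namespace ATM

variable (M : ATM)

/-- The accepting and the rejecting state are final. -/
def IsFinal (q : M.Q) : Prop := q = M.qAcc ∨ q = M.qRej

/-- Configurations; the cells of the tape are numbered from `0`. -/
structure Cfg where
  /-- the current state -/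
  state : M.Q
  /-- the cell under the head -/
  head : ℕ
  /-- the content of the tape -/
  tape : ℕ → Letter

/-- The initial configuration on input `x`. -/
def init (x : List Bool) : M.Cfg where
  state := M.q₀
  head := 0
  tape k := (x.map Letter.ofBool).getD k .blank

variable {M}

/-- The successor configuration along `d`; a left move at the left-most cell leaves the head where
it is. -/
def Cfg.step (d : Branch) (c : M.Cfg) : M.Cfg :=
  let r := M.δ d c.state (c.tape c.head)
  { state := r.1
    head := match r.2.2 with
      | .left => c.head - 1
      | .stay => c.head
      | .right => c.head + 1
    tape := Function.update c.tape c.head r.2.1 }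

/-- The configurations that can be reached from a given one. -/
inductive Cfg.Reaches (c : M.Cfg) : M.Cfg → Prop
  | refl : Reaches c c
  | tail (c' : M.Cfg) (d : Branch) :
      Reaches c c' → ¬ M.IsFinal c'.state → Reaches c (c'.step d)

/-- All computations from the configuration terminate. -/
inductive Cfg.Halts : M.Cfg → Prop
  | final (c : M.Cfg) : M.IsFinal c.state → Halts c
  | step (c : M.Cfg) : (∀ d, Halts (c.step d)) → Halts c

/-- The configuration is the root of an accepting computation tree. -/
inductive Cfg.Accepts : M.Cfg → Prop
  | acc (c : M.Cfg) : c.state = M.qAcc → Accepts c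
  | exist (c : M.Cfg) (d : Branch) : ¬ M.IsFinal c.state → M.isExist c.state = true →
      Accepts (c.step d) → Accepts c
  | univ (c : M.Cfg) : ¬ M.IsFinal c.state → M.isExist c.state = false →
      (∀ d, Accepts (c.step d)) → Accepts c

variable (M)

/-- `M` decides the problem `L`: every computation terminates, and the accepted inputs are those
in `L`. -/
def Decides (L : Language Bool) : Prop :=
  ∀ x : List Bool, (M.init x).Halts ∧ (x ∈ L ↔ (M.init x).Accepts)

/-- `M` runs in space `e(|x|)`, where the configurations on input `x` are written as words
`# ⋯ #` of length `e(|x|)`: the input and all visited cells fit between the end markers. -/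
def RunsInSpace (e : ℕ → ℕ) : Prop :=
  ∀ x : List Bool, x.length + 2 ≤ e x.length ∧
    ∀ c, (M.init x).Reaches c → c.head + 3 ≤ e x.length

/-- The normal form of alternating machines: the initial state is existential, existential and
universal states alternate, and when the machine stops its head is on a blank. -/
structure Normal : Prop where
  start : M.isExist M.q₀ = true
  alternates : ∀ d q l, ¬ M.IsFinal q → ¬ M.IsFinal (M.δ d q l).1 →
    M.isExist (M.δ d q l).1 = !(M.isExist q)
  stops_on_blank : ∀ x c, (M.init x).Reaches c → M.IsFinal c.state → c.tape c.head = .blank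

end ATM

/-! # The reduction -/

/-- The symbols of configuration words. -/
inductive CellSym (Q : Type)
  /-- a tape letter away from the head -/
  | letter (l : Letter) : CellSym Q
  /-- the letter under the head, with the current state -/
  | head (q : Q) (l : Letter) : CellSym Q
  /-- the end marker -/
  | hash : CellSym Q
  deriving DecidableEq, Fintype

/-- The symbol in the middle after the transition `d`, given three consecutive symbols. -/
def ATM.succ (M : ATM) (d : Branch) (α β γ : CellSym M.Q) : CellSym M.Q :=
  match β with
  | .hash => .hash
  | .head q l =>
    let r := M.δ d q l
    match r.2.2 with
    | .left => if α = .hash then .head r.1 r.2.1 else .letter r.2.1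
    | .stay => .head r.1 r.2.1
    | .right => .letter r.2.1
  | .letter l =>
    match α, γ with
    | .head q m, _ => if (M.δ d q m).2.2 = .right then .head (M.δ d q m).1 l else .letter l
    | _, .head q m => if (M.δ d q m).2.2 = .left then .head (M.δ d q m).1 l else .letter l
    | _, _ => .letter l

namespace POL

/-- The two agents. -/
inductive Agent
  | i
  | j
  deriving DecidableEq

instance : Fintype Agent :=
  ⟨{.i, .j}, fun l => by cases l <;> decide⟩

/-- The other agent. -/
def Agent.other : Agent → Agent
  | .i => .j
  | .j => .i

/-- Propositional letters: `p m` for the binary digits of the positions, and an auxiliary letter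
`t` (true at the nodes of the tree, false at the intermediate states between a node and its
children). -/
inductive Atom
  | p (m : ℕ)
  | t
  deriving DecidableEq

/-- The finite alphabet of observations, for positions of `n` binary digits. -/
inductive Obs (Q : Type) (n : ℕ)
  /-- the transitions -/
  | act (d : Branch) : Obs Q n
  /-- the digit `m` is `1` -/
  | p (m : Fin (3 * n)) : Obs Q n
  /-- the digit `m` is `0` -/
  | pbar (m : Fin (3 * n)) : Obs Q n
  /-- the symbol `α` is written in the current cell of the configuration `k` -/
  | sym (k : Fin 3) (α : CellSym Q) : Obs Q n
  /-- the configuration is existential -/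
  | ex : Obs Q n
  /-- the configuration is winning -/
  | win : Obs Q n
  deriving DecidableEq, Fintype

namespace Reduction

open Formula

/-- The formulas of the reduction. -/
abbrev F (Q : Type) (n : ℕ) : Type := Formula Atom Agent (Obs Q n)

variable {Q : Type} {n : ℕ}

/-- The list of all symbols. -/
noncomputable def syms (Q : Type) [Fintype Q] [DecidableEq Q] : List (CellSym Q) :=
  (Finset.univ : Finset (CellSym Q)).toList

/-! ## Programs -/

/-- `a ∪ b` -/
def step : RegularExpression (Obs Q n) := .plus (.char (.act .a)) (.char (.act .b))

/-- `p_m ∪ p̄_m` -/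
def digit (m : Fin (3 * n)) : RegularExpression (Obs Q n) := .plus (.char (.p m)) (.char (.pbar m))

/-- `(p_1 ∪ p̄_1 ∪ ⋯ ∪ p_{3n} ∪ p̄_{3n})^*` -/
def digits : RegularExpression (Obs Q n) := .star (unionOf ((List.finRange (3 * n)).map digit))

/-- The index of the digit number `m` (least significant first) of the `k`-th position; the digits
of `pos_1`, `pos_2`, `pos_3` form three consecutive blocks. -/
def idx (k : Fin 3) (m : Fin n) : Fin (3 * n) := finProdFinEquiv (k, m)

/-- The program `choose pos_k`. -/
def choose (k : Fin 3) : RegularExpression (Obs Q n) :=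
  concatOf ((List.finRange n).map fun m => digit (idx k m))

/-- The program `Σ^*`. -/
noncomputable def anything [Fintype Q] [DecidableEq Q] : RegularExpression (Obs Q n) :=
  .star (unionOf (
    ([Obs.act .a, .act .b, .ex, .win]
      ++ (List.finRange (3 * n)).map Obs.p ++ (List.finRange (3 * n)).map Obs.pbar
      ++ (List.finRange 3).flatMap fun k => (syms Q).map (Obs.sym k)).map .char))

/-- After every sequence of transitions. -/
def always (φ : F Q n) : F Q n := box (.star step) φ

/-! ## Epistemic modalities -/

/-- The modality `□` of the logic K, simulated by the knowledge of two agents. -/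
def nec (φ : F Q n) : F Q n :=
  know .i (imp (neg (prop .t)) (know .j (imp (prop .t) φ)))

/-- `□^k` -/
def necIter (k : ℕ) (φ : F Q n) : F Q n := nec^[k] φ

/-- The dual modality `◇`. -/
def pos (φ : F Q n) : F Q n := neg (nec (neg φ))

/-- `◇^k` -/
def posIter (k : ℕ) (φ : F Q n) : F Q n := pos^[k] φ

/-- The formula `φ` holds at all leaves. -/
def leaves (φ : F Q n) : F Q n := necIter (3 * n) φ

/-- `K_g K_g' K_g K_g' ⋯ φ` with `k` alternating knowledge modalities, where `g` and `g'` are the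
two agents. -/
def knowAlt : Agent → ℕ → F Q n → F Q n
  | _, 0, φ => φ
  | g, k + 1, φ => know g (knowAlt g.other k φ)

/-- `φ` holds at all states reachable by fewer than `k` alternating epistemic steps. As `□` consists
of two epistemic steps, the states of depth less than `6 n` are the inner nodes of the binary tree
and the intermediate states, and the states of depth `6 n` are its leaves. -/
def within (k : ℕ) (φ : F Q n) : F Q n :=
  bigAnd ((List.range k).map fun l => knowAlt .i l φ)

/-! ## Positions and symbols -/

/-- The proposition `p_m`. -/
def pr (m : Fin (3 * n)) : F Q n := prop (.p m)

/-- The `k`-th position of the current leaf is `v` (for `v < 2 ^ n`). -/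
def posEq (k : Fin 3) (v : ℕ) : F Q n :=
  bigAnd ((List.finRange n).map fun m : Fin n =>
    if v.testBit m.val then pr (idx k m) else neg (pr (idx k m)))

/-- `pos_k = pos_k'` -/
def posSame (k k' : Fin 3) : F Q n :=
  bigAnd ((List.finRange n).map fun m => iff (pr (idx k m)) (pr (idx k' m)))

/-- `pos_k' = pos_k + 1` (without overflow): for some `m`, the digits below `m` are `1` in `pos_k`
and `0` in `pos_k'`, the digit `m` is `0` in `pos_k` and `1` in `pos_k'`, and the digits above `m`
agree. -/
def posSucc (k k' : Fin 3) : F Q n :=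
  bigOr ((List.finRange n).map fun m =>
    bigAnd ((List.finRange n).map fun l =>
      if l < m then conj (pr (idx k l)) (neg (pr (idx k' l)))
      else if l = m then conj (neg (pr (idx k l))) (pr (idx k' l))
      else iff (pr (idx k l)) (pr (idx k' l))))

/-- The symbol `α` is written in the current cell of the configuration `k`. -/
def wr (k : Fin 3) (α : CellSym Q) : F Q n := obs (.sym k α)

/-- Exactly one of the formulas `f a`, for `a` in `l`, is true. -/
def exactlyOne {B : Type} [DecidableEq B] (l : List B) (f : B → F Q n) : F Q n :=
  bigOr (l.map fun a => conj (f a) (bigAnd ((l.filter (· ≠ a)).map fun a' => neg (f a'))))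

/-! ## The conjuncts -/

/-- There is a complete binary tree of depth `3 n`, branching over the digits. -/
def tree : F Q n :=
  always (bigAnd ((List.finRange (3 * n)).map fun l => necIter l.val
    (conj (conj (pos (pr l)) (pos (neg (pr l))))
      (bigAnd (((List.finRange (3 * n)).filter (· < l)).map fun m =>
        conj (imp (pr m) (nec (pr m))) (imp (neg (pr m)) (nec (neg (pr m)))))))))

/-- At the leaves, exactly the values of the digits are observable, at any time. -/
noncomputable def digitsLeaf [Fintype Q] [DecidableEq Q] : F Q n :=
  bigAnd ((List.finRange (3 * n)).map fun m => conj
    (always (leaves (box anything (iff (pr m) (conj (obs (.p m)) (box (.char (.pbar m)) bot))))))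
    (always (leaves (box anything
      (iff (neg (pr m)) (conj (obs (.pbar m)) (box (.char (.p m)) bot)))))))

/-- At the inner nodes and the intermediate states, all digits are observable. -/
def digitsInner : F Q n :=
  bigAnd ((List.finRange (3 * n)).map fun m =>
    always (within (6 * n) (box digits (conj (obs (.p m)) (obs (.pbar m))))))

section Symbols

variable [Fintype Q] [DecidableEq Q]

/-- At each leaf, there is a unique symbol in each of the three configurations. -/
noncomputable def uniqueSym : F Q n :=
  bigAnd ((List.finRange 3).map fun k => always (leaves (exactlyOne (syms Q) (wr k))))

/-- Symbols do not change when digits are observed. -/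
noncomputable def stableSym : F Q n :=
  bigAnd ((List.finRange 3).map fun k => conj
    (always (leaves (bigAnd ((syms Q).map fun α => imp (wr k α) (box digits (wr k α))))))
    (always (leaves (bigAnd ((syms Q).map fun α =>
      imp (neg (wr k α)) (box digits (neg (wr k α))))))))

/-- Leaves with the same `k`-th position have the same symbol in the configuration `k`. -/
noncomputable def coherentSym : F Q n :=
  bigAnd ((List.finRange 3).map fun k =>
    always (box (choose k) (bigOr ((syms Q).map fun α => leaves (wr k α)))))

/-- The three configurations are equal. -/
noncomputable def sameConfig : F Q n :=
  bigAnd (([(0, 1), (0, 2), (1, 2)] : List (Fin 3 × Fin 3)).map fun r =>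
    always (leaves (imp (posSame r.1 r.2)
      (bigOr ((syms Q).map fun α => conj (wr r.1 α) (wr r.2 α))))))

end Symbols

/-- Each transition is observable everywhere in the tree if it is observable at the root, and nowhere
otherwise. -/
def uniformTrans : F Q n :=
  bigAnd (([obs (.act .a), neg (obs (.act .a)), obs (.act .b), neg (obs (.act .b))]).map fun ψ =>
    always (imp ψ (within (6 * n + 1) ψ)))

/-- The left-most and right-most cells contain the end marker. -/
def endMarkers : F Q n :=
  conj (always (leaves (imp (posEq 0 0) (wr 0 .hash))))
    (always (leaves (imp (posEq 0 (2 ^ n - 1)) (wr 0 .hash))))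

/-- The symbol at position `v + 1` of the initial configuration on input `x`, for `v < |x|` and
for `v = 0`. -/
def inputSym (q₀ : Q) (x : List Bool) (v : ℕ) : CellSym Q :=
  let l := (x.map Letter.ofBool).getD v .blank
  if v = 0 then .head q₀ l else .letter l

/-- The non-blank part of the initial configuration: the initial state with the first letter (a
blank if the input is empty) at position `1`, then the other letters of the input. -/
def initInput (q₀ : Q) (x : List Bool) : F Q n :=
  leaves (bigAnd ((List.range (max x.length 1)).map fun v =>
    imp (posEq 0 (v + 1)) (wr 0 (inputSym q₀ x v))))

/-- The blank part of the initial configuration: the positions from `max |x| 1 + 1` to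
`2 ^ n - 2`. -/
def initBlank (x : List Bool) : F Q n :=
  leaves (imp
    (conj (bigAnd ((List.range (max x.length 1 + 1)).map fun v => neg (posEq 0 v)))
      (neg (posEq 0 (2 ^ n - 1))))
    (wr 0 (.letter .blank)))

section Machine

variable (M : ATM)

/-- The current configuration is accepting. -/
def accepted : F M.Q n := posIter (3 * n) (wr 0 (.head M.qAcc .blank))

/-- The current configuration is rejecting. -/
def rejected : F M.Q n := posIter (3 * n) (wr 0 (.head M.qRej .blank))

/-- The current configuration is final. -/
def final : F M.Q n := Formula.or (accepted M) (rejected M)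

/-- In a non-final configuration, the observation of `a` and of `b` updates the symbols as the
corresponding transition does. -/
noncomputable def transitions : F M.Q n :=
  always (imp (neg (final M)) (leaves (imp (conj (posSucc 0 1) (posSucc 1 2))
    (bigAnd ((syms M.Q).flatMap fun α => (syms M.Q).flatMap fun β => (syms M.Q).map fun γ =>
      imp (conj (wr 0 α) (conj (wr 1 β) (wr 2 γ)))
        (conj (dia (.char (.act .a)) (wr 1 (M.succ .a α β γ)))
          (dia (.char (.act .b)) (wr 1 (M.succ .b α β γ)))))))))

/-- No transition is taken in a final configuration. -/
def halted : F M.Q n := always (imp (final M) (box step bot))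

/-- Existential and universal configurations alternate. -/
def alternation : F M.Q n :=
  conj (always (imp (obs .ex) (box step (neg (obs .ex)))))
    (always (imp (neg (obs .ex)) (box step (obs .ex))))

/-- The winning condition. -/
def winning : F M.Q n :=
  bigAnd [
    always (imp (accepted M) (obs .win)),
    always (imp (rejected M) (neg (obs .win))),
    always (imp (conj (neg (final M)) (neg (obs .ex))) (iff (obs .win) (box step (obs .win)))),
    always (imp (conj (neg (final M)) (obs .ex)) (iff (obs .win) (dia step (obs .win))))]

/-- The formula for input `x` with `n` digits per position, i.e. for configuration words of length
`2 ^ n`. -/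
noncomputable def formula (n : ℕ) (x : List Bool) : F M.Q n :=
  bigAnd [tree, digitsLeaf, digitsInner, uniqueSym, stableSym, coherentSym, sameConfig,
    uniformTrans, endMarkers, initInput M.q₀ x, initBlank x, transitions M, halted M,
    alternation M, winning M, conj (obs .win) (obs .ex)]

/-- The formula `tr(x)`, for configuration words of length `e(|x|) = 2 ^ p(|x|)`. -/
noncomputable def tr (p : Polynomial ℕ) (x : List Bool) : F M.Q (p.eval x.length) :=
  formula M (p.eval x.length) x

end Machine

end Reduction

/-! # Writing formulas as strings -/

/-- The finite alphabet in which formulas are written; indices are written in unary. -/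
inductive Token (Q : Type)
  | top | propP | propT | or | neg
  | poss (g : Agent)
  | dia
  | zero | epsilon | char | plus | comp | star
  | act (d : Branch)
  | p | pbar
  | sym (k : Fin 3) (α : CellSym Q)
  | ex | win
  | tick | endNum
  deriving DecidableEq, Fintype

section Encoding

variable {Q : Type} {n : ℕ}

/-- Unary notation. -/
def encNat (m : ℕ) : List (Token Q) := List.replicate m .tick ++ [.endNum]

/-- Observations as strings. -/
def encObs : Obs Q n → List (Token Q)
  | .act d => [.act d]
  | .p m => .p :: encNat m
  | .pbar m => .pbar :: encNat m
  | .sym k α => [.sym k α]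
  | .ex => [.ex]
  | .win => [.win]

/-- Observation expressions as strings, in Polish notation. -/
def encExpr : RegularExpression (Obs Q n) → List (Token Q)
  | .zero => [.zero]
  | .epsilon => [.epsilon]
  | .char o => .char :: encObs o
  | .plus π ρ => .plus :: (encExpr π ++ encExpr ρ)
  | .comp π ρ => .comp :: (encExpr π ++ encExpr ρ)
  | .star π => .star :: encExpr π

/-- Formulas as strings, in Polish notation. -/
def encFormula : Formula Atom Agent (Obs Q n) → List (Token Q)
  | .top => [.top]
  | .prop (.p m) => .propP :: encNat m
  | .prop .t => [.propT]
  | .or φ ψ => .or :: (encFormula φ ++ encFormula ψ)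
  | .neg φ => .neg :: encFormula φ
  | .poss g φ => .poss g :: encFormula φ
  | .dia π φ => .dia :: (encExpr π ++ encFormula φ)

end Encoding

end POL

/-! # Structured programs on stacks of bits -/

namespace StackProgram

open Turing

/-! The formula describes a play of the machine. The transitions observed so far are a word over
`a`, `b`, and the current configuration word of length `2 ^ n` is stored at the leaves of a binary
tree of depth `3 n`, whose edges are simulated by the two agents. A leaf carries three positions
and, as observable letters, the symbols at these positions in three copies of the configuration.
Three copies are needed because a transition acts locally: the new symbol at a position depends on
three consecutive old ones (`ATM.succ_cell`).

From a model to acceptance. The tree conjunct yields a leaf for every choice of the three positions,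
but there may be many leaves with the same positions. Digit observations make their symbols agree:
inner states allow all digits, a leaf only its own, so observing the digits of `v` in block `k`
keeps all leaves with `k`-th position `v` and discards the other leaves. The survivors share a
symbol, and stability carries this back to the time before the digits were observed (`exists_sym`);
leaves with equal positions identify the three copies (`canSee_of_canSee`). Hence the leaves show
one configuration: the initial one at the start (`shows_init`), and the successor after each
transition (`Shows.step`). Induction on the terminating computation then turns observability of
`win` into acceptance (`accepts_of_holdsAt`).

From acceptance to a model. The states are the nodes of the infinite binary tree together with an
intermediate state on every edge, and the two relations are kernels of maps, hence equivalences. At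
every state one can observe a run of the machine followed by letters that are true of the state and
of the configuration reached. This language is regular because the computation tree is finite
(`exists_regularExpression`), and it is closed under prefixes, so that a state survives exactly the
words in its language. The letter `win` is observable at the root exactly when the configuration
reached is accepting in the sense of `Accepts`; acceptance of the input is needed for the last
conjunct only (`holdsAt_formula_of_accepts`).

Both directions replace updated models by truth relative to the word observed so far in one fixed
model (`holds_iff_holdsAt`).

Polynomial time. Programs on stacks of bits compile to stack machines with the same number of steps
(`iterate_of_runs`). Numbers are heights of stacks, and Polish notation makes every string occurring
here a concatenation of loops over such heights. All indices are polynomial in the input length; the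
one exponential number, the last position, has all its digits equal to `1` and is never computed
(`posEq_last`). -/

/-- Structured programs over `R` stacks of bits and one output stack over `Γ`. -/
inductive Prog (R : ℕ) (Γ : Type) : Type
  | skip : Prog R Γ
  /-- write a letter on the output stack -/
  | emit (a : Γ) : Prog R Γ
  | push (r : Fin R) (b : Bool) : Prog R Γ
  | seq (p q : Prog R Γ) : Prog R Γ
  /-- pop the stack `r` and continue depending on the result -/
  | case (r : Fin R) (f : Option Bool → Prog R Γ) : Prog R Γ
  /-- while the stack `r` is nonempty, pop it and run the body -/
  | loop (r : Fin R) (f : Bool → Prog R Γ) : Prog R Γ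

/-- The contents of the stacks of bits. -/
abbrev Regs (R : ℕ) : Type := Fin R → List Bool

/-- The contents of all stacks. -/
structure Store (R : ℕ) (Γ : Type) where
  reg : Regs R
  out : List Γ

variable {R : ℕ} {Γ : Type}

/-- Big-step semantics, with the number of steps. -/
inductive Runs : Prog R Γ → Store R Γ → ℕ → Store R Γ → Prop
  | skip (s) : Runs .skip s 1 s
  | emit (a s) : Runs (.emit a) s 1 ⟨s.reg, a :: s.out⟩
  | push (r b s) : Runs (.push r b) s 1 ⟨Function.update s.reg r (b :: s.reg r), s.out⟩
  | seq {p q s t₁ s₁ t₂ s₂} : Runs p s t₁ s₁ → Runs q s₁ t₂ s₂ →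
      Runs (.seq p q) s (1 + t₁ + t₂) s₂
  | case_nil {r f s t s'} : s.reg r = [] → Runs (f none) s t s' → Runs (.case r f) s (1 + t) s'
  | case_cons {r f s t s' b l} : s.reg r = b :: l →
      Runs (f (some b)) ⟨Function.update s.reg r l, s.out⟩ t s' → Runs (.case r f) s (1 + t) s'
  | loop_nil {r f s} : s.reg r = [] → Runs (.loop r f) s 1 s
  | loop_cons {r f s t s' t' s'' b l} : s.reg r = b :: l →
      Runs (f b) ⟨Function.update s.reg r l, s.out⟩ t s' → Runs (.loop r f) s' t' s'' →
      Runs (.loop r f) s (1 + t + t') s''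

/-! ## Compilation -/

/-- The alphabets of the stacks. -/
abbrev Alph (R : ℕ) (Γ : Type) : Option (Fin R) → Type
  | none => Γ
  | some _ => Bool

/-- A store as a family of stacks. -/
def Store.stk (s : Store R Γ) : ∀ k, List (Alph R Γ k)
  | none => s.out
  | some r => s.reg r

theorem Store.update_out (s : Store R Γ) (l : List Γ) :
    Function.update s.stk none l = Store.stk ⟨s.reg, l⟩ := by
  funext k; cases k <;> simp [Store.stk]

theorem Store.update_reg (s : Store R Γ) (r : Fin R) (l : List Bool) :
    Function.update s.stk (some r) l = Store.stk ⟨Function.update s.reg r l, s.out⟩ := by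
  funext k
  cases k with
  | none => simp [Store.stk]
  | some q =>
    by_cases h : q = r
    · subst h; simp [Store.stk]
    · simp [Store.stk, h]

/-- The statement executed at a continuation. -/
def code {Λ : Type} (lift : List (Prog R Γ) → Λ) :
    List (Prog R Γ) → TM2.Stmt (Alph R Γ) Λ (Option Bool)
  | [] => .load (fun _ => none) .halt
  | .skip :: k => .goto fun _ => lift k
  | .emit a :: k => .push none (fun _ => a) (.goto fun _ => lift k)
  | .push r b :: k => .push (some r) (fun _ => b) (.goto fun _ => lift k)
  | .seq p q :: k => .goto fun _ => lift (p :: q :: k)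
  | .case r f :: k => .pop (some r) (fun _ o => o) (.goto fun v => lift (f v :: k))
  | .loop r f :: k => .pop (some r) (fun _ o => o) (.goto fun v =>
      match v with
      | none => lift k
      | some b => lift (f b :: .loop r f :: k))

/-- The continuations that can occur when a program is run with a given continuation. -/
def conts : Prog R Γ → List (Prog R Γ) → Set (List (Prog R Γ))
  | .skip, k => {.skip :: k, k}
  | .emit a, k => {.emit a :: k, k}
  | .push r b, k => {.push r b :: k, k}
  | .seq p q, k => {.seq p q :: k, k} ∪ (conts p (q :: k) ∪ conts q k)
  | .case r f, k => {.case r f :: k, k} ∪ ⋃ o, conts (f o) k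
  | .loop r f, k => {.loop r f :: k, k} ∪ ⋃ b, conts (f b) (.loop r f :: k)

/-- A loop returns to the same continuation after each round instead of growing a new one, and bits
have finitely many values. So continuations can serve as the labels of a finite machine. -/
theorem conts_finite (p : Prog R Γ) : ∀ k, (conts p k).Finite := by
  induction p with
  | skip => intro k; simp [conts]
  | emit a => intro k; simp [conts]
  | push r b => intro k; simp [conts]
  | seq p q hp hq => intro k; exact (Set.toFinite _).union ((hp _).union (hq _))
  | case r f h => intro k; exact (Set.toFinite _).union (Set.finite_iUnion fun o => h o _)
  | loop r f h => intro k; exact (Set.toFinite _).union (Set.finite_iUnion fun o => h o _)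

theorem cons_mem_conts (p : Prog R Γ) (k) : p :: k ∈ conts p k := by
  cases p <;> simp [conts]

theorem mem_conts (p : Prog R Γ) (k) : k ∈ conts p k := by
  cases p <;> simp [conts]

/-! ### Simulation of the big-step semantics by the compiled machine -/

section Compile

variable {S : Set (List (Prog R Γ))} (h₀ : [] ∈ S)

open Classical in
/-- A continuation as a label. -/
noncomputable def label (k : List (Prog R Γ)) : S := if h : k ∈ S then ⟨k, h⟩ else ⟨[], h₀⟩

theorem label_val {k : List (Prog R Γ)} (h : k ∈ S) : (label h₀ k : S).1 = k := by
  simp [label, h]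

/-- The program of the compiled machine. -/
noncomputable def machine : S → TM2.Stmt (Alph R Γ) S (Option Bool) := fun k => code (label h₀) k.1

/-- One step of the compiled machine. -/
theorem step_machine {k : List (Prog R Γ)} (h : k ∈ S) (v : Option Bool) (s : Store R Γ) :
    TM2.step (machine h₀) ⟨some (label h₀ k), v, s.stk⟩ =
      some (TM2.stepAux (code (label h₀) k) v s.stk) := by
  rw [TM2.step, machine, label_val h₀ h]

/-- The costs in `Runs` are chosen so that each rule corresponds to exactly one step of the machine,
plus those of its premises. The internal state only carries the last popped value and is overwritten
before it is read again, so it may be arbitrary at the start. -/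
theorem iterate_of_runs {p : Prog R Γ} {s s' : Store R Γ} {t : ℕ} (h : Runs p s t s') :
    ∀ (k : List (Prog R Γ)) (v : Option Bool), conts p k ⊆ S → ∃ v',
      (flip bind (TM2.step (machine h₀)))^[t] (some ⟨some (label h₀ (p :: k)), v, s.stk⟩) =
        some ⟨some (label h₀ k), v', s'.stk⟩ := by
  induction h with
  | skip s =>
    intro k v hS
    refine ⟨v, ?_⟩
    rw [Function.iterate_one]
    exact step_machine h₀ (hS (cons_mem_conts _ _)) v s
  | emit a s =>
    intro k v hS
    refine ⟨v, ?_⟩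
    rw [Function.iterate_one]
    refine (step_machine h₀ (hS (cons_mem_conts _ _)) v s).trans ?_
    rw [← Store.update_out s (a :: s.out)]
    rfl
  | push r b s =>
    intro k v hS
    refine ⟨v, ?_⟩
    rw [Function.iterate_one]
    refine (step_machine h₀ (hS (cons_mem_conts _ _)) v s).trans ?_
    rw [← Store.update_reg]
    rfl
  | @seq p q s t₁ s₁ t₂ s₂ _ _ ih₁ ih₂ =>
    intro k v hS
    obtain ⟨v₁, h₁⟩ := ih₁ (q :: k) v fun x hx => hS (Or.inr (Or.inl hx))
    obtain ⟨v₂, h₂⟩ := ih₂ k v₁ fun x hx => hS (Or.inr (Or.inr hx))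
    refine ⟨v₂, ?_⟩
    rw [add_comm (1 + t₁), Function.iterate_add_apply, add_comm 1, Function.iterate_add_apply,
      Function.iterate_one]
    rw [show flip bind (TM2.step (machine h₀)) (some ⟨some (label h₀ (.seq p q :: k)), v, s.stk⟩) =
      some ⟨some (label h₀ (p :: q :: k)), v, s.stk⟩ from
        step_machine h₀ (hS (cons_mem_conts _ _)) v s, h₁, h₂]
  | @case_nil r f s t s' hr _ ih =>
    intro k v hS
    obtain ⟨v₁, h₁⟩ := ih k none fun x hx => hS (Or.inr (Set.mem_iUnion.2 ⟨_, hx⟩))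
    refine ⟨v₁, ?_⟩
    rw [add_comm 1, Function.iterate_add_apply, Function.iterate_one, ← h₁]
    congr 1
    refine (step_machine h₀ (hS (cons_mem_conts _ _)) v s).trans ?_
    simp only [code, TM2.stepAux]
    rw [show s.stk (some r) = [] from hr, List.tail_nil,
      show Function.update s.stk (some r) [] = s.stk by
        rw [← show s.stk (some r) = [] from hr, Function.update_eq_self]]
    rfl
  | @case_cons r f s t s' b l hr _ ih =>
    intro k v hS
    obtain ⟨v₁, h₁⟩ := ih k (some b) fun x hx => hS (Or.inr (Set.mem_iUnion.2 ⟨_, hx⟩))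
    refine ⟨v₁, ?_⟩
    rw [add_comm 1, Function.iterate_add_apply, Function.iterate_one, ← h₁]
    congr 1
    refine (step_machine h₀ (hS (cons_mem_conts _ _)) v s).trans ?_
    simp only [code, TM2.stepAux]
    rw [show s.stk (some r) = b :: l from hr, List.tail_cons, Store.update_reg]
    rfl
  | @loop_nil r f s hr =>
    intro k v hS
    refine ⟨none, ?_⟩
    rw [Function.iterate_one]
    refine (step_machine h₀ (hS (cons_mem_conts _ _)) v s).trans ?_
    simp only [code, TM2.stepAux]
    rw [show s.stk (some r) = [] from hr, List.tail_nil,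
      show Function.update s.stk (some r) [] = s.stk by
        rw [← show s.stk (some r) = [] from hr, Function.update_eq_self]]
    rfl
  | @loop_cons r f s t s' t' s'' b l hr _ _ ih₁ ih₂ =>
    intro k v hS
    obtain ⟨v₁, h₁⟩ := ih₁ (.loop r f :: k) (some b) fun x hx =>
      hS (Or.inr (Set.mem_iUnion.2 ⟨_, hx⟩))
    obtain ⟨v₂, h₂⟩ := ih₂ k v₁ hS
    refine ⟨v₂, ?_⟩
    rw [add_comm (1 + t), Function.iterate_add_apply, add_comm 1, Function.iterate_add_apply,
      Function.iterate_one, ← h₂, ← h₁]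
    congr 2
    refine (step_machine h₀ (hS (cons_mem_conts _ _)) v s).trans ?_
    simp only [code, TM2.stepAux]
    rw [show s.stk (some r) = b :: l from hr, List.tail_cons, Store.update_reg]
    rfl

end Compile

/-- A function computed by a program in polynomial time, from the stack `r₀` to the output stack,
is computable in polynomial time. -/
theorem nonempty_polyTime (r₀ : Fin R) (p : Prog R Γ) (f : List Bool → List Γ)
    (T : Polynomial ℕ)
    (h : ∀ x, ∃ t ≤ T.eval x.length,
      Runs p ⟨Function.update (fun _ => []) r₀ x, []⟩ t ⟨fun _ => [], f x⟩) :
    Nonempty (TM2ComputableInPolyTime (id : List Bool → List Bool) (id : List Γ → List Γ) f) := by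
  classical
  have hfin : (conts p []).Finite := conts_finite p []
  have : Fintype (conts p []) := hfin.fintype
  let tm : FinTM2 :=
    { K := Option (Fin R)
      k₀ := some r₀
      k₁ := none
      Γ := Alph R Γ
      Λ := conts p []
      main := ⟨[p], cons_mem_conts p []⟩
      σ := Option Bool
      initialState := none
      Γk₀Fin := inferInstanceAs (Fintype Bool)
      m := machine (mem_conts p []) }
  have hmain : (⟨[p], cons_mem_conts p []⟩ : conts p []) = label (mem_conts p []) [p] :=
    Subtype.ext (label_val _ (cons_mem_conts p [])).symm
  -- The additional step executes the empty continuation, which halts.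
  refine ⟨{ tm := tm, inputAlphabet := Equiv.refl _, outputAlphabet := Equiv.refl _,
            time := T + 1, outputsFun := fun x => ?_ }⟩
  let hx := (h x).choose_spec
  refine ⟨⟨(h x).choose + 1, ?_⟩, ?_⟩
  · obtain ⟨v', hv'⟩ := iterate_of_runs (mem_conts p []) hx.2 [] none subset_rfl
    have hinit : initList tm (List.map (Equiv.refl Bool).invFun (id x)) =
        ⟨some (label (mem_conts p []) [p]), none,
          Store.stk ⟨Function.update (fun _ => []) r₀ x, []⟩⟩ := by
      rw [← hmain]
      unfold initList
      congr 1
      funext k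
      cases k with
      | none => rfl
      | some r =>
        by_cases hr : r = r₀
        · subst hr
          simp [Store.stk, tm]
        · have : (some r : Option (Fin R)) ≠ some r₀ := by simpa using hr
          simp [Store.stk, tm, hr]
    rw [add_comm, Function.iterate_add_apply, Function.iterate_one]
    have e : (flip bind tm.step)^[(h x).choose]
        (some (initList tm (List.map (Equiv.refl Bool).invFun (id x)))) =
        some ⟨some (label (mem_conts p []) []), v', Store.stk ⟨fun _ => [], f x⟩⟩ := by
      rw [hinit]; exact hv'
    refine (congrArg _ e).trans ?_
    refine (step_machine (mem_conts p []) (mem_conts p []) v' ⟨fun _ => [], f x⟩).trans ?_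
    -- The halting statement resets the internal state, as `haltList` requires the initial one.
    simp only [code, TM2.stepAux, Option.map_some]
    unfold haltList
    congr 2
    funext k
    cases k with
    | none => simp [Store.stk, tm]
    | some r => simp [Store.stk, tm]
  · rw [Polynomial.eval_add, Polynomial.eval_one]
    exact Nat.add_le_add_right hx.1 1

end StackProgram

namespace StackProgram

open Function

variable {R : ℕ} {Γ : Type}

/-! ## Basic programs -/

theorem Runs.of_eq {p : Prog R Γ} {s : Store R Γ} {t t' : ℕ} {g g' : Regs R} {out : List Γ}
    (h : Runs p s t ⟨g, out⟩) (ht : t = t') (hg : ∀ x, g x = g' x) : Runs p s t' ⟨g', out⟩ := by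
  subst ht
  rwa [← show g = g' from funext hg]

theorem runs_move {r q : Fin R} (hrq : r ≠ q) (out : List Γ) :
    ∀ (l : List Bool) (g : Regs R), g r = l →
      Runs (.loop r fun b => .push q b) ⟨g, out⟩ (2 * l.length + 1)
        ⟨update (update g r []) q (l.reverse ++ g q), out⟩ := by
  intro l
  induction l with
  | nil =>
    intro g h
    have : update (update g r []) q ([].reverse ++ g q) = g := by
      funext x; simp only [update_apply]; split_ifs <;> simp_all
    rw [this]
    exact .loop_nil h
  | cons b l ih =>
    intro g h
    have h1 := ih (update (update g r l) q (b :: g q)) (by simp [hrq])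
    have h2 := Runs.loop_cons (f := fun b => Prog.push q b) (s := (⟨g, out⟩ : Store R Γ)) h
      (.push _ _ _) (by simpa [hrq.symm] using h1)
    refine h2.of_eq (by simp; ring) fun x => ?_
    simp only [update_apply]; split_ifs <;> simp_all

/-- Empty the stack `r`. -/
def clear (r : Fin R) : Prog R Γ := .loop r fun _ => .skip

theorem runs_clear {r : Fin R} (out : List Γ) :
    ∀ (l : List Bool) (g : Regs R), g r = l →
      Runs (clear r) ⟨g, out⟩ (2 * l.length + 1) ⟨update g r [], out⟩ := by
  intro l
  induction l with
  | nil =>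
    intro g h
    rw [← h, update_eq_self, h]
    exact Runs.loop_nil (s := ⟨g, out⟩) h
  | cons b l ih =>
    intro g h
    have h1 := ih (update g r l) (by simp)
    have h2 := Runs.loop_cons (f := fun b => Prog.skip) (s := (⟨g, out⟩ : Store R Γ)) h
      (.skip _) (by simpa [clear] using h1)
    exact h2.of_eq (by simp; ring) fun x => rfl

theorem runs_double {r d q : Fin R} (hrd : r ≠ d) (hrq : r ≠ q) (hdq : d ≠ q) (out : List Γ) :
    ∀ (l : List Bool) (g : Regs R), g q = l →
      Runs (.loop q fun b => .seq (.push r b) (.push d b)) ⟨g, out⟩ (4 * l.length + 1)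
        ⟨update (update (update g q []) r (l.reverse ++ g r)) d (l.reverse ++ g d), out⟩ := by
  intro l
  induction l with
  | nil =>
    intro g h
    have : update (update (update g q []) r ([].reverse ++ g r)) d ([].reverse ++ g d) = g := by
      funext x; simp only [update_apply]; split_ifs <;> simp_all
    rw [this]
    exact .loop_nil h
  | cons b l ih =>
    intro g h
    have h1 := ih (update (update (update g q l) r (b :: g r)) d (b :: g d))
      (by simp [hrq.symm, hdq.symm])
    have h2 := Runs.loop_cons (f := fun b => Prog.seq (.push r b) (.push d b))
      (s := (⟨g, out⟩ : Store R Γ)) h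
      (.seq (.push _ _ _) (.push _ _ _)) (by simpa [hrd, hrd.symm, hrq, hdq] using h1)
    refine h2.of_eq (by simp; ring) fun x => ?_
    simp only [update_apply]; split_ifs <;> simp_all

/-- Add a copy of the stack `r` to the stack `d`, using the stack `q`. -/
def copy (r d q : Fin R) : Prog R Γ :=
  .seq (.loop r fun b => .push q b) (.loop q fun b => .seq (.push r b) (.push d b))

/-- The stack is reversed on its way to `q` and again on its way back, so `r` is restored and `d`
receives the entries in the original order. -/
theorem runs_copy {r d q : Fin R} (hrd : r ≠ d) (hrq : r ≠ q) (hdq : d ≠ q) (g : Regs R)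
    (hq : g q = []) (out : List Γ) :
    Runs (copy r d q) ⟨g, out⟩ (6 * (g r).length + 3) ⟨update g d (g r ++ g d), out⟩ := by
  have h1 := runs_move hrq out _ g rfl
  have h2 := runs_double hrd hrq hdq out _ (update (update g r []) q ((g r).reverse ++ g q)) rfl
  have h3 := Runs.seq h1 h2
  refine h3.of_eq (by simp [hq]; ring) fun x => ?_
  simp only [update_apply]; split_ifs <;> simp_all

/-! ## Programs that write on the output stack -/

/-- The stacks have height at most `B`, and those from number `d` on are empty. -/
def Fits (d B : ℕ) (g : Regs R) : Prop :=
  (∀ r, (g r).length ≤ B) ∧ ∀ r : Fin R, d ≤ r.val → g r = []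

theorem Fits.update {d B : ℕ} {g : Regs R} (h : Fits d B g) {r : Fin R} (hr : r.val = d)
    {l : List Bool} (hl : l.length ≤ B) : Fits (d + 1) B (Function.update g r l) := by
  constructor
  · intro q
    by_cases hq : q = r
    · subst hq; simpa using hl
    · simpa [hq] using h.1 q
  · intro q hq
    have : q ≠ r := by rintro rfl; omega
    simpa [this] using h.2 q (by omega)

theorem Fits.mono {d B B' : ℕ} {g : Regs R} (h : Fits d B g) (hB : B ≤ B') : Fits d B' g :=
  ⟨fun r => (h.1 r).trans hB, h.2⟩

/-- In polynomial time, `f` can be written on top of the output stack, where the stacks from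
number `d` on are free for use. -/
def Emits (d : ℕ) (f : Regs R → List Γ) : Prop :=
  ∃ (p : Prog R Γ) (T : Polynomial ℕ), ∀ B g, Fits d B g → ∀ out, ∃ t ≤ T.eval B,
    Runs p ⟨g, out⟩ t ⟨g, f g ++ out⟩

/-- In polynomial time, `F` can be put on the empty stack `d`, where the stacks after it are free
for use. -/
def Computes (Γ : Type) (d : Fin R) (F : Regs R → List Bool) : Prop :=
  ∃ (p : Prog R Γ) (T G : Polynomial ℕ), ∀ B g, Fits d.val B g →
    (F g).length ≤ G.eval B ∧ ∀ out, ∃ t ≤ T.eval B,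
      Runs p ⟨g, out⟩ t ⟨update g d (F g), out⟩

theorem Emits.congr {d : ℕ} {f f' : Regs R → List Γ} (h : Emits d f) (e : ∀ g, f g = f' g) :
    Emits d f' := by
  rwa [← show f = f' from funext e]

theorem emits_nil (d : ℕ) : Emits d (fun _ : Regs R => ([] : List Γ)) :=
  ⟨.skip, 1, fun _ _ _ _ => ⟨1, by simp, .skip _⟩⟩

theorem Emits.append {d : ℕ} {f f' : Regs R → List Γ} (h : Emits d f) (h' : Emits d f') :
    Emits d (fun g => f g ++ f' g) := by
  obtain ⟨p, T, hp⟩ := h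
  obtain ⟨p', T', hp'⟩ := h'
  -- The output is a stack, so words are written from the back: the second one comes first.
  refine ⟨.seq p' p, 1 + T' + T, fun B g hg out => ?_⟩
  obtain ⟨t', ht', r'⟩ := hp' B g hg out
  obtain ⟨t, ht, r⟩ := hp B g hg (f' g ++ out)
  refine ⟨1 + t' + t, ?_, ?_⟩
  · simp only [Polynomial.eval_add, Polynomial.eval_one]; omega
  · rw [List.append_assoc]; exact .seq r' r

theorem Emits.cons {d : ℕ} {f : Regs R → List Γ} (a : Γ) (h : Emits d f) :
    Emits d (fun g => a :: f g) :=
  Emits.append (f := fun _ => [a])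
    ⟨.emit a, 1, fun _ _ _ out => ⟨1, by simp, .emit a _⟩⟩ h

theorem emits_const (d : ℕ) (w : List Γ) : Emits d (fun _ : Regs R => w) := by
  induction w with
  | nil => exact emits_nil d
  | cons a w ih => exact ih.cons a

theorem emits_flatMap {A : Type} (d : ℕ) (l : List A) {f : A → Regs R → List Γ}
    (h : ∀ a, Emits d (f a)) : Emits d (fun g => l.flatMap fun a => f a g) := by
  induction l with
  | nil => exact emits_nil d
  | cons a l ih => exact ((h a).append ih).congr fun g => by simp

/-- Case distinction on whether the stack `r` is empty. -/
theorem Emits.ite_nil {d : ℕ} {f f' : Regs R → List Γ} (r : Fin R) (h : Emits d f)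
    (h' : Emits d f') : Emits d (fun g => if g r = [] then f g else f' g) := by
  obtain ⟨p, T, hp⟩ := h
  obtain ⟨p', T', hp'⟩ := h'
  -- Testing for emptiness pops an entry; the nonempty branch has to put it back.
  refine ⟨.case r fun o => match o with
    | none => p
    | some b => .seq (.push r b) p', 3 + T' + T, fun B g hg out => ?_⟩
  change ∃ t ≤ _, Runs _ _ t ⟨g, (if g r = [] then f g else f' g) ++ out⟩
  rcases e : g r with _ | ⟨b, l⟩
  · obtain ⟨t, ht, hr⟩ := hp B g hg out
    refine ⟨1 + t, ?_, ?_⟩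
    · simp only [Polynomial.eval_add, Polynomial.eval_ofNat]; omega
    · rw [if_pos rfl]
      exact Runs.case_nil (s := (⟨g, out⟩ : Store R Γ)) e hr
  · obtain ⟨t, ht, hr⟩ := hp' B g hg out
    refine ⟨1 + (1 + 1 + t), ?_, ?_⟩
    · simp only [Polynomial.eval_add, Polynomial.eval_ofNat]; omega
    · rw [if_neg (by simp)]
      refine Runs.case_cons (s := (⟨g, out⟩ : Store R Γ)) e (.seq (.push _ _ _) ?_)
      have : update (update g r l) r (b :: update g r l r) = g := by
        simp [← e]
      change Runs p' ⟨update (update g r l) r (b :: update g r l r), out⟩ t _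
      rw [this]
      exact hr

/-- A local variable: its value lives on the stack `d` while the body runs and is cleared
afterwards. The value can be higher than all other stacks, so the body is timed with the bound `B +
G(B)`. -/
theorem Emits.let {d : Fin R} {F : Regs R → List Bool} {f : Regs R → List Γ}
    (hF : Computes Γ d F) (hf : Emits (d.val + 1) f) :
    Emits d.val (fun g => f (update g d (F g))) := by
  obtain ⟨p, T, G, hp⟩ := hF
  obtain ⟨q, T', hq⟩ := hf
  refine ⟨.seq p (.seq q (clear d)), T + T'.comp (.X + G) + (2 * G + 3), fun B g hg out => ?_⟩
  obtain ⟨hG, hp⟩ := hp B g hg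
  obtain ⟨t, ht, hr⟩ := hp out
  obtain ⟨t', ht', hr'⟩ := hq (B + G.eval B) (update g d (F g))
    ((hg.mono (by omega)).update rfl (by omega)) out
  have h3 := runs_clear (r := d) (f (update g d (F g)) ++ out) (F g) (update g d (F g)) (by simp)
  refine ⟨_, ?_, .seq hr (.seq hr' (h3.of_eq rfl fun x => ?_))⟩
  rotate_left
  · rw [update_idem, ← hg.2 d le_rfl, update_eq_self]
  · simp only [Polynomial.eval_add, Polynomial.eval_comp, Polynomial.eval_X, Polynomial.eval_mul,
      Polynomial.eval_ofNat]
    omega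

/-- The word written by a loop over a stack, whose body gets the popped bit and the rest. -/
def loopOut (F : Bool → List Bool → List Γ) : List Bool → List Γ
  | [] => []
  | b :: l => loopOut F l ++ F b l

/-- A loop over a copy of the stack `r`. -/
theorem Emits.for {d : ℕ} (r v q : Fin R) (hv : v.val = d) (hq : q.val = d + 1) (hr : r.val < d)
    {f : Bool → Regs R → List Γ} (hf : ∀ b, Emits (d + 1) (f b)) :
    Emits d (fun g => loopOut (fun b l => f b (update g v l)) (g r)) := by
  choose p T hp using hf
  have hrv : r ≠ v := by rintro rfl; omega
  have hrq : r ≠ q := by rintro rfl; omega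
  have hvq : v ≠ q := by rintro rfl; omega
  have key : ∀ (B : ℕ) (g : Regs R) (out : List Γ), Fits d B g → ∀ l : List Bool, l.length ≤ B →
      ∃ t ≤ l.length * (1 + (T true).eval B + (T false).eval B) + 1,
        Runs (.loop v p) ⟨update g v l, out⟩ t
          ⟨g, loopOut (fun b l => f b (update g v l)) l ++ out⟩ := by
    intro B g out hg l
    induction l generalizing out with
    | nil =>
      intro _
      refine ⟨1, by simp, ?_⟩
      rw [← hg.2 v hv.ge, update_eq_self, hg.2 v hv.ge]
      exact .loop_nil (hg.2 v hv.ge)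
    | cons b l ih =>
      intro hl
      rw [List.length_cons] at hl
      obtain ⟨t, ht, h1⟩ := hp b B (update g v l) (hg.update hv (by omega)) out
      obtain ⟨t', ht', h2⟩ := ih (f b (update g v l) ++ out) (by omega)
      refine ⟨1 + t + t', ?_, ?_⟩
      · rw [List.length_cons, Nat.succ_mul]
        cases b <;> omega
      · refine .loop_cons (s' := ⟨update g v l, f b (update g v l) ++ out⟩) (b := b) (l := l)
          (by simp) ?_ ?_
        · simpa using h1
        · simpa [loopOut] using h2
  -- The stack `q` is needed for copying only and is empty again when the loop starts, so that the
  -- body may use it.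
  refine ⟨.seq (copy r v q) (.loop v p),
    (6 * .X + 4) + (.X * (1 + T true + T false) + 1), fun B g hg out => ?_⟩
  obtain ⟨t, ht, h2⟩ := key B g out hg (g r) (hg.1 r)
  have h1 := runs_copy hrv hrq hvq g (hg.2 q (by omega)) out
  rw [hg.2 v hv.ge, List.append_nil] at h1
  refine ⟨_, ?_, .seq h1 h2⟩
  simp only [Polynomial.eval_add, Polynomial.eval_X, Polynomial.eval_mul, Polynomial.eval_ofNat,
    Polynomial.eval_one]
  have := hg.1 r
  have h3 := Nat.mul_le_mul_right (1 + (T true).eval B + (T false).eval B) this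
  omega

/-! ## Programs that compute on a stack -/

theorem computes_nil (d : Fin R) : Computes Γ d fun _ => [] := by
  refine ⟨.skip, 1, 0, fun B g hg => ⟨by simp, fun out => ⟨1, by simp, ?_⟩⟩⟩
  rw [← hg.2 d le_rfl, update_eq_self]
  exact .skip _

theorem Computes.cons {d : Fin R} {F : Regs R → List Bool} (h : Computes Γ d F) (b : Bool) :
    Computes Γ d fun g => b :: F g := by
  obtain ⟨p, T, G, hp⟩ := h
  refine ⟨.seq p (.push d b), T + 2, G + 1, fun B g hg => ?_⟩
  obtain ⟨hG, hp⟩ := hp B g hg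
  refine ⟨by simpa using hG, fun out => ?_⟩
  obtain ⟨t, ht, hr⟩ := hp out
  refine ⟨1 + t + 1, ?_, .seq hr ?_⟩
  rotate_left
  · simpa using Runs.push d b (⟨update g d (F g), out⟩ : Store R Γ)
  · simp only [Polynomial.eval_add, Polynomial.eval_ofNat]; omega

theorem Computes.append {d : Fin R} {F : Regs R → List Bool} (h : Computes Γ d F) (r q : Fin R)
    (hr : r < d) (hq : d < q) : Computes Γ d fun g => g r ++ F g := by
  obtain ⟨p, T, G, hp⟩ := h
  refine ⟨.seq p (copy r d q), T + (6 * .X + 4), .X + G, fun B g hg => ?_⟩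
  obtain ⟨hG, hp⟩ := hp B g hg
  have hB := hg.1 r
  refine ⟨by simp only [List.length_append, Polynomial.eval_add, Polynomial.eval_X]; omega,
    fun out => ?_⟩
  obtain ⟨t, ht, h1⟩ := hp out
  have h2 := runs_copy hr.ne (hr.trans hq).ne hq.ne (update g d (F g))
    (by rw [update_of_ne hq.ne']; exact hg.2 q hq.le) out
  rw [update_of_ne hr.ne, update_self, update_idem] at h2
  refine ⟨_, ?_, .seq h1 h2⟩
  simp only [Polynomial.eval_add, Polynomial.eval_mul, Polynomial.eval_ofNat, Polynomial.eval_X]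
  omega

/-- Put the reversal of the stack `r` on the stack `d`. -/
theorem computes_reverse (r d q q' : Fin R) (hr : r < d) (hq : d < q) (hq' : q < q') :
    Computes Γ d fun g => (g r).reverse := by
  refine ⟨.seq (copy r q q') (.loop q fun b => .push d b), 8 * .X + 5, .X, fun B g hg =>
    ⟨by simpa using hg.1 r, fun out => ?_⟩⟩
  have h1 := runs_copy (hr.trans hq).ne (hr.trans (hq.trans hq')).ne hq'.ne g
    (hg.2 q' (hq.trans hq').le) out
  have h2 := runs_move hq.ne' out _ (update g q (g r ++ g q)) rfl
  rw [update_self, update_idem, update_of_ne hq.ne, ← hg.2 q hq.le, update_eq_self, hg.2 q hq.le,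
    hg.2 d le_rfl, List.append_nil, List.append_nil] at h2
  rw [hg.2 q hq.le, List.append_nil] at h1
  refine ⟨_, ?_, .seq h1 h2⟩
  have := hg.1 r
  simp only [Polynomial.eval_add, Polynomial.eval_mul, Polynomial.eval_ofNat, Polynomial.eval_X]
  omega

end StackProgram

namespace StackProgram

open Function

variable {R : ℕ} {Γ : Type}

/-! ## Arithmetic on stack heights -/

theorem runs_mul {r d q q' : Fin R} (hrd : r ≠ d) (hrq : r ≠ q) (hrq' : r ≠ q') (hdq : d ≠ q)
    (hdq' : d ≠ q') (hqq' : q ≠ q') (out : List Γ) : ∀ (l : List Bool) (g : Regs R), g d = l →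
      g q' = [] → Runs (.loop d fun _ => copy r q q') ⟨g, out⟩
        (l.length * (6 * (g r).length + 4) + 1)
        ⟨update (update g d []) q ((List.replicate l.length (g r)).flatten ++ g q), out⟩ := by
  intro l
  induction l with
  | nil =>
    intro g h _
    refine Runs.of_eq (.loop_nil (s := ⟨g, out⟩) h) (by simp) fun x => ?_
    simp only [update_apply]; split_ifs <;> simp_all
  | cons b l ih =>
    intro g h h'
    have h1 := runs_copy hrq hrq' hqq' (update g d l) (by simpa [hdq'.symm] using h') out
    have h2 := ih (update (update g d l) q (update g d l r ++ update g d l q))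
      (by simp [hdq]) (by simp [hqq'.symm, hdq'.symm, h'])
    have h3 := Runs.loop_cons (f := fun _ => copy r q q') (s := (⟨g, out⟩ : Store R Γ)) h h1 h2
    refine h3.of_eq (by simp [hrd, hrq]; ring) fun x => ?_
    by_cases hx : x = q
    · subst hx
      simp [hrd, hrq, hdq.symm, List.replicate_succ']
    · by_cases hx' : x = d
      · subst hx'; simp [hdq]
      · simp [hx, hx']

/-- One copy of `r` is made for each entry of `d`. The product is built on `q` and moved back to
`d`, hence the reversal, which is harmless because only heights matter. -/
theorem Computes.mul {d : Fin R} {F : Regs R → List Bool} (h : Computes Γ d F) (r q q' : Fin R)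
    (hr : r < d) (hq : d < q) (hq' : q < q') :
    Computes Γ d fun g => (List.replicate (F g).length (g r)).flatten.reverse := by
  obtain ⟨p, T, G, hp⟩ := h
  refine ⟨.seq p (.seq (.loop d fun _ => copy r q q') (.loop q fun b => .push d b)),
    T + (G * (6 * .X + 4) + (2 * (G * .X) + 5)), G * .X, fun B g hg => ?_⟩
  obtain ⟨hG, hp⟩ := hp B g hg
  have hB : (F g).length * (g r).length ≤ G.eval B * B := Nat.mul_le_mul hG (hg.1 r)
  refine ⟨by simpa using hB, fun out => ?_⟩
  obtain ⟨t, ht, h1⟩ := hp out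
  have h2 := runs_mul hr.ne (hr.trans hq).ne (hr.trans (hq.trans hq')).ne hq.ne (hq.trans hq').ne
    hq'.ne out (F g) (update g d (F g)) (by simp)
    (by rw [update_of_ne (hq.trans hq').ne']; exact hg.2 q' (hq.trans hq').le)
  have h3 := runs_move hq.ne' out _ (update (update (update g d (F g)) d []) q
    ((List.replicate (F g).length (update g d (F g) r)).flatten ++ update g d (F g) q)) rfl
  have e := hg.2 q hq.le
  refine ⟨_, ?_, .seq h1 (.seq h2 (h3.of_eq rfl fun x => ?_))⟩
  · have hB' : (F g).length * (6 * (g r).length + 4) ≤ G.eval B * (6 * B + 4) :=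
      Nat.mul_le_mul hG (by have := hg.1 r; omega)
    simp only [Polynomial.eval_add, Polynomial.eval_mul, Polynomial.eval_ofNat, Polynomial.eval_X,
      update_self, update_of_ne hq.ne', update_of_ne hr.ne, e, List.append_nil,
      List.length_flatten, List.map_replicate, List.sum_replicate, smul_eq_mul]
    omega
  · by_cases hx : x = d
    · subst hx
      simp [hq.ne, hq.ne', hr.ne, e]
    · by_cases hx' : x = q
      · subst hx'; simp [hq.ne', e]
      · simp [hx, hx']

/-- The value of a polynomial at the height of a stack can be computed in unary. -/
theorem exists_computes_eval (P : Polynomial ℕ) (r d q q' : Fin R) (hr : r < d) (hq : d < q)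
    (hq' : q < q') :
    ∃ F, Computes Γ d F ∧ ∀ g, (F g).length = P.eval (g r).length := by
  -- Horner's scheme: adding a constant means pushing that many entries, and multiplying by the
  -- variable is one call of `Computes.mul`.
  induction P using Polynomial.recOnHorner with
  | M0 => exact ⟨_, computes_nil d, by simp⟩
  | MC P a _ _ ih =>
    obtain ⟨F, hF, hl⟩ := ih
    have (k : ℕ) : ∃ F, Computes Γ d F ∧ ∀ g, (F g).length = P.eval (g r).length + k := by
      induction k with
      | zero => exact ⟨F, hF, hl⟩
      | succ k ih =>
        obtain ⟨F, hF, hl⟩ := ih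
        exact ⟨_, hF.cons true, fun g => by simp [hl, add_assoc]⟩
    simpa using this a
  | MX P _ ih =>
    obtain ⟨F, hF, hl⟩ := ih
    exact ⟨_, hF.mul r q q' hr hq hq', fun g => by simp [hl]⟩

theorem runs_pops {d q : Fin R} (hdq : d ≠ q) (out : List Γ) :
    ∀ (l : List Bool) (g : Regs R), g q = l → ∃ t ≤ 3 * l.length + 1,
      Runs (.loop q fun _ => .case d fun _ => .skip) ⟨g, out⟩ t
        ⟨update (update g q []) d ((g d).drop l.length), out⟩ := by
  intro l
  induction l with
  | nil =>
    intro g h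
    refine ⟨1, by simp, Runs.of_eq (.loop_nil (s := ⟨g, out⟩) h) rfl fun x => ?_⟩
    simp only [update_apply]; split_ifs <;> simp_all
  | cons b l ih =>
    intro g h
    have hd : update g q l d = g d := update_of_ne hdq _ _
    obtain ⟨t, ht, h1⟩ := ih (update (update g q l) d (g d).tail) (by simp [hdq.symm])
    refine ⟨1 + (1 + 1) + t, by simp; omega, ?_⟩
    refine Runs.of_eq (.loop_cons (s := ⟨g, out⟩) h ?_ h1) rfl fun x => ?_
    · rcases e : g d with _ | ⟨c, m⟩
      · refine .case_nil (hd.trans e) ?_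
        rw [List.tail_nil, ← e, ← hd, update_eq_self]
        exact .skip _
      · exact .case_cons (hd.trans e) (.skip _)
    · simp only [update_apply]; split_ifs <;> simp_all

/-- Truncated subtraction of stack heights. -/
theorem computes_drop (m l d q q' : Fin R) (hm : m < d) (hl : l < d) (hq : d < q) (hq' : q < q') :
    Computes Γ d fun g => (g m).drop (g l).length := by
  refine ⟨.seq (copy m d q) (.seq (copy l q q') (.loop q fun _ => .case d fun _ => .skip)),
    15 * .X + 9, .X, fun B g hg => ⟨?_, fun out => ?_⟩⟩
  · have := hg.1 m
    simp only [List.length_drop, Polynomial.eval_X]; omega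
  have eq : g q = [] := hg.2 q hq.le
  have h1 := runs_copy hm.ne (hm.trans hq).ne hq.ne g eq out
  rw [hg.2 d le_rfl, List.append_nil] at h1
  have h2 := runs_copy (hl.trans hq).ne (hl.trans (hq.trans hq')).ne hq'.ne (update g d (g m))
    (by rw [update_of_ne (hq.trans hq').ne']; exact hg.2 q' (hq.trans hq').le) out
  rw [update_of_ne hl.ne, update_of_ne hq.ne', eq, List.append_nil] at h2
  obtain ⟨t, ht, h3⟩ := runs_pops hq.ne out (g l) (update (update g d (g m)) q (g l)) (by simp)
  refine ⟨_, ?_, .seq h1 (.seq h2 (h3.of_eq rfl fun x => ?_))⟩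
  · have := hg.1 m
    have := hg.1 l
    simp only [Polynomial.eval_add, Polynomial.eval_mul, Polynomial.eval_ofNat, Polynomial.eval_X]
    omega
  · by_cases hx : x = d
    · subst hx; simp [hq.ne]
    · by_cases hx' : x = q
      · subst hx'; simp [hx, eq]
      · simp [hx, hx']

/-- Drop the first of each two entries of the stack `d`, using the stack `q`. -/
def half (d q : Fin R) : Prog R Γ :=
  .seq (.loop d fun _ => .case d fun o => match o with
    | none => .skip
    | some b => .push q b) (.loop q fun b => .push d b)

/-- Each round consumes two entries and keeps one, and a single last entry is lost, which gives the
rounded quotient. The entries of the result are left unspecified, as only its height is a number of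
interest. -/
theorem runs_half_aux {d q : Fin R} (hdq : d ≠ q) (out : List Γ) :
    ∀ (l : List Bool) (g : Regs R), g d = l → ∃ t ≤ 3 * l.length + 1, ∃ l' : List Bool,
      l'.length = l.length / 2 + (g q).length ∧
      Runs (.loop d fun _ => .case d fun o => match o with
        | none => .skip
        | some b => .push q b) ⟨g, out⟩ t ⟨update (update g d []) q l', out⟩
  | [], g, h => by
    refine ⟨1, by simp, g q, by simp, Runs.of_eq (.loop_nil (s := ⟨g, out⟩) h) rfl fun x => ?_⟩
    simp only [update_apply]; split_ifs <;> simp_all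
  | [a], g, h => by
    refine ⟨1 + (1 + 1) + 1, by simp, g q, by simp, Runs.of_eq (g := update g d [])
      (.loop_cons (s := ⟨g, out⟩) h (.case_nil (by simp) (.skip _)) (.loop_nil (by simp)))
        rfl fun x => ?_⟩
    simp only [update_apply]; split_ifs <;> simp_all
  | a :: b :: l, g, h => by
    obtain ⟨t, ht, l', hl', h1⟩ := runs_half_aux hdq out l
      (update (update (update g d (b :: l)) d l) q (b :: g q)) (by simp [hdq])
    refine ⟨1 + (1 + 1) + t, ?_, l', ?_, Runs.of_eq (g := update (update (update (update
      (update g d (b :: l)) d l) q (b :: g q)) d []) q l') (.loop_cons (s := ⟨g, out⟩) h (.case_cons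
      (b := b) (l := l) (by simp) (.push _ _ _)) ?_) rfl fun x => ?_⟩
    · simp only [List.length_cons]; omega
    · rw [hl']; simp; omega
    · simpa [hdq.symm] using h1
    · simp only [update_apply]; split_ifs <;> simp_all

theorem runs_half {d q : Fin R} (hdq : d ≠ q) (out : List Γ) (g : Regs R) (hq : g q = []) :
    ∃ t ≤ 5 * (g d).length + 3, ∃ l' : List Bool, l'.length = (g d).length / 2 ∧
      Runs (half d q) ⟨g, out⟩ t ⟨update g d l', out⟩ := by
  obtain ⟨t, ht, l', hl', h1⟩ := runs_half_aux hdq out _ g rfl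
  have h2 := runs_move hdq.symm out l' (update (update g d []) q l') (by simp)
  rw [hq] at hl'
  refine ⟨_, ?_, l'.reverse, ?_, .seq h1 (h2.of_eq rfl fun x => ?_)⟩
  · simp at hl'; omega
  · simpa using hl'
  · simp only [update_apply]; split_ifs <;> simp_all

/-- Iterated rounded division by two is rounded division by a power of two. Heights do not grow
under halving, so one bound `B` serves for all rounds. -/
theorem runs_halves {d q q' : Fin R} (hdq : d ≠ q) (hdq' : d ≠ q') (hqq' : q ≠ q') (B : ℕ)
    (out : List Γ) : ∀ (l : List Bool) (g : Regs R), g q = l → g q' = [] → (g d).length ≤ B →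
      ∃ t ≤ l.length * (5 * B + 4) + 1, ∃ l' : List Bool,
        l'.length = (g d).length / 2 ^ l.length ∧
        Runs (.loop q fun _ => half d q') ⟨g, out⟩ t ⟨update (update g q []) d l', out⟩ := by
  intro l
  induction l with
  | nil =>
    intro g h _ _
    refine ⟨1, by simp, g d, by simp, Runs.of_eq (.loop_nil (s := ⟨g, out⟩) h) rfl fun x => ?_⟩
    simp only [update_apply]; split_ifs <;> simp_all
  | cons b l ih =>
    intro g h h' hB
    obtain ⟨t, ht, m, hm, h1⟩ := runs_half hdq' out (update g q l) (by simp [hqq'.symm, h'])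
    rw [update_of_ne hdq] at ht hm
    obtain ⟨t', ht', m', hm', h2⟩ := ih (update (update g q l) d m) (by simp [hdq.symm])
      (by simp [hdq'.symm, hqq'.symm, h']) (by simp; omega)
    refine ⟨1 + t + t', ?_, m', ?_, Runs.of_eq (.loop_cons (s := ⟨g, out⟩) h h1 h2) rfl
      fun x => ?_⟩
    · rw [List.length_cons, Nat.succ_mul]; omega
    · rw [hm', update_self, hm, Nat.div_div_eq_div_mul, List.length_cons, pow_succ']
    · simp only [update_apply]; split_ifs <;> simp_all

/-- Entries are removed in pairs; the second removal fails only for the last entry of a stack of odd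
height. -/
theorem runs_parity {d q : Fin R} (hdq : d ≠ q) (out : List Γ) :
    ∀ (l : List Bool) (g : Regs R), g d = l → g q = [] → ∃ t ≤ 3 * l.length + 1,
      Runs (.loop d fun _ => .case d fun o => match o with
        | none => .push q true
        | some _ => .skip) ⟨g, out⟩ t
        ⟨update (update g d []) q (if l.length % 2 = 1 then [true] else []), out⟩
  | [], g, h, h' => by
    refine ⟨1, by simp, Runs.of_eq (.loop_nil (s := ⟨g, out⟩) h) rfl fun x => ?_⟩
    simp only [update_apply]; split_ifs <;> simp_all
  | [a], g, h, h' => by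
    refine ⟨1 + (1 + 1) + 1, by simp, Runs.of_eq (g := update (update g d []) q [true])
      (.loop_cons (s := ⟨g, out⟩) h (s' := ⟨update (update g d []) q [true], out⟩)
        (.case_nil (by simp) ?_) (.loop_nil (by simp [hdq])))
        rfl fun x => ?_⟩
    · have := Runs.push (Γ := Γ) q true ⟨update g d [], out⟩
      simpa [hdq.symm, h'] using this
    · simp
  | a :: b :: l, g, h, h' => by
    obtain ⟨t, ht, h1⟩ := runs_parity hdq out l (update (update g d (b :: l)) d l) (by simp)
      (by simp [hdq.symm, h'])
    refine ⟨1 + (1 + 1) + t, ?_, Runs.of_eq (.loop_cons (s := ⟨g, out⟩) h (.case_cons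
      (b := b) (l := l) (by simp) (.skip _)) h1) rfl fun x => ?_⟩
    · simp only [List.length_cons]; omega
    · have : (a :: b :: l).length % 2 = l.length % 2 := by simp only [List.length_cons]; omega
      rw [this]
      simp only [update_apply]; split_ifs <;> simp_all

/-- The binary digits of stack heights. -/
theorem computes_testBit (v m d q q' : Fin R) (hv : v < d) (hm : m < d) (hq : d < q)
    (hq' : q < q') :
    Computes Γ d fun g => if (g v).length.testBit (g m).length then [true] else [] := by
  -- The digit number `m` of `v` is the parity of `v / 2 ^ m`: halve `m` times, then take the
  -- parity, which arrives on `q` and is moved to `d`.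
  refine ⟨.seq (copy v d q) (.seq (copy m q q') (.seq (.loop q fun _ => half d q')
    (.seq (.loop d fun _ => .case d fun o => match o with
        | none => .push q true
        | some _ => .skip) (.loop q fun b => .push d b)))),
    15 * .X + .X * (5 * .X + 4) + 15, 1, fun B g hg => ⟨?_, fun out => ?_⟩⟩
  · dsimp only; split_ifs <;> simp
  have eq : g q = [] := hg.2 q hq.le
  have eq' : g q' = [] := hg.2 q' (hq.trans hq').le
  have h1 := runs_copy hv.ne (hv.trans hq).ne hq.ne g eq out
  rw [hg.2 d le_rfl, List.append_nil] at h1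
  have h2 := runs_copy (hm.trans hq).ne (hm.trans (hq.trans hq')).ne hq'.ne (update g d (g v))
    (by rw [update_of_ne (hq.trans hq').ne']; exact eq') out
  rw [update_of_ne hm.ne, update_of_ne hq.ne', eq, List.append_nil] at h2
  obtain ⟨t, ht, l, hl, h3⟩ := runs_halves hq.ne (hq.trans hq').ne hq'.ne B out (g m)
    (update (update g d (g v)) q (g m)) (by simp) (by simp [hq'.ne', (hq.trans hq').ne', eq'])
    (by simpa [hq.ne] using hg.1 v)
  simp only [update_of_ne hq.ne, update_self] at hl
  obtain ⟨t', ht', h4⟩ := runs_parity hq.ne out l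
    (update (update (update (update g d (g v)) q (g m)) q []) d l) (by simp) (by simp [hq.ne'])
  have h5 := runs_move hq.ne' out (if l.length % 2 = 1 then [true] else []) (update (update
    (update (update (update (update g d (g v)) q (g m)) q []) d l) d []) q
      (if l.length % 2 = 1 then [true] else [])) (by simp)
  refine ⟨_, ?_, .seq h1 (.seq h2 (.seq h3 (.seq h4 (h5.of_eq rfl fun x => ?_))))⟩
  · have := hg.1 v
    have := hg.1 m
    have : l.length ≤ B := by rw [hl]; exact (Nat.div_le_self _ _).trans (hg.1 v)
    have : (if l.length % 2 = 1 then [true] else []).length ≤ 1 := by split_ifs <;> simp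
    have : (g m).length * (5 * B + 4) ≤ B * (5 * B + 4) := Nat.mul_le_mul_right _ (hg.1 m)
    simp only [Polynomial.eval_add, Polynomial.eval_mul, Polynomial.eval_ofNat, Polynomial.eval_X]
    omega
  · have e : (l.length % 2 = 1) ↔ (g v).length.testBit (g m).length = true := by
      rw [Nat.testBit_eq_decide_div_mod_eq, hl]; simp
    simp only [e]
    by_cases hx : x = d
    · subst hx
      simp [hq.ne]
      split_ifs <;> simp
    · by_cases hx' : x = q
      · subst hx'; simp [hx, eq]
      · simp [hx, hx']

/-- Case distinction on a computed bit. -/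
theorem Emits.ite {d : Fin R} {P : Regs R → Prop} [DecidablePred P] {F : Regs R → List Bool}
    (hF : Computes Γ d F) (hP : ∀ g, P g ↔ F g ≠ []) {f f' : Regs R → List Γ}
    (h : Emits (d.val + 1) f) (h' : Emits (d.val + 1) f') (hf : ∀ g l, f (update g d l) = f g)
    (hf' : ∀ g l, f' (update g d l) = f' g) :
    Emits d.val fun g => if P g then f g else f' g := by
  refine (Emits.let hF (h'.ite_nil d h)).congr fun g => ?_
  simp only [update_self, hf, hf', hP]
  split_ifs <;> simp_all

end StackProgram

/-! ### From writing on the output stack to computability in polynomial time -/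

namespace StackProgram

open Function

variable {R : ℕ} {Γ : Type}

/-- A function that can be written on the output stack in polynomial time, with the input on stack
`0`, is computable in polynomial time. -/
theorem Emits.polyTime {r₀ : Fin R} (h₀ : r₀.val = 0) {f : Regs R → List Γ} (h : Emits 1 f) :
    Nonempty (Turing.TM2ComputableInPolyTime (id : List Bool → List Bool)
      (id : List Γ → List Γ) fun x => f (update (fun _ => []) r₀ x)) := by
  obtain ⟨p, T, hp⟩ := h
  refine nonempty_polyTime r₀ (.seq p (clear r₀)) _ (T + (2 * .X + 2)) fun x => ?_
  obtain ⟨t, ht, h1⟩ := hp x.length (update (fun _ => []) r₀ x) ⟨fun r => by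
      by_cases hr : r = r₀
      · subst hr; simp
      · simp [hr], fun r hr => by
      have : r ≠ r₀ := by rintro rfl; omega
      simp [this]⟩ []
  rw [List.append_nil] at h1
  have h2 := runs_clear (r := r₀) (f (update (fun _ => []) r₀ x)) x (update (fun _ => []) r₀ x)
    (by simp)
  refine ⟨_, ?_, .seq h1 (h2.of_eq rfl fun q => ?_)⟩
  · simp only [Polynomial.eval_add, Polynomial.eval_mul, Polynomial.eval_ofNat, Polynomial.eval_X]
    omega
  · simp only [update_apply]; split_ifs <;> rfl

/-- The remaining height decreases during the loop while each new word is put in front of the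
earlier ones, so the indices appear in increasing order. -/
theorem loopOut_length (f : ℕ → List Γ) (l : List Bool) :
    loopOut (fun _ m => f m.length) l = (List.range l.length).flatMap f := by
  induction l with
  | nil => rfl
  | cons b l ih => simp [loopOut, ih, List.range_succ, List.flatMap_append]

/-- In the reversed list, the number of entries after a bit is the index of that bit in the original
list. This is how a loop over the reversed input gets to know positions. -/
theorem loopOut_reverse (F : Bool → ℕ → List Γ) (l : List Bool) :
    loopOut (fun b m => F b m.length) l.reverse =
      (List.range l.length).flatMap fun i => F (l.getD i false) i := by
  induction l using List.reverseRecOn with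
  | nil => rfl
  | append_singleton l b ih =>
    rw [List.reverse_append, List.reverse_singleton, List.singleton_append, loopOut, ih,
      List.length_append, List.length_singleton, List.range_succ, List.flatMap_append]
    congr 1
    · refine List.flatMap_congr fun i hi => ?_
      rw [List.mem_range] at hi
      simp [List.getElem?_append, hi]
    · simp

/-- A loop whose body only depends on the number of remaining iterations. -/
theorem Emits.range {d : ℕ} (r v q : Fin R) {f : ℕ → Regs R → List Γ}
    (hf : Emits (d + 1) fun g => f (g v).length g)
    (hind : ∀ i g l, f i (update g v l) = f i g)
    (hv : v.val = d) (hq : q.val = d + 1) (hr : r.val < d) :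
    Emits d fun g => (List.range (g r).length).flatMap fun i => f i g := by
  refine (Emits.for r v q hv hq hr fun _ => hf).congr fun g => ?_
  simp only [update_self, hind]
  exact loopOut_length (fun i => f i g) (g r)

theorem Emits.replicate {d : ℕ} (r v q : Fin R) (a : Γ) (hv : v.val = d) (hq : q.val = d + 1)
    (hr : r.val < d) : Emits d fun g => List.replicate (g r).length a := by
  refine (Emits.range r v q (f := fun _ _ => [a]) (emits_const _ _) (by simp) hv hq hr).congr
    fun g => ?_
  simp only [List.flatMap_def, List.map_const', List.length_range, List.flatten_replicate_singleton]

end StackProgram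

/-! # Strings of formulas -/

namespace POL

namespace Strings

variable {Q : Type}

/-- Formulas as strings. -/
abbrev Str (Q : Type) : Type := List (Token Q)

/-! ## Connectives -/

def neg (a : Str Q) : Str Q := .neg :: a
def or (a b : Str Q) : Str Q := .or :: (a ++ b)
def conj (a b : Str Q) : Str Q := neg (or (neg a) (neg b))
def imp (a b : Str Q) : Str Q := or (neg a) b
def iff (a b : Str Q) : Str Q := conj (imp a b) (imp b a)
def know (ag : Agent) (a : Str Q) : Str Q := neg (.poss ag :: neg a)
def dia (e a : Str Q) : Str Q := .dia :: (e ++ a)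
def box (e a : Str Q) : Str Q := neg (dia e (neg a))
def bot : Str Q := neg [.top]
def obs (o : Str Q) : Str Q := dia (.char :: o) [.top]

/-- The contribution of a conjunct to the string of a finite conjunction. -/
def conjunct (a : Str Q) : Str Q := .neg :: .or :: .neg :: (a ++ [.neg])
-- Polish notation has no closing symbols: in a right-nested conjunction all the rest follows a
-- conjunct, so each conjunct contributes a contiguous block and the conjunction is their
-- concatenation.
def bigAnd (l : List (Str Q)) : Str Q := l.flatMap conjunct ++ [.top]
def bigOr (l : List (Str Q)) : Str Q := l.flatMap (fun a => .or :: a) ++ bot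
def union (l : List (Str Q)) : Str Q := l.flatMap (fun a => .plus :: a) ++ [.zero]
def concat (l : List (Str Q)) : Str Q := l.flatMap (fun a => .comp :: a) ++ [.epsilon]

def nec (a : Str Q) : Str Q := know .i (imp (neg [.propT]) (know .j (imp [.propT] a)))
def pos (a : Str Q) : Str Q := neg (nec (neg a))

section

variable {n : ℕ} (φ ψ : Formula Atom Agent (Obs Q n)) (π : RegularExpression (Obs Q n))

theorem enc_neg : encFormula φ.neg = neg (encFormula φ) := rfl
theorem enc_or : encFormula (φ.or ψ) = or (encFormula φ) (encFormula ψ) := rfl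
theorem enc_conj : encFormula (φ.conj ψ) = conj (encFormula φ) (encFormula ψ) := rfl
theorem enc_imp : encFormula (φ.imp ψ) = imp (encFormula φ) (encFormula ψ) := rfl
theorem enc_iff : encFormula (φ.iff ψ) = iff (encFormula φ) (encFormula ψ) := rfl
theorem enc_know (ag : Agent) : encFormula (φ.know ag) = know ag (encFormula φ) := rfl
theorem enc_dia : encFormula (φ.dia π) = dia (encExpr π) (encFormula φ) := rfl
theorem enc_box : encFormula (φ.box π) = box (encExpr π) (encFormula φ) := rfl
theorem enc_bot : encFormula (Formula.bot : Formula Atom Agent (Obs Q n)) = bot := rfl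
theorem enc_nec : encFormula (Reduction.nec φ) = nec (encFormula φ) := rfl
theorem enc_pos : encFormula (Reduction.pos φ) = pos (encFormula φ) := rfl

theorem enc_bigAnd (l : List (Formula Atom Agent (Obs Q n))) :
    encFormula (Formula.bigAnd l) = bigAnd (l.map encFormula) := by
  induction l with
  | nil => rfl
  | cons φ l ih =>
    change encFormula (Formula.conj φ (Formula.bigAnd l)) = _
    rw [enc_conj, ih]
    simp [conj, neg, or, bigAnd, conjunct]

theorem enc_bigOr (l : List (Formula Atom Agent (Obs Q n))) :
    encFormula (Formula.bigOr l) = bigOr (l.map encFormula) := by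
  induction l with
  | nil => rfl
  | cons φ l ih =>
    change encFormula (Formula.or φ (Formula.bigOr l)) = _
    rw [enc_or, ih]
    simp [or, bigOr]

theorem enc_union (l : List (RegularExpression (Obs Q n))) :
    encExpr (unionOf l) = union (l.map encExpr) := by
  induction l with
  | nil => rfl
  | cons φ l ih =>
    change encExpr (.plus φ (unionOf l)) = _
    rw [encExpr, ih]
    simp [union]

theorem enc_concat (l : List (RegularExpression (Obs Q n))) :
    encExpr (concatOf l) = concat (l.map encExpr) := by
  induction l with
  | nil => rfl
  | cons φ l ih =>
    change encExpr (.comp φ (concatOf l)) = _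
    rw [encExpr, ih]
    simp [concat]

/-- Strings of lists over finite index types as lists over ranges. -/
theorem map_finRange {A : Type} {N : ℕ} (f : Fin N → A) (F : ℕ → A)
    (h : ∀ i, f i = F i.val) : (List.finRange N).map f = (List.range N).map F := by
  rw [← List.map_coe_finRange_eq_range, List.map_map]
  exact List.map_congr_left fun i _ => h i

theorem map_filter_lt {A : Type} {N : ℕ} (l : Fin N) (f : Fin N → A) (F : ℕ → A)
    (h : ∀ i, f i = F i.val) :
    ((List.finRange N).filter (· < l)).map f = (List.range l.val).map F := by
  have h1 : f = F ∘ Fin.val := funext h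
  have h2 : (fun i : Fin N => decide (i < l)) = (fun i => decide (i < l.val)) ∘ Fin.val := by
    funext i; rfl
  rw [h1, ← List.map_map, h2, ← List.filter_map, List.map_coe_finRange_eq_range]
  have key (a k : ℕ) : (List.range (a + k)).filter (· < a) = List.range a := by
    rw [List.range_add, List.filter_append, List.filter_eq_self.2 (by simp),
      List.filter_eq_nil_iff.2 (by simp), List.append_nil]
  obtain ⟨k, hk⟩ := Nat.exists_eq_add_of_le l.2.le
  rw [← key l.val k, ← hk]

end

end Strings

end POL

namespace POL

namespace Strings

variable {Q : Type}

open Reduction (syms)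

/-! ## Programs and modalities -/

def digit (m : ℕ) : Str Q := .plus :: ((.char :: .p :: encNat m) ++ (.char :: .pbar :: encNat m))
def digits (N : ℕ) : Str Q := .star :: union ((List.range N).map digit)
def choose (n : ℕ) (k : Fin 3) : Str Q := concat ((List.range n).map fun m => digit (m + n * k.val))
def step : Str Q := [.plus, .char, .act .a, .char, .act .b]

noncomputable def anything [Fintype Q] [DecidableEq Q] (N : ℕ) : Str Q :=
  .star :: union ([[.char, .act .a], [.char, .act .b], [.char, .ex], [.char, .win]]
      ++ (List.range N).map (fun m => .char :: .p :: encNat m)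
      ++ (List.range N).map (fun m => .char :: .pbar :: encNat m)
      ++ (List.finRange 3).flatMap fun k => (syms Q).map fun α => [.char, .sym k α])

def always (a : Str Q) : Str Q := box (.star :: step) a

/-- A prefix written `k` times. -/
def prefixes (k : ℕ) (w : ℕ → Str Q) (a : Str Q) : Str Q := (List.range k).flatMap w ++ a

/-- The argument of a modality stands at the end of its string, so the modality applied to the empty
string is the prefix to be repeated. -/
def necIter (k : ℕ) (a : Str Q) : Str Q := prefixes k (fun _ => nec []) a
def posIter (k : ℕ) (a : Str Q) : Str Q := prefixes k (fun _ => pos []) a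
def knowAlt (k : ℕ) (a : Str Q) : Str Q :=
  prefixes k (fun c => if c % 2 = 1 then know .j [] else know .i []) a
def within (k : ℕ) (a : Str Q) : Str Q := bigAnd ((List.range k).map fun l => knowAlt l a)

def pr (m : ℕ) : Str Q := .propP :: encNat m
def wr (k : Fin 3) (α : CellSym Q) : Str Q := obs [.sym k α]
def obsP (m : ℕ) : Str Q := obs (.p :: encNat m)
def obsPbar (m : ℕ) : Str Q := obs (.pbar :: encNat m)

def posEq (n v : ℕ) : Str Q :=
  bigAnd ((List.range n).map fun m => if v.testBit m then pr m else neg (pr m))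
def posSame (n : ℕ) (k k' : Fin 3) : Str Q :=
  bigAnd ((List.range n).map fun m => iff (pr (m + n * k.val)) (pr (m + n * k'.val)))
-- The test for equality of indices is replaced by a second strict inequality, because both
-- comparisons can then be decided by truncated subtraction.
def posSucc (n : ℕ) (k k' : Fin 3) : Str Q :=
  bigOr ((List.range n).map fun m => bigAnd ((List.range n).map fun l =>
      if l < m then conj (pr (l + n * k.val)) (neg (pr (l + n * k'.val)))
      else if m < l then iff (pr (l + n * k.val)) (pr (l + n * k'.val))
      else conj (neg (pr (l + n * k.val))) (pr (l + n * k'.val))))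

def exactlyOne {B : Type} [DecidableEq B] (l : List B) (f : B → Str Q) : Str Q :=
  bigOr (l.map fun a => conj (f a) (bigAnd ((l.filter (· ≠ a)).map fun a' => neg (f a'))))

section

variable {n : ℕ} (φ ψ : Formula Atom Agent (Obs Q n)) (π : RegularExpression (Obs Q n))

theorem encExpr_digit (m : Fin (3 * n)) :
    encExpr (Reduction.digit m : RegularExpression (Obs Q n)) = digit m.val := rfl

theorem encExpr_digits :
    encExpr (Reduction.digits : RegularExpression (Obs Q n)) = digits (3 * n) := by
  rw [Reduction.digits, encExpr, enc_union, List.map_map, digits]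
  exact congrArg (fun l => Token.star :: union l) (map_finRange _ _ fun i => encExpr_digit i)

theorem idx_val (k : Fin 3) (m : Fin n) : (Reduction.idx k m).val = m.val + n * k.val := by
  simp [Reduction.idx, finProdFinEquiv]

theorem encExpr_choose (k : Fin 3) :
    encExpr (Reduction.choose k : RegularExpression (Obs Q n)) = choose n k := by
  rw [Reduction.choose, enc_concat, List.map_map, choose]
  refine congrArg concat (map_finRange _ _ fun i => ?_)
  rw [← idx_val]; rfl

theorem encExpr_anything [Fintype Q] [DecidableEq Q] :
    encExpr (Reduction.anything : RegularExpression (Obs Q n)) = anything (3 * n) := by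
  rw [Reduction.anything, encExpr, enc_union, anything, List.map_map]
  congr 2
  have h1 : (List.finRange (3 * n)).map (fun m => encExpr (.char (Obs.p m : Obs Q n))) =
    (List.range (3 * n)).map fun m => .char :: .p :: encNat m := map_finRange _ _ fun _ => rfl
  have h2 : (List.finRange (3 * n)).map (fun m => encExpr (.char (Obs.pbar m : Obs Q n))) =
    (List.range (3 * n)).map fun m => .char :: .pbar :: encNat m := map_finRange _ _ fun _ => rfl
  simp only [List.map_append, List.map_map, List.map_flatMap, Function.comp_def, h1, h2]
  rfl

theorem enc_always : encFormula (Reduction.always φ) = always (encFormula φ) := rfl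

theorem prefixes_succ (k : ℕ) (w : ℕ → Str Q) (a : Str Q) :
    prefixes (k + 1) w a = w 0 ++ prefixes k (fun c => w (c + 1)) a := by
  simp [prefixes, List.range_succ_eq_map, List.flatMap_map]

theorem enc_necIter (k : ℕ) : encFormula (Reduction.necIter k φ) = necIter k (encFormula φ) := by
  induction k with
  | zero => rfl
  | succ k ih =>
    rw [Reduction.necIter, Function.iterate_succ_apply', enc_nec, necIter, prefixes_succ]
    rw [Reduction.necIter] at ih
    rw [ih]; rfl

theorem enc_posIter (k : ℕ) : encFormula (Reduction.posIter k φ) = posIter k (encFormula φ) := by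
  induction k with
  | zero => rfl
  | succ k ih =>
    rw [Reduction.posIter, Function.iterate_succ_apply', enc_pos, posIter, prefixes_succ]
    rw [Reduction.posIter] at ih
    rw [ih]; rfl

theorem enc_leaves : encFormula (Reduction.leaves φ) = necIter (3 * n) (encFormula φ) :=
  enc_necIter _ _

/-- The two agents are treated together because removing the outermost modality exchanges them. -/
theorem enc_knowAlt (k : ℕ) :
    encFormula (Reduction.knowAlt .i k φ) = knowAlt k (encFormula φ) ∧
    encFormula (Reduction.knowAlt .j k φ) =
      prefixes k (fun c => if c % 2 = 1 then know .i [] else know .j []) (encFormula φ) := by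
  induction k with
  | zero => exact ⟨rfl, rfl⟩
  | succ k ih =>
    have h (c : ℕ) : (c + 1) % 2 = 1 ↔ ¬ c % 2 = 1 := by omega
    constructor
    · rw [Reduction.knowAlt, enc_know, Agent.other, ih.2, knowAlt, prefixes_succ]
      simp only [h, ite_not]
      rfl
    · rw [Reduction.knowAlt, enc_know, Agent.other, ih.1, knowAlt, prefixes_succ]
      simp only [h, ite_not]
      rfl

theorem enc_within (k : ℕ) : encFormula (Reduction.within k φ) = within k (encFormula φ) := by
  rw [Reduction.within, enc_bigAnd, List.map_map, within]
  congr 1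
  exact List.map_congr_left fun l _ => (enc_knowAlt φ l).1

theorem enc_pr (m : Fin (3 * n)) : encFormula (Reduction.pr m : Reduction.F Q n) = pr m.val := rfl

theorem enc_pr_idx (k : Fin 3) (m : Fin n) :
    encFormula (Reduction.pr (Reduction.idx k m) : Reduction.F Q n) = pr (m.val + n * k.val) := by
  rw [enc_pr, idx_val]

theorem enc_wr (k : Fin 3) (α : CellSym Q) :
    encFormula (Reduction.wr k α : Reduction.F Q n) = wr k α := rfl
theorem enc_obsP (m : Fin (3 * n)) :
    encFormula (Formula.obs (Obs.p m) : Reduction.F Q n) = obsP m.val := rfl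
theorem enc_obsPbar (m : Fin (3 * n)) :
    encFormula (Formula.obs (Obs.pbar m) : Reduction.F Q n) = obsPbar m.val := rfl

theorem enc_posEq (v : ℕ) : encFormula (Reduction.posEq 0 v : Reduction.F Q n) = posEq n v := by
  rw [Reduction.posEq, enc_bigAnd, List.map_map, posEq]
  rw [map_finRange _ (fun m => if v.testBit m then pr m else neg (pr m))]
  intro m
  have := enc_pr_idx (Q := Q) 0 m
  rw [Fin.val_zero, mul_zero, add_zero] at this
  simp only [Function.comp_apply, apply_ite encFormula, enc_neg, this]

theorem enc_posSame (k k' : Fin 3) :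
    encFormula (Reduction.posSame k k' : Reduction.F Q n) = posSame n k k' := by
  rw [Reduction.posSame, enc_bigAnd, List.map_map, posSame]
  rw [map_finRange _ (fun m => iff (pr (m + n * k.val)) (pr (m + n * k'.val)))]
  intro m
  rw [Function.comp_apply, enc_iff, enc_pr_idx, enc_pr_idx]

theorem enc_posSucc (k k' : Fin 3) :
    encFormula (Reduction.posSucc k k' : Reduction.F Q n) = posSucc n k k' := by
  rw [Reduction.posSucc, enc_bigOr, List.map_map, posSucc]
  rw [map_finRange _ (fun m => bigAnd ((List.range n).map fun l =>
      if l < m then conj (pr (l + n * k.val)) (neg (pr (l + n * k'.val)))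
      else if m < l then iff (pr (l + n * k.val)) (pr (l + n * k'.val))
      else conj (neg (pr (l + n * k.val))) (pr (l + n * k'.val))))]
  intro m
  rw [Function.comp_apply, enc_bigAnd, List.map_map]
  rw [map_finRange _ (fun l =>
      if l < m.val then conj (pr (l + n * k.val)) (neg (pr (l + n * k'.val)))
      else if m.val < l then iff (pr (l + n * k.val)) (pr (l + n * k'.val))
      else conj (neg (pr (l + n * k.val))) (pr (l + n * k'.val)))]
  intro l
  simp only [Function.comp_apply, apply_ite encFormula, enc_neg, enc_conj, enc_iff, enc_pr_idx,
    ← Fin.lt_def]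
  rcases lt_trichotomy l m with h | h | h
  · simp [h]
  · simp [h]
  · simp [h, h.not_gt, h.ne']

theorem enc_exactlyOne {B : Type} [DecidableEq B] (l : List B) (f : B → Reduction.F Q n) :
    encFormula (Reduction.exactlyOne l f) = exactlyOne l fun a => encFormula (f a) := by
  simp only [Reduction.exactlyOne, enc_bigOr, List.map_map, exactlyOne, Function.comp_def,
    enc_conj, enc_bigAnd, enc_neg]

theorem enc_bigAnd_finRange {N : ℕ} (f : Fin N → Reduction.F Q n) (F : ℕ → Str Q)
    (h : ∀ i, encFormula (f i) = F i.val) :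
    encFormula (Formula.bigAnd ((List.finRange N).map f)) = bigAnd ((List.range N).map F) := by
  rw [enc_bigAnd, List.map_map]
  exact congrArg bigAnd (map_finRange _ _ h)

end

/-! ## The conjuncts -/

def tree (N : ℕ) : Str Q :=
  always (bigAnd ((List.range N).map fun l => necIter l
    (conj (conj (pos (pr l)) (pos (neg (pr l))))
      (bigAnd ((List.range l).map fun m =>
        conj (imp (pr m) (nec (pr m))) (imp (neg (pr m)) (nec (neg (pr m)))))))))

theorem enc_tree {n : ℕ} : encFormula (Reduction.tree : Reduction.F Q n) = tree (3 * n) := by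
  rw [Reduction.tree, enc_always, tree]
  rw [enc_bigAnd_finRange _ (fun l => necIter l
    (conj (conj (pos (pr l)) (pos (neg (pr l))))
      (bigAnd ((List.range l).map fun m =>
        conj (imp (pr m) (nec (pr m))) (imp (neg (pr m)) (nec (neg (pr m))))))))]
  intro l
  rw [enc_necIter, enc_conj, enc_bigAnd, List.map_map]
  rw [map_filter_lt l _ (fun m => conj (imp (pr m) (nec (pr m)))
    (imp (neg (pr m)) (nec (neg (pr m)))))]
  · rfl
  · intro i; rfl

def digitsInner (N N2 : ℕ) : Str Q :=
  bigAnd ((List.range N).map fun m =>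
    always (within N2 (box (digits N) (conj (obsP m) (obsPbar m)))))

theorem enc_digitsInner {n : ℕ} :
    encFormula (Reduction.digitsInner : Reduction.F Q n) = digitsInner (3 * n) (6 * n) := by
  rw [Reduction.digitsInner, digitsInner]
  apply enc_bigAnd_finRange
  intro m
  rw [enc_always, enc_within, enc_box, encExpr_digits, enc_conj, enc_obsP, enc_obsPbar]

section Symbols

variable [Fintype Q] [DecidableEq Q]

noncomputable def digitsLeaf (N : ℕ) : Str Q :=
  bigAnd ((List.range N).map fun m => conj
    (always (necIter N (box (anything N)
      (iff (pr m) (conj (obsP m) (box (.char :: .pbar :: encNat m) bot))))))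
    (always (necIter N (box (anything N)
      (iff (neg (pr m)) (conj (obsPbar m) (box (.char :: .p :: encNat m) bot)))))))

theorem enc_digitsLeaf {n : ℕ} :
    encFormula (Reduction.digitsLeaf : Reduction.F Q n) = digitsLeaf (3 * n) := by
  rw [Reduction.digitsLeaf, digitsLeaf]
  apply enc_bigAnd_finRange
  intro m
  simp only [enc_always, enc_leaves, enc_box, encExpr_anything, enc_conj, enc_iff, enc_neg]
  rfl

noncomputable def uniqueSym (N : ℕ) : Str Q :=
  bigAnd ((List.finRange 3).map fun k => always (necIter N (exactlyOne (syms Q) (wr k))))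

theorem enc_uniqueSym {n : ℕ} :
    encFormula (Reduction.uniqueSym : Reduction.F Q n) = uniqueSym (3 * n) := by
  simp only [Reduction.uniqueSym, uniqueSym, enc_bigAnd, List.map_map, Function.comp_def,
    enc_always, enc_leaves, enc_exactlyOne, enc_wr]

noncomputable def stableSym (N : ℕ) : Str Q :=
  bigAnd ((List.finRange 3).map fun k => conj
    (always (necIter N (bigAnd ((syms Q).map fun α => imp (wr k α) (box (digits N) (wr k α))))))
    (always (necIter N (bigAnd ((syms Q).map fun α =>
      imp (neg (wr k α)) (box (digits N) (neg (wr k α))))))))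

theorem enc_stableSym {n : ℕ} :
    encFormula (Reduction.stableSym : Reduction.F Q n) = stableSym (3 * n) := by
  simp only [Reduction.stableSym, stableSym, enc_bigAnd, List.map_map, Function.comp_def,
    enc_always, enc_leaves, enc_wr, enc_conj, enc_imp, enc_box, encExpr_digits, enc_neg]

noncomputable def coherentSym (n N : ℕ) : Str Q :=
  bigAnd ((List.finRange 3).map fun k =>
    always (box (choose n k) (bigOr ((syms Q).map fun α => necIter N (wr k α)))))

theorem enc_coherentSym {n : ℕ} :
    encFormula (Reduction.coherentSym : Reduction.F Q n) = coherentSym n (3 * n) := by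
  simp only [Reduction.coherentSym, coherentSym, enc_bigAnd, List.map_map, Function.comp_def,
    enc_always, enc_leaves, enc_wr, enc_box, encExpr_choose, enc_bigOr]

noncomputable def sameConfig (n N : ℕ) : Str Q :=
  bigAnd (([(0, 1), (0, 2), (1, 2)] : List (Fin 3 × Fin 3)).map fun r =>
    always (necIter N (imp (posSame n r.1 r.2)
      (bigOr ((syms Q).map fun α => conj (wr r.1 α) (wr r.2 α))))))

theorem enc_sameConfig {n : ℕ} :
    encFormula (Reduction.sameConfig : Reduction.F Q n) = sameConfig n (3 * n) := by
  simp only [Reduction.sameConfig, sameConfig, enc_bigAnd, List.map_map, Function.comp_def,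
    enc_always, enc_leaves, enc_wr, enc_imp, enc_posSame, enc_bigOr, enc_conj]

end Symbols

def obsAct (d : Branch) : Str Q := obs [.act d]

def uniformTrans (N3 : ℕ) : Str Q :=
  bigAnd (([obsAct .a, neg (obsAct .a), obsAct .b, neg (obsAct .b)]).map fun ψ =>
    always (imp ψ (within N3 ψ)))

theorem enc_uniformTrans {n : ℕ} :
    encFormula (Reduction.uniformTrans : Reduction.F Q n) = uniformTrans (6 * n + 1) := by
  simp only [Reduction.uniformTrans, uniformTrans, enc_bigAnd,
    enc_always, enc_imp, enc_within, List.map_cons, List.map_nil, enc_neg]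
  rfl

/-- The string for `pos_1 = 2 ^ n - 1`. -/
def posLast (n : ℕ) : Str Q := bigAnd ((List.range n).map pr)

/-- All digits of `2 ^ n - 1` are `1`. Its unary representation would be exponentially long, so the
program has to avoid this number. -/
theorem posEq_last (n : ℕ) : (posEq n (2 ^ n - 1) : Str Q) = posLast n := by
  rw [posEq, posLast]
  congr 1
  refine List.map_congr_left fun m hm => ?_
  rw [List.mem_range] at hm
  simp [Nat.testBit_two_pow_sub_one, hm]

def endMarkers (n N : ℕ) : Str Q :=
  conj (always (necIter N (imp (posEq n 0) (wr 0 .hash))))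
    (always (necIter N (imp (posLast n) (wr 0 .hash))))

theorem enc_endMarkers {n : ℕ} :
    encFormula (Reduction.endMarkers : Reduction.F Q n) = endMarkers n (3 * n) := by
  simp only [Reduction.endMarkers, endMarkers, enc_conj, enc_always, enc_leaves, enc_imp,
    posEq_last, enc_posEq, enc_wr]

def initInput (q₀ : Q) (x : List Bool) (n N : ℕ) : Str Q :=
  necIter N (bigAnd ((List.range (max x.length 1)).map fun v =>
    imp (posEq n (v + 1)) (wr 0 (Reduction.inputSym q₀ x v))))

theorem enc_initInput {n : ℕ} (q₀ : Q) (x : List Bool) :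
    encFormula (Reduction.initInput q₀ x : Reduction.F Q n) = initInput q₀ x n (3 * n) := by
  simp only [Reduction.initInput, initInput, enc_leaves, enc_imp,
    enc_posEq, enc_wr, enc_bigAnd, List.map_map, Function.comp_def]

def initBlank (len n N : ℕ) : Str Q :=
  necIter N (imp
    (conj (bigAnd ((List.range (max len 1 + 1)).map fun v => neg (posEq n v)))
      (neg (posLast n)))
    (wr 0 (.letter .blank)))

theorem enc_initBlank {n : ℕ} (x : List Bool) :
    encFormula (Reduction.initBlank x : Reduction.F Q n) = initBlank x.length n (3 * n) := by
  simp only [Reduction.initBlank, initBlank, enc_leaves, enc_imp, enc_conj, enc_neg, posEq_last,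
    enc_posEq, enc_wr, enc_bigAnd, List.map_map, Function.comp_def]

section Machine

variable (M : ATM)

def accepted (N : ℕ) : Str M.Q := posIter N (wr 0 (.head M.qAcc .blank))
def rejected (N : ℕ) : Str M.Q := posIter N (wr 0 (.head M.qRej .blank))
def final (N : ℕ) : Str M.Q := or (accepted M N) (rejected M N)

theorem enc_accepted {n : ℕ} :
    encFormula (Reduction.accepted M : Reduction.F M.Q n) = accepted M (3 * n) := by
  rw [Reduction.accepted, enc_posIter, accepted, enc_wr]

theorem enc_rejected {n : ℕ} :
    encFormula (Reduction.rejected M : Reduction.F M.Q n) = rejected M (3 * n) := by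
  rw [Reduction.rejected, enc_posIter, rejected, enc_wr]

theorem enc_final {n : ℕ} :
    encFormula (Reduction.final M : Reduction.F M.Q n) = final M (3 * n) := by
  rw [Reduction.final, enc_or, enc_accepted, enc_rejected, final]

/-- The string for the local effect of the transitions. -/
noncomputable def succs : Str M.Q :=
  bigAnd ((syms M.Q).flatMap fun α => (syms M.Q).flatMap fun β => (syms M.Q).map fun γ =>
      imp (conj (wr 0 α) (conj (wr 1 β) (wr 2 γ)))
        (conj (dia [.char, .act .a] (wr 1 (M.succ .a α β γ)))
          (dia [.char, .act .b] (wr 1 (M.succ .b α β γ)))))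

noncomputable def transitions (n N : ℕ) : Str M.Q :=
  always (imp (neg (final M N)) (necIter N (imp (conj (posSucc n 0 1) (posSucc n 1 2)) (succs M))))

theorem enc_transitions {n : ℕ} :
    encFormula (Reduction.transitions M : Reduction.F M.Q n) = transitions M n (3 * n) := by
  simp only [Reduction.transitions, transitions, enc_always, enc_imp, enc_neg, enc_final,
    enc_leaves, enc_conj, enc_posSucc, enc_bigAnd, List.map_flatMap, List.map_map,
    Function.comp_def, enc_wr, succs, enc_dia]
  rfl

def boxStep (a : Str Q) : Str Q := box step a

theorem enc_boxStep {n : ℕ} (φ : Formula Atom Agent (Obs Q n)) :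
    encFormula (φ.box Reduction.step) = boxStep (encFormula φ) := rfl

def halted (N : ℕ) : Str M.Q := always (imp (final M N) (boxStep bot))

theorem enc_halted {n : ℕ} :
    encFormula (Reduction.halted M : Reduction.F M.Q n) = halted M (3 * n) := by
  simp only [Reduction.halted, halted, enc_always, enc_imp, enc_final, enc_boxStep, enc_bot]

def alternation : Str Q :=
  conj (always (imp (obs [.ex]) (boxStep (neg (obs [.ex])))))
    (always (imp (neg (obs [.ex])) (boxStep (obs [.ex]))))

def winning (N : ℕ) : Str M.Q :=
  bigAnd [
    always (imp (accepted M N) (obs [.win])),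
    always (imp (rejected M N) (neg (obs [.win]))),
    always (imp (conj (neg (final M N)) (neg (obs [.ex])))
      (iff (obs [.win]) (boxStep (obs [.win])))),
    always (imp (conj (neg (final M N)) (obs [.ex]))
      (iff (obs [.win]) (dia step (obs [.win]))))]

theorem enc_winning {n : ℕ} :
    encFormula (Reduction.winning M : Reduction.F M.Q n) = winning M (3 * n) := by
  simp only [Reduction.winning, winning, enc_bigAnd, List.map_cons, List.map_nil, enc_always,
    enc_imp, enc_neg, enc_final, enc_accepted, enc_rejected, enc_boxStep, enc_conj, enc_iff,
    enc_dia]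
  rfl

/-- The string of the formula for input `x` with `n` digits per position. -/
noncomputable def formula (x : List Bool) (n : ℕ) : Str M.Q :=
  bigAnd [tree (3 * n), digitsLeaf (3 * n), digitsInner (3 * n) (6 * n), uniqueSym (3 * n),
    stableSym (3 * n), coherentSym n (3 * n), sameConfig n (3 * n), uniformTrans (6 * n + 1),
    endMarkers n (3 * n), initInput M.q₀ x n (3 * n), initBlank x.length n (3 * n),
    transitions M n (3 * n), halted M (3 * n), alternation, winning M (3 * n),
    conj (obs [.win]) (obs [.ex])]

theorem enc_formula (n : ℕ) (x : List Bool) :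
    encFormula (Reduction.formula M n x) = formula M x n := by
  simp only [Reduction.formula, formula, enc_bigAnd, List.map_cons, List.map_nil, enc_tree,
    enc_digitsLeaf, enc_digitsInner, enc_uniqueSym, enc_stableSym, enc_coherentSym,
    enc_sameConfig, enc_uniformTrans, enc_endMarkers, enc_initInput, enc_initBlank,
    enc_transitions, enc_halted, enc_winning]
  rfl

end Machine

end Strings

end POL

namespace POL

namespace Strings

open StackProgram Function

open Reduction (syms)

variable {Q : Type} {R : ℕ} {d : ℕ}

/-! ## Writing the strings -/

section Connectives

variable {a b : Regs R → Str Q}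

theorem emits_neg (h : Emits d a) : Emits d fun g => neg (a g) := h.cons _

theorem emits_or (h : Emits d a) (h' : Emits d b) : Emits d fun g => or (a g) (b g) :=
  (h.append h').cons _

theorem emits_conj (h : Emits d a) (h' : Emits d b) : Emits d fun g => conj (a g) (b g) :=
  emits_neg (emits_or (emits_neg h) (emits_neg h'))

theorem emits_imp (h : Emits d a) (h' : Emits d b) : Emits d fun g => imp (a g) (b g) :=
  emits_or (emits_neg h) h'

theorem emits_iff (h : Emits d a) (h' : Emits d b) : Emits d fun g => iff (a g) (b g) :=
  emits_conj (emits_imp h h') (emits_imp h' h)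

theorem emits_know (ag : Agent) (h : Emits d a) : Emits d fun g => know ag (a g) :=
  emits_neg ((emits_neg h).cons _)

theorem emits_box (h : Emits d a) (h' : Emits d b) : Emits d fun g => box (a g) (b g) :=
  emits_neg ((h.append (emits_neg h')).cons _)

theorem emits_obs (h : Emits d a) : Emits d fun g => obs (a g) :=
  ((h.cons _).append (emits_const d _)).cons _

theorem emits_nec (h : Emits d a) : Emits d fun g => nec (a g) :=
  emits_know _ (emits_imp (emits_const d _) (emits_know _ (emits_imp (emits_const d _) h)))

theorem emits_pos (h : Emits d a) : Emits d fun g => pos (a g) :=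
  emits_neg (emits_nec (emits_neg h))

theorem emits_always (h : Emits d a) : Emits d fun g => always (a g) :=
  emits_box (emits_const d _) h

theorem emits_bigAnd_map {A : Type} (l : List A) {f : A → Regs R → Str Q}
    (h : ∀ i, Emits d (f i)) : Emits d fun g => bigAnd (l.map fun i => f i g) := by
  refine ((emits_flatMap d l fun i => ((h i).append (emits_const d [.neg])).cons .neg |>.cons .or
    |>.cons .neg).append (emits_const d [.top])).congr fun g => ?_
  simp [bigAnd, conjunct, List.flatMap_map]

theorem emits_bigOr_map {A : Type} (l : List A) {f : A → Regs R → Str Q}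
    (h : ∀ i, Emits d (f i)) : Emits d fun g => bigOr (l.map fun i => f i g) := by
  refine ((emits_flatMap d l fun i => (h i).cons .or).append (emits_const d bot)).congr fun g => ?_
  simp [bigOr, List.flatMap_map]

end Connectives

section Loops

variable (r : Fin R) {f : ℕ → Regs R → Str Q}

/-- The stack `d` is the loop counter. The body may read the index only through its first argument,
which is what makes the result independent of the counter stack outside of the loop. -/
theorem emits_bigAnd_range (hd : d + 1 < R)
    (hf : Emits (d + 1) fun g => f (g ⟨d, by omega⟩).length g)
    (hind : ∀ i g l, f i (update g ⟨d, by omega⟩ l) = f i g) (hr : r.val < d) :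
    Emits d fun g => bigAnd ((List.range (g r).length).map fun i => f i g) := by
  refine ((Emits.range r ⟨d, by omega⟩ ⟨d + 1, hd⟩ (f := fun i g => conjunct (f i g))
    ((((hf.append (emits_const _ [.neg])).cons .neg).cons .or).cons .neg) ?_ rfl rfl hr).append
    (emits_const d [.top])).congr fun g => ?_
  · intro i g l; rw [hind]
  · simp [bigAnd, List.flatMap_map]

theorem emits_bigOr_range (hd : d + 1 < R)
    (hf : Emits (d + 1) fun g => f (g ⟨d, by omega⟩).length g)
    (hind : ∀ i g l, f i (update g ⟨d, by omega⟩ l) = f i g) (hr : r.val < d) :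
    Emits d fun g => bigOr ((List.range (g r).length).map fun i => f i g) := by
  refine ((Emits.range r ⟨d, by omega⟩ ⟨d + 1, hd⟩ (f := fun i g => .or :: f i g)
    (hf.cons .or) ?_ rfl rfl hr).append (emits_const d bot)).congr fun g => ?_
  · intro i g l; rw [hind]
  · simp [bigOr, List.flatMap_map]

/-- A loop over the height of a stack, for a function that only depends on the index. -/
theorem emits_flatMap_range (w : ℕ → Str Q) (hd : d + 1 < R)
    (hw : Emits (d + 1) fun g : Regs R => w (g ⟨d, by omega⟩).length) (hr : r.val < d) :
    Emits d fun g => (List.range (g r).length).flatMap w :=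
  Emits.range r ⟨d, by omega⟩ ⟨d + 1, hd⟩ (f := fun i _ => w i) hw (fun _ _ _ => rfl) rfl rfl hr

theorem emits_prefixes (w : ℕ → Str Q) {a : Regs R → Str Q} (hd : d + 1 < R)
    (hw : Emits (d + 1) fun g : Regs R => w (g ⟨d, by omega⟩).length) (hr : r.val < d)
    (ha : Emits d a) : Emits d fun g => prefixes (g r).length w (a g) :=
  (emits_flatMap_range r w hd hw hr).append ha

theorem emits_necIter {a : Regs R → Str Q} (hd : d + 1 < R) (hr : r.val < d)
    (ha : Emits d a) : Emits d fun g => necIter (g r).length (a g) :=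
  emits_prefixes r _ hd (emits_const _ _) hr ha

theorem emits_posIter {a : Regs R → Str Q} (hd : d + 1 < R) (hr : r.val < d)
    (ha : Emits d a) : Emits d fun g => posIter (g r).length (a g) :=
  emits_prefixes r _ hd (emits_const _ _) hr ha

/-- Parity is the digit number `0`; an empty local stack provides this index. -/
theorem emits_ite_odd (hd : d + 3 < R) (hr : r.val < d) (w w' : Str Q) :
    Emits d fun g => if (g r).length % 2 = 1 then w else w' := by
  have h := Emits.ite (Γ := Token Q) (d := (⟨d + 1, by omega⟩ : Fin R))
    (computes_testBit r ⟨d, by omega⟩ ⟨d + 1, by omega⟩ ⟨d + 2, by omega⟩ ⟨d + 3, hd⟩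
      (by simp [Fin.lt_def]; omega) (by simp [Fin.lt_def]) (by simp [Fin.lt_def])
      (by simp [Fin.lt_def])) (P := fun g => (g r).length.testBit (g ⟨d, by omega⟩).length = true)
    (fun g => by simp) (emits_const _ w) (emits_const _ w') (fun _ _ => rfl) (fun _ _ => rfl)
  refine (Emits.let (computes_nil (⟨d, by omega⟩ : Fin R)) h).congr fun g => ?_
  have hrd : r ≠ ⟨d, by omega⟩ := Fin.ne_of_val_ne (show r.val ≠ d by omega)
  simp [hrd, Nat.testBit_zero]

theorem emits_within {a : Regs R → Str Q} (hd : d + 5 < R) (hr : r.val < d)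
    (ha : Emits (d + 1) a) (hind : ∀ g l, a (update g ⟨d, by omega⟩ l) = a g) :
    Emits d fun g => within (g r).length (a g) :=
  emits_bigAnd_range r (f := fun l g => knowAlt l (a g)) (by omega)
    (emits_prefixes ⟨d, by omega⟩ _ (by omega)
      (emits_ite_odd (⟨d + 1, by omega⟩ : Fin R) (by omega) (by simp) _ _) (by simp) ha)
    (fun i g l => by rw [hind]) hr

/-- The factor `k` is the number of a block and does not depend on the input, so the product is
written as `k` repetitions of the same loop. -/
theorem emits_encNat_idx (r' : Fin R) (k : ℕ) (hd : d + 1 < R) (hr : r.val < d)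
    (hr' : r'.val < d) :
    Emits d fun g => (encNat ((g r).length + (g r').length * k) : Str Q) := by
  have h (s : Fin R) (hs : s.val < d) :=
    Emits.replicate (Γ := Token Q) s ⟨d, by omega⟩ ⟨d + 1, hd⟩ .tick rfl rfl hs
  have h2 : Emits d fun g : Regs R => List.replicate ((g r').length * k) (Token.tick (Q := Q)) := by
    induction k with
    | zero => exact emits_nil d
    | succ k ih =>
      refine (ih.append (h r' hr')).congr fun g => ?_
      rw [List.replicate_append_replicate, Nat.mul_succ]
  refine (((h r hr).append h2).append (emits_const d [.endNum])).congr fun g => ?_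
  rw [encNat, List.replicate_append_replicate]

theorem emits_encNat (hd : d + 1 < R) (hr : r.val < d) :
    Emits d fun g => (encNat (g r).length : Str Q) :=
  emits_encNat_idx r r 0 hd hr hr

end Loops

section Indices

variable {m : Regs R → ℕ}
theorem emits_pr (h : Emits d fun g => (encNat (m g) : Str Q)) :
    Emits d fun g => (pr (m g) : Str Q) := h.cons _
theorem emits_obsP (h : Emits d fun g => (encNat (m g) : Str Q)) :
    Emits d fun g => (obsP (m g) : Str Q) := emits_obs (h.cons _)
theorem emits_obsPbar (h : Emits d fun g => (encNat (m g) : Str Q)) :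
    Emits d fun g => (obsPbar (m g) : Str Q) := emits_obs (h.cons _)
theorem emits_digit (h : Emits d fun g => (encNat (m g) : Str Q)) :
    Emits d fun g => (digit (m g) : Str Q) :=
  (((h.cons _).cons _).append ((h.cons _).cons _)).cons _

end Indices

section Positions

variable (n N r : Fin R)

theorem emits_digits (hd : d + 2 < R) (hr : r.val < d) :
    Emits d fun g => (digits (g r).length : Str Q) := by
  refine (((emits_flatMap_range r (fun m => .plus :: digit m) (by omega)
    ((emits_digit (emits_encNat (⟨d, by omega⟩ : Fin R) (by omega) (by simp))).cons _) hr).append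
      (emits_const d [.zero])).cons .star).congr fun g => ?_
  simp [digits, union, List.flatMap_map]

theorem emits_choose (hd : d + 2 < R) (hn : n.val < d) (k : Fin 3) :
    Emits d fun g => (choose (g n).length k : Str Q) := by
  have hnd : n ≠ ⟨d, by omega⟩ := Fin.ne_of_val_ne (show n.val ≠ d by omega)
  refine ((Emits.range n ⟨d, by omega⟩ ⟨d + 1, by omega⟩
    (f := fun m g => .comp :: digit (m + (g n).length * k.val))
    ((emits_digit (emits_encNat_idx (d := d + 1) (⟨d, by omega⟩ : Fin R) n k (by omega) (by simp)
      (by omega))).cons _) ?_ rfl rfl hn).append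
      (emits_const d [.epsilon])).congr fun g => ?_
  · intro i g l; simp [hnd]
  · simp [choose, concat, List.flatMap_map]

theorem emits_anything [Fintype Q] [DecidableEq Q] (hd : d + 2 < R) (hr : r.val < d) :
    Emits d fun g => (anything (g r).length : Str Q) := by
  have h (t : Token Q) := emits_flatMap_range r (fun m => .plus :: .char :: t :: encNat m)
    (by omega) ((((emits_encNat (⟨d, by omega⟩ : Fin R) (by omega) (by simp)).cons t).cons
      .char).cons .plus) hr
  refine ((((((emits_const d (([[.char, .act .a], [.char, .act .b], [.char, .ex],
    [.char, .win]] : List (Str Q)).flatMap fun a => .plus :: a)).append (h .p)).append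
    (h .pbar)).append (emits_const d (((List.finRange 3).flatMap fun k => (syms Q).map fun α =>
      [.char, .sym k α]).flatMap fun a => .plus :: a))).append
    (emits_const d [.zero])).cons .star).congr fun g => ?_
  simp [anything, union, List.flatMap_map]

theorem emits_posEq (v : Fin R) (hd : d + 4 < R) (hn : n.val < d) (hv : v.val < d) :
    Emits d fun g => (posEq (g n).length (g v).length : Str Q) := by
  have hvd : v ≠ ⟨d, by omega⟩ := Fin.ne_of_val_ne (show v.val ≠ d by omega)
  have hvd' : (⟨d, by omega⟩ : Fin R) ≠ ⟨d + 1, by omega⟩ := by simp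
  have hp : Emits (d + 1 + 1) fun g : Regs R => (pr (g ⟨d, by omega⟩).length : Str Q) :=
    emits_pr (emits_encNat (⟨d, by omega⟩ : Fin R) (by omega) (by simp))
  refine emits_bigAnd_range n (f := fun m g => if (g v).length.testBit m then pr m else neg (pr m))
    (by omega) ?_ (fun i g l => by simp [hvd]) hn
  refine Emits.ite (Γ := Token Q) (d := (⟨d + 1, by omega⟩ : Fin R))
    (computes_testBit v ⟨d, by omega⟩ ⟨d + 1, by omega⟩ ⟨d + 2, by omega⟩ ⟨d + 3, by omega⟩
      (by simp [Fin.lt_def]; omega) (by simp [Fin.lt_def]) (by simp [Fin.lt_def])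
      (by simp [Fin.lt_def]))
    (fun g => by simp) hp (emits_neg hp) (fun g l => by simp [hvd']) (fun g l => by simp [hvd'])

theorem emits_posLast (hd : d + 2 < R) (hn : n.val < d) :
    Emits d fun g => (posLast (g n).length : Str Q) :=
  emits_bigAnd_range n (f := fun m _ => pr m) (by omega)
    (emits_pr (emits_encNat (⟨d, by omega⟩ : Fin R) (by omega) (by simp)))
    (fun _ _ _ => rfl) hn

theorem emits_posSame (hd : d + 2 < R) (hn : n.val < d) (k k' : Fin 3) :
    Emits d fun g => (posSame (g n).length k k' : Str Q) := by
  have hnd : n ≠ ⟨d, by omega⟩ := Fin.ne_of_val_ne (show n.val ≠ d by omega)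
  have h (k : ℕ) := emits_pr (emits_encNat_idx (Q := Q) (d := d + 1) (⟨d, by omega⟩ : Fin R) n k
    (by omega) (by simp) (by omega))
  exact emits_bigAnd_range n (f := fun m g =>
    iff (pr (m + (g n).length * k.val)) (pr (m + (g n).length * k'.val))) (by omega)
    (emits_iff (h _) (h _)) (fun i g l => by simp [hnd]) hn

theorem emits_posSucc (hd : d + 6 < R) (hn : n.val < d) (k k' : Fin 3) :
    Emits d fun g => (posSucc (g n).length k k' : Str Q) := by
  have hnd : n ≠ ⟨d, by omega⟩ := Fin.ne_of_val_ne (show n.val ≠ d by omega)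
  have hnd1 : n ≠ ⟨d + 1, by omega⟩ := Fin.ne_of_val_ne (show n.val ≠ d + 1 by omega)
  have hnd2 : n ≠ ⟨d + 2, by omega⟩ := Fin.ne_of_val_ne (show n.val ≠ d + 2 by omega)
  have hnd3 : n ≠ ⟨d + 3, by omega⟩ := Fin.ne_of_val_ne (show n.val ≠ d + 3 by omega)
  have h (e k : ℕ) (he : d + 1 < e) (he' : e + 2 < R) :=
    emits_pr (emits_encNat_idx (Q := Q) (d := e) (⟨d + 1, by omega⟩ : Fin R) n k
      (by omega) (by simpa using he) (by omega))
  refine emits_bigOr_range n (f := fun m g => bigAnd ((List.range (g n).length).map fun l =>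
      if l < m then conj (pr (l + (g n).length * k.val)) (neg (pr (l + (g n).length * k'.val)))
      else if m < l then iff (pr (l + (g n).length * k.val)) (pr (l + (g n).length * k'.val))
      else conj (neg (pr (l + (g n).length * k.val))) (pr (l + (g n).length * k'.val))))
    (by omega) ?_ (fun i g l => by simp [hnd]) hn
  refine emits_bigAnd_range n (f := fun l g =>
      if l < (g ⟨d, by omega⟩).length then
        conj (pr (l + (g n).length * k.val)) (neg (pr (l + (g n).length * k'.val)))
      else if (g ⟨d, by omega⟩).length < l then
        iff (pr (l + (g n).length * k.val)) (pr (l + (g n).length * k'.val))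
      else conj (neg (pr (l + (g n).length * k.val))) (pr (l + (g n).length * k'.val)))
    (by omega) ?_ (fun i g l => by simp [hnd1]) (by omega)
  -- The stacks `d` and `d + 1` hold `m` and `l`. The truncated difference `m - l` is nonzero
  -- exactly if `l < m`; the next test uses `l - m` in the same way.
  refine Emits.ite (Γ := Token Q) (d := (⟨d + 2, by omega⟩ : Fin R))
    (computes_drop ⟨d, by omega⟩ ⟨d + 1, by omega⟩ ⟨d + 2, by omega⟩ ⟨d + 3, by omega⟩
      ⟨d + 4, by omega⟩ (by simp [Fin.lt_def]) (by simp [Fin.lt_def]) (by simp [Fin.lt_def])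
      (by simp [Fin.lt_def]))
    (fun g => by simp) (emits_conj (h _ _ (by simp) (by simp; omega))
      (emits_neg (h _ _ (by simp) (by simp; omega)))) ?_
    (fun g l => by simp [hnd2]) (fun g l => by simp [hnd2])
  refine Emits.ite (Γ := Token Q) (d := (⟨d + 3, by omega⟩ : Fin R))
    (computes_drop ⟨d + 1, by omega⟩ ⟨d, by omega⟩ ⟨d + 3, by omega⟩ ⟨d + 4, by omega⟩
      ⟨d + 5, by omega⟩ (by simp [Fin.lt_def]) (by simp [Fin.lt_def]) (by simp [Fin.lt_def])
      (by simp [Fin.lt_def]))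
    (fun g => by simp) (emits_iff (h _ _ (by simp) (by simp; omega))
      (h _ _ (by simp) (by simp; omega)))
    (emits_conj (emits_neg (h _ _ (by simp) (by simp; omega)))
      (h _ _ (by simp) (by simp; omega)))
    (fun g l => by simp [hnd3]) (fun g l => by simp [hnd3])

end Positions

end Strings

end POL

/-! ### Writing the conjuncts -/

namespace POL

namespace Strings

open StackProgram Function

open Reduction (syms)

variable {Q : Type}

section

variable {R d : ℕ}

theorem emits_bigAnd_nil : Emits d fun _ : Regs R => (bigAnd [] : Str Q) := emits_const d _

theorem emits_bigAnd_cons {a : Regs R → Str Q} {l : Regs R → List (Str Q)} (h : Emits d a)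
    (h' : Emits d fun g => bigAnd (l g)) : Emits d fun g => bigAnd (a g :: l g) := by
  refine (((((h.append (emits_const d [.neg])).cons .neg).cons .or).cons .neg).append h').congr
    fun g => ?_
  simp [bigAnd, conjunct]

variable (n N N2 : Fin R)

theorem emits_tree (hd : d + 6 < R) (hN : N.val < d) :
    Emits d fun g => (tree (g N).length : Str Q) := by
  have h (e k : ℕ) (hk : k < e) (he : e + 2 < R) :=
    emits_pr (emits_encNat (Q := Q) (d := e) (⟨k, by omega⟩ : Fin R) (by omega) (by simpa using hk))
  refine emits_always (emits_bigAnd_range N (f := fun l _ => necIter l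
    (conj (conj (pos (pr l)) (pos (neg (pr l))))
      (bigAnd ((List.range l).map fun m =>
        conj (imp (pr m) (nec (pr m))) (imp (neg (pr m)) (nec (neg (pr m)))))))) (by omega)
    (emits_necIter _ (by omega) (by simp) (emits_conj (emits_conj (emits_pos (h _ _ (by omega)
      (by omega))) (emits_pos (emits_neg (h _ _ (by omega) (by omega))))) ?_))
    (fun _ _ _ => rfl) hN)
  have h' := h (d + 1 + 1) (d + 1) (by omega) (by omega)
  exact emits_bigAnd_range (⟨d, by omega⟩ : Fin R) (f := fun m _ =>
    conj (imp (pr m) (nec (pr m))) (imp (neg (pr m)) (nec (neg (pr m))))) (by omega)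
    (emits_conj (emits_imp h' (emits_nec h')) (emits_imp (emits_neg h')
      (emits_nec (emits_neg h')))) (fun _ _ _ => rfl) (by simp)

theorem emits_digitsInner (hd : d + 8 < R) (hN : N.val < d) (hN2 : N2.val < d) :
    Emits d fun g => (digitsInner (g N).length (g N2).length : Str Q) := by
  have e : N ≠ ⟨d, by omega⟩ := Fin.ne_of_val_ne (show N.val ≠ d by omega)
  have e1 : N ≠ ⟨d + 1, by omega⟩ := Fin.ne_of_val_ne (show N.val ≠ d + 1 by omega)
  have e2 : N2 ≠ ⟨d, by omega⟩ := Fin.ne_of_val_ne (show N2.val ≠ d by omega)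
  refine emits_bigAnd_range N (f := fun m g => always (within (g N2).length
    (box (digits (g N).length) (conj (obsP m) (obsPbar m))))) (by omega)
    (emits_always (emits_within N2 (by omega) (by omega) (emits_box (emits_digits N (by omega)
      (by omega)) (emits_conj (emits_obsP ?_) (emits_obsPbar ?_))) ?_))
    (fun i g l => by simp [e, e2]) hN
  · exact emits_encNat _ (by omega) (by simp)
  · exact emits_encNat _ (by omega) (by simp)
  · intro g l; simp [e1]

section Symbols

variable [Fintype Q] [DecidableEq Q]

theorem emits_digitsLeaf (hd : d + 4 < R) (hN : N.val < d) :
    Emits d fun g => (digitsLeaf (g N).length : Str Q) := by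
  have e : N ≠ ⟨d, by omega⟩ := Fin.ne_of_val_ne (show N.val ≠ d by omega)
  have h := emits_encNat (Q := Q) (d := d + 1) (⟨d, by omega⟩ : Fin R) (by omega) (by simp)
  refine emits_bigAnd_range N (f := fun m g => conj
    (always (necIter (g N).length (box (anything (g N).length)
      (iff (pr m) (conj (obsP m) (box (.char :: .pbar :: encNat m) bot))))))
    (always (necIter (g N).length (box (anything (g N).length)
      (iff (neg (pr m)) (conj (obsPbar m) (box (.char :: .p :: encNat m) bot)))))))
    (by omega) ?_ (fun i g l => by simp [e]) hN
  refine emits_conj (emits_always (emits_necIter N (by omega) (by omega) (emits_box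
    (emits_anything N (by omega) (by omega)) (emits_iff (emits_pr h) (emits_conj (emits_obsP h)
      (emits_box ((h.cons _).cons _) (emits_const _ _)))))))
    (emits_always (emits_necIter N (by omega) (by omega) (emits_box
    (emits_anything N (by omega) (by omega)) (emits_iff (emits_neg (emits_pr h)) (emits_conj
      (emits_obsPbar h) (emits_box ((h.cons _).cons _) (emits_const _ _)))))))

theorem emits_uniqueSym (hd : d + 4 < R) (hN : N.val < d) :
    Emits d fun g => (uniqueSym (g N).length : Str Q) :=
  emits_bigAnd_map _ fun _ => emits_always (emits_necIter N (by omega) hN (emits_const _ _))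

theorem emits_stableSym (hd : d + 4 < R) (hN : N.val < d) :
    Emits d fun g => (stableSym (g N).length : Str Q) :=
  emits_bigAnd_map _ fun _ => emits_conj
    (emits_always (emits_necIter N (by omega) hN (emits_bigAnd_map _ fun _ =>
      emits_imp (emits_const _ _) (emits_box (emits_digits N (by omega) hN) (emits_const _ _)))))
    (emits_always (emits_necIter N (by omega) hN (emits_bigAnd_map _ fun _ =>
      emits_imp (emits_const _ _) (emits_box (emits_digits N (by omega) hN) (emits_const _ _)))))

theorem emits_coherentSym (hd : d + 4 < R) (hn : n.val < d) (hN : N.val < d) :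
    Emits d fun g => (coherentSym (g n).length (g N).length : Str Q) :=
  emits_bigAnd_map _ fun _ => emits_always (emits_box (emits_choose n (by omega) hn _)
    (emits_bigOr_map _ fun _ => emits_necIter N (by omega) hN (emits_const _ _)))

theorem emits_sameConfig (hd : d + 4 < R) (hn : n.val < d) (hN : N.val < d) :
    Emits d fun g => (sameConfig (g n).length (g N).length : Str Q) :=
  emits_bigAnd_map _ fun _ => emits_always (emits_necIter N (by omega) hN (emits_imp
    (emits_posSame n (by omega) hn _ _) (emits_const _ _)))

end Symbols

theorem emits_uniformTrans (hd : d + 6 < R) (hN : N.val < d) :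
    Emits d fun g => (uniformTrans (g N).length : Str Q) :=
  emits_bigAnd_map _ fun _ => emits_always (emits_imp (emits_const _ _)
    (emits_within N (by omega) hN (emits_const _ _) (fun _ _ => rfl)))

theorem emits_endMarkers (hd : d + 6 < R) (hn : n.val < d) (hN : N.val < d) :
    Emits d fun g => (endMarkers (g n).length (g N).length : Str Q) := by
  have e : n ≠ ⟨d, by omega⟩ := Fin.ne_of_val_ne (show n.val ≠ d by omega)
  refine emits_conj (emits_always (emits_necIter N (by omega) hN (emits_imp ?_ (emits_const _ _))))
    (emits_always (emits_necIter N (by omega) hN (emits_imp (emits_posLast n (by omega) hn)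
      (emits_const _ _))))
  -- The position `0` is an empty local stack.
  refine (Emits.let (computes_nil (⟨d, by omega⟩ : Fin R))
    (emits_posEq n (⟨d, by omega⟩ : Fin R) (by simp; omega) (by simp; omega) (by simp))).congr
    fun g => ?_
  simp [e]

theorem emits_initBlank (L : Fin R) (hd : d + 6 < R) (hn : n.val < d) (hN : N.val < d)
    (hL : L.val < d) :
    Emits d fun g => (necIter (g N).length (imp
      (conj (bigAnd ((List.range (g L).length).map fun v => neg (posEq (g n).length v)))
        (neg (posLast (g n).length))) (wr 0 (.letter .blank))) : Str Q) := by
  have e : n ≠ ⟨d, by omega⟩ := Fin.ne_of_val_ne (show n.val ≠ d by omega)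
  exact emits_necIter N (by omega) hN (emits_imp (emits_conj (emits_bigAnd_range L
    (f := fun v g => neg (posEq (g n).length v)) (by omega) (emits_neg (emits_posEq n _ (by omega)
      (by omega) (by simp))) (fun i g l => by simp [e]) hL) (emits_neg (emits_posLast n (by omega)
        hn))) (emits_const _ _))

section Machine

variable (M : ATM)

theorem emits_accepted (hd : d + 1 < R) (hN : N.val < d) :
    Emits d fun g => accepted M (g N).length := emits_posIter N hd hN (emits_const _ _)

theorem emits_rejected (hd : d + 1 < R) (hN : N.val < d) :
    Emits d fun g => rejected M (g N).length := emits_posIter N hd hN (emits_const _ _)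

theorem emits_final (hd : d + 1 < R) (hN : N.val < d) :
    Emits d fun g => final M (g N).length :=
  emits_or (emits_accepted N M hd hN) (emits_rejected N M hd hN)

theorem emits_transitions (hd : d + 6 < R) (hn : n.val < d) (hN : N.val < d) :
    Emits d fun g => transitions M (g n).length (g N).length :=
  emits_always (emits_imp (emits_neg (emits_final N M (by omega) hN)) (emits_necIter N (by omega) hN
    (emits_imp (emits_conj (emits_posSucc n hd hn _ _) (emits_posSucc n hd hn _ _))
      (emits_const _ _))))

theorem emits_halted (hd : d + 1 < R) (hN : N.val < d) :
    Emits d fun g => halted M (g N).length :=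
  emits_always (emits_imp (emits_final N M hd hN) (emits_const _ _))

theorem emits_winning (hd : d + 1 < R) (hN : N.val < d) :
    Emits d fun g => winning M (g N).length := by
  have h := emits_final N M hd hN
  have hc (w : Str M.Q) : Emits d fun _ : Regs R => w := emits_const d w
  exact emits_bigAnd_cons (emits_always (emits_imp (emits_accepted N M hd hN) (hc _)))
    (emits_bigAnd_cons (emits_always (emits_imp (emits_rejected N M hd hN) (hc _)))
    (emits_bigAnd_cons (emits_always (emits_imp (emits_conj (emits_neg h) (hc _)) (hc _)))
    (emits_bigAnd_cons (emits_always (emits_imp (emits_conj (emits_neg h) (hc _)) (hc _)))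
    emits_bigAnd_nil)))

end Machine

/-- The conjunct for a letter of the input, with `l` as many letters before it. -/
def inputConjunct (q₀ : Q) (n : ℕ) (b : Bool) (l : ℕ) : Str Q :=
  conjunct (imp (posEq n (l + 1))
    (wr 0 (if l = 0 then .head q₀ (.ofBool b) else .letter (.ofBool b))))

theorem emits_initInput (q₀ : Q) (r : Fin R) (hd : d + 6 < R) (hn : n.val < d) (hN : N.val < d)
    (hr : r.val < d) :
    Emits d fun g => necIter (g N).length ((if g r = [] then
        conjunct (imp (posEq (g n).length 1) (wr 0 (.head q₀ .blank)))
      else loopOut (fun b l => inputConjunct q₀ (g n).length b l.length) (g r)) ++ [.top]) := by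
  have e : n ≠ ⟨d, by omega⟩ := Fin.ne_of_val_ne (show n.val ≠ d by omega)
  have e1 : n ≠ ⟨d + 1, by omega⟩ := Fin.ne_of_val_ne (show n.val ≠ d + 1 by omega)
  refine emits_necIter N (by omega) hN (Emits.append (Emits.ite_nil r ?_ ?_) (emits_const _ _))
  · refine (((((emits_imp ?_ (emits_const _ _)).append (emits_const _ _)).cons _).cons _).cons _)
    -- A local stack with one entry is the position `1`.
    refine (Emits.let ((computes_nil (⟨d, by omega⟩ : Fin R)).cons true)
      (emits_posEq n (⟨d, by omega⟩ : Fin R) (by simp; omega) (by simp; omega) (by simp))).congr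
      fun g => ?_
    simp [e]
  · refine (Emits.for r ⟨d, by omega⟩ ⟨d + 1, by omega⟩ rfl rfl hr (f := fun b g =>
      inputConjunct q₀ (g n).length b (g ⟨d, by omega⟩).length) fun b => ?_).congr fun g => ?_
    · refine (((((emits_imp ?_ ?_).append (emits_const _ _)).cons _).cons _).cons _)
      -- The position is one more than the number of letters before the current one, because
      -- position `0` holds the end marker.
      · refine (Emits.let (((computes_nil (⟨d + 1, by omega⟩ : Fin R)).append ⟨d, by omega⟩
          ⟨d + 2, by omega⟩ (by simp [Fin.lt_def]) (by simp [Fin.lt_def])).cons true)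
          (emits_posEq n (⟨d + 1, by omega⟩ : Fin R) (by simp; omega) (by simp; omega)
            (by simp))).congr fun g => ?_
        simp [e1]
      · refine (Emits.ite_nil (⟨d, by omega⟩ : Fin R)
          (emits_const _ (wr 0 (.head q₀ (.ofBool b))))
          (emits_const _ (wr 0 (.letter (.ofBool b))))).congr fun g => ?_
        simp only [List.length_eq_zero_iff]
        split_ifs <;> rfl
    · simp [e]

/-- The empty input is a case of its own: its only conjunct concerns the blank at position `1`, and
there is no bit that a loop could pop for it. -/
theorem initInput_eq (q₀ : Q) (x : List Bool) (n N : ℕ) :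
    initInput q₀ x n N = necIter N ((if x.reverse = [] then
        conjunct (imp (posEq n 1) (wr 0 (.head q₀ .blank)))
      else loopOut (fun b l => inputConjunct q₀ n b l.length) x.reverse) ++ [.top]) := by
  rw [initInput, bigAnd, List.flatMap_map]
  congr 2
  split_ifs with h
  · rw [List.reverse_eq_nil_iff] at h
    subst h
    simp [Reduction.inputSym]
  · rw [List.reverse_eq_nil_iff] at h
    rw [loopOut_reverse (inputConjunct q₀ n) x,
      max_eq_left (show 1 ≤ x.length from List.length_pos_iff.2 h)]
    refine List.flatMap_congr fun i hi => ?_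
    rw [List.mem_range] at hi
    simp [inputConjunct, Reduction.inputSym, hi]

end

end Strings

end POL

/-! ### The reduction as a single program -/

namespace POL

namespace Strings

open StackProgram Function

/-- The stacks below `9` hold the parameters, to be filled in later: `1` the reversed input, `2` to
`5` the numbers `n`, `3 n`, `6 n`, `6 n + 1`, and `8` the number `max |x| 1 + 1`. The other stacks
are local variables; `24` is large enough for the deepest nesting. -/
theorem emits_formula (M : ATM) : Emits (R := 24) 9 fun g =>
    bigAnd [tree (g 3).length, digitsLeaf (g 3).length, digitsInner (g 3).length (g 4).length,
      uniqueSym (g 3).length, stableSym (g 3).length, coherentSym (g 2).length (g 3).length,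
      sameConfig (g 2).length (g 3).length, uniformTrans (g 5).length,
      endMarkers (g 2).length (g 3).length,
      necIter (g 3).length ((if g 1 = [] then
          conjunct (imp (posEq (g 2).length 1) (wr 0 (.head M.q₀ .blank)))
        else loopOut (fun b l => inputConjunct M.q₀ (g 2).length b l.length) (g 1)) ++ [.top]),
      necIter (g 3).length (imp
        (conj (bigAnd ((List.range (g 8).length).map fun v => neg (posEq (g 2).length v)))
          (neg (posLast (g 2).length))) (wr 0 (.letter .blank))),
      transitions M (g 2).length (g 3).length, halted M (g 3).length, alternation,
      winning M (g 3).length, conj (obs [.win]) (obs [.ex])] := by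
  have h2 : (2 : Fin 24).val < 9 := by decide
  have h3 : (3 : Fin 24).val < 9 := by decide
  exact emits_bigAnd_cons (emits_tree _ (by decide) h3) <|
    emits_bigAnd_cons (emits_digitsLeaf _ (by decide) h3) <|
    emits_bigAnd_cons (emits_digitsInner _ _ (by decide) h3 (by decide)) <|
    emits_bigAnd_cons (emits_uniqueSym _ (by decide) h3) <|
    emits_bigAnd_cons (emits_stableSym _ (by decide) h3) <|
    emits_bigAnd_cons (emits_coherentSym _ _ (by decide) h2 h3) <|
    emits_bigAnd_cons (emits_sameConfig _ _ (by decide) h2 h3) <|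
    emits_bigAnd_cons (emits_uniformTrans _ (by decide) (by decide)) <|
    emits_bigAnd_cons (emits_endMarkers _ _ (by decide) h2 h3) <|
    emits_bigAnd_cons (emits_initInput _ _ _ _ (by decide) h2 h3 (by decide)) <|
    emits_bigAnd_cons (emits_initBlank _ _ _ (by decide) h2 h3 (by decide)) <|
    emits_bigAnd_cons (emits_transitions _ _ M (by decide) h2 h3) <|
    emits_bigAnd_cons (emits_halted _ M (by decide) h3) <|
    emits_bigAnd_cons (emits_const _ _) <|
    emits_bigAnd_cons (emits_winning _ M (by decide) h3) <|
    emits_bigAnd_cons (emits_const _ _) emits_bigAnd_nil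

/-- The reduction is computable in polynomial time. -/
theorem polyTime_tr (M : ATM) (p : Polynomial ℕ) :
    Nonempty (Turing.TM2ComputableInPolyTime (id : List Bool → List Bool)
      (id : List (Token M.Q) → List (Token M.Q))
      (fun x => encFormula (Reduction.tr M p x))) := by
  have c1 : Computes (R := 24) (Token M.Q) 1 _ :=
    computes_reverse 0 1 2 3 (by decide) (by decide) (by decide)
  obtain ⟨F, c2, hF⟩ := exists_computes_eval (R := 24) (Γ := Token M.Q) p 0 2 3 4
    (by decide) (by decide) (by decide)
  have c3 : Computes (R := 24) (Token M.Q) 3 _ :=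
    (((computes_nil 3).append 2 4 (by decide) (by decide)).append 2 4 (by decide)
      (by decide)).append 2 4 (by decide) (by decide)
  have c4 : Computes (R := 24) (Token M.Q) 4 _ :=
    ((computes_nil 4).append 3 5 (by decide) (by decide)).append 3 5 (by decide) (by decide)
  have c5 : Computes (R := 24) (Token M.Q) 5 _ :=
    ((computes_nil 5).append 4 6 (by decide) (by decide)).cons true
  have c6 : Computes (R := 24) (Token M.Q) 6 _ := (computes_nil 6).cons true
  -- The truncated difference `1 - |x|` is computed because adding it to `|x|` gives the maximum of
  -- `|x|` and `1`.
  have c7 : Computes (R := 24) (Token M.Q) 7 _ :=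
    computes_drop 6 0 7 8 9 (by decide) (by decide) (by decide) (by decide)
  have c8 : Computes (R := 24) (Token M.Q) 8 _ :=
    (((computes_nil 8).append 7 9 (by decide) (by decide)).append 0 9 (by decide)
      (by decide)).cons true
  have h := Emits.polyTime (r₀ := (0 : Fin 24)) rfl <| Emits.let c1 <| Emits.let c2 <|
    Emits.let c3 <| Emits.let c4 <| Emits.let c5 <| Emits.let c6 <| Emits.let c7 <|
    Emits.let c8 (emits_formula M)
  convert! h using 2
  funext x
  rw [Reduction.tr, enc_formula, formula]
  have e2 : ((F (update (update (fun _ => []) 0 x) 1 x.reverse) : List Bool)).length =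
    p.eval x.length := by rw [hF]; rfl
  have e3 (k : ℕ) : k + (k + k) = 3 * k := by ring
  have e4 (k : ℕ) : k + (k + (k + 3 * k)) = 6 * k := by ring
  have e5 : x.length + (1 - x.length) = max x.length 1 := by omega
  simp [e2, e3, e4, e5, initInput_eq, initBlank]

end Strings

end POL

/-! # Truth after observations, without updating the model -/

namespace POL

section

variable {P Ag A : Type} {M : Model P Ag A}

/-- The word `w` can be observed at `s`. -/
def Survives (M : Model P Ag A) (w : List A) (s : M.S) : Prop :=
  ∃ u, w ++ u ∈ (M.Exp s).matches'

theorem Survives.of_append {w u : List A} {s : M.S} (h : Survives M (w ++ u) s) :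
    Survives M w s := by
  obtain ⟨v, hv⟩ := h
  exact ⟨u ++ v, by rwa [← List.append_assoc]⟩

/-- The states of the model itself (`none`) or of its update by a word. -/
def Alive (M : Model P Ag A) : Option (List A) → M.S → Prop
  | none, _ => True
  | some w, s => Survives M w s

/-- Truth in the model itself (`none`) or in its update by a word. -/
def HoldsAt (M : Model P Ag A) : Formula P Ag A → Option (List A) → M.S → Prop
  | .top, _, _ => True
  | .prop p, _, s => p ∈ M.V s
  | .or φ ψ, c, s => HoldsAt M φ c s ∨ HoldsAt M ψ c s
  | .neg φ, c, s => ¬ HoldsAt M φ c s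
  | .poss i φ, c, s => ∃ t, M.R i s t ∧ Alive M c t ∧ HoldsAt M φ c t
  | .dia π φ, c, s => ∃ w ∈ π.matches', Survives M (c.getD [] ++ w) s ∧
      HoldsAt M φ (some (c.getD [] ++ w)) s

/-- `N` is isomorphic to the update of `M` given by `c`. -/
structure Represents (M N : Model P Ag A) (c : Option (List A)) (f : N.S → M.S) : Prop where
  alive : ∀ s, Alive M c s ↔ ∃ t, f t = s
  rel : ∀ i s t, N.R i s t ↔ M.R i (f s) (f t)
  val : ∀ s, N.V s = M.V (f s)
  exp : ∀ s u, u ∈ (N.Exp s).matches' ↔ c.getD [] ++ u ∈ (M.Exp (f s)).matches'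

/-- Residuals compose: observing `w` after `v` is observing `v w`. So iterated updates of a model
are described by one word. -/
theorem Represents.update [DecidableEq A] {N : Model P Ag A} {c : Option (List A)} {f : N.S → M.S}
    (h : Represents M N c f) (w : List A) :
    Represents M (N.update w) (some (c.getD [] ++ w)) fun s => f s.1 where
  alive s := by
    constructor
    · rintro ⟨u, hu⟩
      have : Alive M c s := by
        cases c with
        | none => trivial
        | some v => exact ⟨w ++ u, by simpa using hu⟩
      obtain ⟨t, rfl⟩ := (h.alive s).1 this
      refine ⟨⟨t, u, ?_⟩, rfl⟩
      rw [mem_residual, h.exp, ← List.append_assoc]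
      exact hu
    · rintro ⟨⟨t, u, hu⟩, rfl⟩
      rw [mem_residual, h.exp, ← List.append_assoc] at hu
      exact ⟨u, hu⟩
  rel i s t := h.rel i s.1 t.1
  val s := h.val s.1
  exp s u := by
    change u ∈ (residual (N.Exp s.1) w).matches' ↔ _
    rw [mem_residual, h.exp, ← List.append_assoc]
    rfl

/-- The represented model varies in the induction because an observation leads from it to an update.
Injectivity of `f` plays no role: it suffices that `f` maps onto the surviving states and preserves
and reflects the relations. -/
theorem Represents.holds_iff [DecidableEq A] (φ : Formula P Ag A) :
    ∀ {N : Model P Ag A} {c : Option (List A)} {f : N.S → M.S}, Represents M N c f →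
      ∀ s, Holds φ N s ↔ HoldsAt M φ c (f s) := by
  induction φ with
  | top => intro N c f _ s; rfl
  | prop p => intro N c f h s; rw [Holds, HoldsAt, h.val]
  | or φ ψ ih₁ ih₂ => intro N c f h s; rw [Holds, HoldsAt, ih₁ h, ih₂ h]
  | neg φ ih => intro N c f h s; rw [Holds, HoldsAt, ih h]
  | poss i φ ih =>
    intro N c f h s
    rw [Holds, HoldsAt]
    constructor
    · rintro ⟨t, hr, ht⟩
      exact ⟨f t, (h.rel _ _ _).1 hr, (h.alive _).2 ⟨t, rfl⟩, (ih h t).1 ht⟩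
    · rintro ⟨t, hr, ha, ht⟩
      obtain ⟨t, rfl⟩ := (h.alive _).1 ha
      exact ⟨t, (h.rel _ _ _).2 hr, (ih h t).2 ht⟩
  | dia π φ ih =>
    intro N c f h s
    rw [Holds, HoldsAt]
    refine exists_congr fun w => and_congr_right fun _ => ?_
    have hs : (∃ u, u ∈ (residual (N.Exp s) w).matches') ↔ Survives M (c.getD [] ++ w) (f s) := by
      refine exists_congr fun u => ?_
      rw [mem_residual, h.exp, ← List.append_assoc]
    constructor
    · rintro ⟨h₁, h₂⟩
      exact ⟨hs.1 h₁, (ih (h.update w) ⟨s, h₁⟩).1 h₂⟩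
    · rintro ⟨h₁, h₂⟩
      exact ⟨hs.2 h₁, (ih (h.update w) ⟨s, hs.2 h₁⟩).2 h₂⟩

/-- The context is `none` rather than the empty word, since even the update by the empty word
deletes the states whose language is empty. -/
theorem holds_iff_holdsAt [DecidableEq A] (φ : Formula P Ag A) (M : Model P Ag A) (s : M.S) :
    Holds φ M s ↔ HoldsAt M φ none s :=
  Represents.holds_iff (M := M) (c := none) (f := id) φ
    { alive := fun s => ⟨fun _ => ⟨s, rfl⟩, fun _ => trivial⟩
      rel := fun _ _ _ => Iff.rfl
      val := fun _ => rfl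
      exp := fun _ _ => Iff.rfl } s

/-! ## Derived connectives -/

variable {c : Option (List A)} {s : M.S} {φ ψ : Formula P Ag A}

theorem holdsAt_neg : HoldsAt M (.neg φ) c s ↔ ¬ HoldsAt M φ c s := Iff.rfl

theorem holdsAt_or : HoldsAt M (.or φ ψ) c s ↔ HoldsAt M φ c s ∨ HoldsAt M ψ c s := Iff.rfl

theorem holdsAt_bot : ¬ HoldsAt M Formula.bot c s := fun h => h trivial

theorem holdsAt_conj : HoldsAt M (φ.conj ψ) c s ↔ HoldsAt M φ c s ∧ HoldsAt M ψ c s := by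
  simp only [Formula.conj, HoldsAt]; tauto

theorem holdsAt_imp : HoldsAt M (φ.imp ψ) c s ↔ (HoldsAt M φ c s → HoldsAt M ψ c s) := by
  simp only [Formula.imp, HoldsAt]; tauto

theorem holdsAt_iff : HoldsAt M (φ.iff ψ) c s ↔ (HoldsAt M φ c s ↔ HoldsAt M ψ c s) := by
  rw [Formula.iff, holdsAt_conj, holdsAt_imp, holdsAt_imp]; tauto

theorem holdsAt_bigAnd {l : List (Formula P Ag A)} :
    HoldsAt M (.bigAnd l) c s ↔ ∀ φ ∈ l, HoldsAt M φ c s := by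
  induction l with
  | nil => simp [Formula.bigAnd, HoldsAt]
  | cons φ l ih =>
    rw [List.forall_mem_cons, ← ih]
    exact holdsAt_conj

theorem holdsAt_bigOr {l : List (Formula P Ag A)} :
    HoldsAt M (.bigOr l) c s ↔ ∃ φ ∈ l, HoldsAt M φ c s := by
  induction l with
  | nil => simp [Formula.bigOr, holdsAt_bot]
  | cons φ l ih =>
    simp only [List.mem_cons, exists_eq_or_imp, ← ih]
    rfl

theorem holdsAt_bigAnd_map {B : Type} {l : List B} {f : B → Formula P Ag A} :
    HoldsAt M (.bigAnd (l.map f)) c s ↔ ∀ b ∈ l, HoldsAt M (f b) c s := by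
  simp [holdsAt_bigAnd]

theorem holdsAt_bigOr_map {B : Type} {l : List B} {f : B → Formula P Ag A} :
    HoldsAt M (.bigOr (l.map f)) c s ↔ ∃ b ∈ l, HoldsAt M (f b) c s := by
  simp [holdsAt_bigOr]

theorem holdsAt_know {i : Ag} : HoldsAt M (φ.know i) c s ↔
    ∀ t, M.R i s t → Alive M c t → HoldsAt M φ c t := by
  simp [Formula.know, HoldsAt]

theorem holdsAt_dia {π : RegularExpression A} : HoldsAt M (φ.dia π) c s ↔ ∃ w ∈ π.matches',
    Survives M (c.getD [] ++ w) s ∧ HoldsAt M φ (some (c.getD [] ++ w)) s := Iff.rfl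

theorem holdsAt_box {π : RegularExpression A} : HoldsAt M (φ.box π) c s ↔ ∀ w ∈ π.matches',
    Survives M (c.getD [] ++ w) s → HoldsAt M φ (some (c.getD [] ++ w)) s := by
  simp [Formula.box, HoldsAt]

theorem matches_char (o : A) (w : List A) :
    w ∈ (RegularExpression.char o).matches' ↔ w = [o] := Iff.rfl

theorem holdsAt_dia_char {o : A} : HoldsAt M (φ.dia (.char o)) c s ↔
    Survives M (c.getD [] ++ [o]) s ∧ HoldsAt M φ (some (c.getD [] ++ [o])) s := by
  simp only [holdsAt_dia, matches_char, exists_eq_left]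

theorem holdsAt_obs {o : A} : HoldsAt M (.obs o) c s ↔ Survives M (c.getD [] ++ [o]) s := by
  rw [Formula.obs, holdsAt_dia_char]
  exact and_iff_left trivial

end

/-! ## Languages of the programs -/

section Languages

variable {A : Type}

theorem mem_unionOf {l : List (RegularExpression A)} {w : List A} :
    w ∈ (unionOf l).matches' ↔ ∃ π ∈ l, w ∈ π.matches' := by
  induction l with
  | nil => simp [unionOf, RegularExpression.matches']
  | cons π l ih =>
    simp only [List.mem_cons, exists_eq_or_imp, ← ih]
    exact Language.mem_add _ _ _

theorem mem_star {π : RegularExpression A} {S : Set A}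
    (h : ∀ w, w ∈ π.matches' ↔ ∃ o ∈ S, w = [o]) (w : List A) :
    w ∈ π.star.matches' ↔ ∀ o ∈ w, o ∈ S := by
  rw [RegularExpression.matches'_star, Language.mem_kstar]
  constructor
  · rintro ⟨L, rfl, hL⟩ o ho
    obtain ⟨u, hu, ho⟩ := List.mem_flatten.1 ho
    obtain ⟨o', h', rfl⟩ := (h u).1 (hL u hu)
    rw [List.mem_singleton] at ho
    exact ho ▸ h'
  · intro hw
    refine ⟨w.map fun o => [o], by simp [← List.flatMap_def], ?_⟩
    intro u hu
    obtain ⟨o, ho, rfl⟩ := List.mem_map.1 hu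
    exact (h _).2 ⟨o, hw o ho, rfl⟩

/-- The words over a finite set of letters form a regular language. -/
theorem mem_star_unionOf_char (l : List A) (w : List A) :
    w ∈ (RegularExpression.star (unionOf (l.map .char))).matches' ↔ ∀ o ∈ w, o ∈ l := by
  refine mem_star (S := {o | o ∈ l}) (fun u => ?_) w
  simp only [mem_unionOf, List.mem_map, exists_exists_and_eq_and, matches_char]
  rfl

namespace Reduction

variable {Q : Type} {n : ℕ}

/-- The observation that a digit has a given value. -/
def bit (m : Fin (3 * n)) (b : Bool) : Obs Q n := if b then .p m else .pbar m

/-- The observations of digits. -/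
def IsDigit (o : Obs Q n) : Prop := ∃ m b, o = bit m b

theorem mem_step (w : List (Obs Q n)) :
    w ∈ (step : RegularExpression (Obs Q n)).matches' ↔ ∃ d, w = [.act d] := by
  constructor
  · rintro (h | h)
    · exact ⟨.a, h⟩
    · exact ⟨.b, h⟩
  · rintro ⟨d, rfl⟩
    cases d
    · exact Or.inl rfl
    · exact Or.inr rfl

theorem mem_star_step (w : List (Obs Q n)) :
    w ∈ (RegularExpression.star step : RegularExpression (Obs Q n)).matches' ↔
      ∃ v : List Branch, w = v.map .act := by
  rw [mem_star (S := {o | ∃ d, o = .act d}) (fun w => by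
    rw [mem_step]; exact ⟨fun ⟨d, h⟩ => ⟨_, ⟨d, rfl⟩, h⟩, fun ⟨_, ⟨d, h⟩, h'⟩ => ⟨d, h ▸ h'⟩⟩)]
  constructor
  · intro h
    choose f hf using h
    refine ⟨w.pmap f fun _ h => h, ?_⟩
    rw [List.map_pmap]
    exact (List.ext_getElem (by simp) fun i h₁ h₂ => by
      simp only [List.getElem_pmap]; exact hf _ _)
  · rintro ⟨v, rfl⟩ o ho
    obtain ⟨d, _, rfl⟩ := List.mem_map.1 ho
    exact ⟨d, rfl⟩

theorem mem_digit (m : Fin (3 * n)) (w : List (Obs Q n)) :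
    w ∈ (digit m : RegularExpression (Obs Q n)).matches' ↔ ∃ b, w = [bit m b] := by
  constructor
  · rintro (h | h)
    · exact ⟨true, h⟩
    · exact ⟨false, h⟩
  · rintro ⟨b, rfl⟩
    cases b
    · exact Or.inr rfl
    · exact Or.inl rfl

theorem mem_digits (w : List (Obs Q n)) :
    w ∈ (digits : RegularExpression (Obs Q n)).matches' ↔ ∀ o ∈ w, IsDigit o := by
  refine mem_star (S := {o | IsDigit o}) (fun u => ?_) w
  simp only [mem_unionOf, List.mem_map, List.mem_finRange, true_and, exists_exists_eq_and,
    mem_digit, Set.mem_ofPred_eq, IsDigit]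
  constructor
  · rintro ⟨m, b, rfl⟩; exact ⟨_, ⟨m, b, rfl⟩, rfl⟩
  · rintro ⟨_, ⟨m, b, rfl⟩, rfl⟩; exact ⟨m, b, rfl⟩

theorem mem_concatOf_digit {l : List (Fin (3 * n))} (w : List (Obs Q n)) :
    w ∈ (concatOf (l.map digit) : RegularExpression (Obs Q n)).matches' ↔
      ∃ f : List Bool, f.length = l.length ∧ w = List.zipWith bit l f := by
  induction l generalizing w with
  | nil =>
    constructor
    · intro h; exact ⟨[], rfl, h⟩
    · rintro ⟨f, _, rfl⟩; exact rfl
  | cons m l ih =>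
    change w ∈ (digit m).matches' * (concatOf (l.map digit)).matches' ↔ _
    rw [Language.mem_mul]
    constructor
    · rintro ⟨u, hu, v, hv, rfl⟩
      obtain ⟨b, rfl⟩ := (mem_digit _ _).1 hu
      obtain ⟨f, hf, rfl⟩ := (ih v).1 hv
      exact ⟨b :: f, by simp [hf], rfl⟩
    · rintro ⟨f, hf, rfl⟩
      cases f with
      | nil => simp at hf
      | cons b f =>
        exact ⟨[bit m b], (mem_digit _ _).2 ⟨b, rfl⟩, _, (ih _).2 ⟨f, by simpa using hf, rfl⟩, rfl⟩

theorem mem_choose (k : Fin 3) (w : List (Obs Q n)) :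
    w ∈ (choose k : RegularExpression (Obs Q n)).matches' ↔
      ∃ f : Fin n → Bool, w = (List.finRange n).map fun m => bit (idx k m) (f m) := by
  have : (choose k : RegularExpression (Obs Q n)) =
    concatOf (((List.finRange n).map (idx k)).map digit) := by
    rw [choose, List.map_map]; rfl
  rw [this, mem_concatOf_digit]
  constructor
  · rintro ⟨f, hf, rfl⟩
    simp only [List.length_map, List.length_finRange] at hf
    refine ⟨fun m => f[m.val], List.ext_getElem (by simp [hf]) fun i h₁ h₂ => by simp⟩
  · rintro ⟨f, rfl⟩
    exact ⟨(List.finRange n).map f, by simp, List.ext_getElem (by simp) fun i h₁ h₂ => by simp⟩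

theorem mem_syms [Fintype Q] [DecidableEq Q] (α : CellSym Q) : α ∈ syms Q := by simp [syms]

theorem mem_anything [Fintype Q] [DecidableEq Q] (w : List (Obs Q n)) :
    w ∈ (anything : RegularExpression (Obs Q n)).matches' := by
  rw [anything, mem_star_unionOf_char]
  intro o _
  rcases o with (_ | _) | _ | _ | ⟨k, α⟩ | _ | _ <;> simp [mem_syms]

end Reduction

end Languages

end POL

/-! # Configuration words -/

namespace ATM

variable {M : ATM}

/-- The symbol at position `v` of the configuration word of length `N`. -/
def Cfg.cell (N : ℕ) (c : M.Cfg) (v : ℕ) : CellSym M.Q :=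
  if v = 0 ∨ v + 1 = N then .hash
  else if v = c.head + 1 then .head c.state (c.tape c.head)
  else .letter (c.tape (v - 1))

/-- A transition affects only the cell under the head and its neighbours, so four cases are
compared: the cell under the head, the one to its right, the one to its left, and all others. The
bounds on the heads keep the symbols under them off the end markers. -/
theorem succ_cell {N : ℕ} {c : M.Cfg} (d : Branch) {v : ℕ} (h₀ : v ≠ 0) (hv : v + 1 < N)
    (hc : c.head + 3 ≤ N) (hc' : (c.step d).head + 3 ≤ N) :
    M.succ d (c.cell N (v - 1)) (c.cell N v) (c.cell N (v + 1)) = (c.step d).cell N v := by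
  -- From here on `v` is a cell of the tape; its position in the word is `v + 1`.
  obtain ⟨v, rfl⟩ := Nat.exists_eq_succ_of_ne_zero h₀
  have e1 : (c.cell N (v + 1)) = if v = c.head then .head c.state (c.tape c.head)
      else .letter (c.tape v) := by
    rw [Cfg.cell, if_neg (by omega)]; simp
  have e2 : ((c.step d).cell N (v + 1)) = if v = (c.step d).head
      then .head (c.step d).state ((c.step d).tape (c.step d).head)
      else .letter ((c.step d).tape v) := by
    rw [Cfg.cell, if_neg (by omega)]; simp
  have e3 : (c.cell N (v + 1 - 1)) = if v = 0 then .hash else if v = c.head + 1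
      then .head c.state (c.tape c.head) else .letter (c.tape (v - 1)) := by
    simp only [Cfg.cell, Nat.add_sub_cancel]
    have : (v = 0 ∨ v + 1 = N) ↔ v = 0 := by omega
    simp only [this]
  have e4 : (c.cell N (v + 1 + 1)) = if v + 1 + 2 = N then .hash else if v + 1 = c.head
      then .head c.state (c.tape c.head) else .letter (c.tape (v + 1)) := by
    simp [Cfg.cell]
  rw [e2, Nat.succ_eq_add_one, e3, e1, e4]
  rcases hr : M.δ d c.state (c.tape c.head) with ⟨q, l, m⟩
  simp only [Cfg.step, hr] at hc' ⊢
  obtain ⟨h', eh⟩ : ∃ h', (match m with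
    | .left => c.head - 1
    | .stay => c.head
    | .right => c.head + 1) = h' := ⟨_, rfl⟩
  by_cases hv' : v = c.head
  · subst hv'
    cases m <;> dsimp only at eh <;> subst eh
    -- A left move at the left-most cell: the left neighbour is the end marker, for which `succ`
    -- keeps the head in place, and so does truncated subtraction.
    · by_cases h0 : c.head = 0
      · rw [h0] at hr
        simp [succ, hr, h0]
      · have e : ¬ c.head = c.head - 1 := by omega
        simp [succ, hr, h0, e]
    · simp [succ, hr]
    · simp [succ, hr]
  · rw [if_neg hv', Function.update_of_ne hv']
    by_cases h1 : v = c.head + 1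
    · subst h1
      cases m <;> dsimp only at eh <;> subst eh
      · have e : ¬ c.head + 1 = c.head - 1 := by omega
        simp [succ, hr, e]
      · simp [succ, hr]
      · simp [succ, hr]
    · by_cases h2 : v + 1 = c.head
      · rw [if_neg h1, if_neg (by omega : ¬ v + 1 + 2 = N), if_pos h2]
        cases m <;> dsimp only at eh <;> subst eh
        · rw [if_pos (by omega : v = c.head - 1),
            Function.update_of_ne (by omega : c.head - 1 ≠ c.head)]
          have : c.head - 1 = v := by omega
          split_ifs <;> simp [succ, hr, this]
        · rw [if_neg hv']
          split_ifs <;> simp [succ, hr]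
        · rw [if_neg h1]
          split_ifs <;> simp [succ, hr]
      · have : ¬ v = h' := by
          cases m <;> dsimp only at eh <;> omega
        rw [if_neg h1, if_neg h2]
        cases m <;> dsimp only at eh ⊢ <;> subst eh <;> rw [if_neg this] <;>
          split_ifs <;> simp [succ]

end ATM

/-! # Binary successors -/

namespace Nat

/-- `m` is the position of the lowest digit `0` of `v`, and `w` is obtained from `v` by changing
the digits up to `m`, where only the digits below `n` are considered. -/
def IsCarry (n m v w : ℕ) : Prop :=
  ∀ l < n, if l < m then v.testBit l = true ∧ w.testBit l = false
    else if l = m then v.testBit l = false ∧ w.testBit l = true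
    else v.testBit l = w.testBit l

/-- For an even number the carry stops at digit `0`. For `2 u + 1` it stops one digit higher than
for `u`, since `2 u + 2` is twice `u + 1`. -/
theorem exists_isCarry_succ (v : ℕ) : ∃ m, ∀ n, IsCarry n m v (v + 1) := by
  induction v using Nat.strong_induction_on with
  | _ v ih =>
    rcases Nat.even_or_odd' v with ⟨u, rfl | rfl⟩
    · refine ⟨0, fun n l _ => ?_⟩
      rcases l with _ | l
      · simp [Nat.testBit_zero]
      · simp only [Nat.not_lt_zero, if_false, Nat.add_eq_zero_iff, one_ne_zero, and_false]
        rw [Nat.testBit_succ, Nat.testBit_succ]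
        congr 1; omega
    · obtain ⟨m, hm⟩ := ih u (by omega)
      refine ⟨m + 1, fun n l _ => ?_⟩
      rcases l with _ | l
      · simp [Nat.testBit_zero]; omega
      · have := hm (l + 1) l (by omega)
        rw [Nat.testBit_succ, Nat.testBit_succ, show (2 * u + 1) / 2 = u by omega,
          show (2 * u + 1 + 1) / 2 = u + 1 by omega]
        simpa using this

theorem eq_of_testBit_lt {n v w : ℕ} (hv : v < 2 ^ n) (hw : w < 2 ^ n)
    (h : ∀ l < n, v.testBit l = w.testBit l) : v = w := by
  refine Nat.eq_of_testBit_eq fun l => ?_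
  by_cases hl : l < n
  · exact h l hl
  · have : 2 ^ n ≤ 2 ^ l := Nat.pow_le_pow_right (by norm_num) (by omega)
    rw [Nat.testBit_lt_two_pow (by omega), Nat.testBit_lt_two_pow (by omega)]

/-- The digit at which the carry stops is the lowest `0` of `v`, hence determined by `v`, and it
determines all digits of `w` below `n`. There is no overflow because `2 ^ n - 1` has no digit `0`
below `n`. -/
theorem exists_isCarry_iff {n v w : ℕ} (hv : v < 2 ^ n) (hw : w < 2 ^ n) :
    (∃ m < n, IsCarry n m v w) ↔ w = v + 1 := by
  obtain ⟨m, hm⟩ := exists_isCarry_succ v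
  constructor
  · rintro ⟨k, hk, h⟩
    have hk' := h k hk
    simp only [lt_irrefl, if_false, if_true] at hk'
    have hmk : m = k := by
      rcases lt_trichotomy m k with h' | h' | h'
      · have h1 := h m (by omega)
        rw [if_pos h'] at h1
        have h2 := hm n m (by omega)
        simp [h1.1] at h2
      · exact h'
      · have h2 := hm n k hk
        rw [if_pos h', hk'.1] at h2
        simp at h2
    subst hmk
    have hlt : v + 1 < 2 ^ n := by
      by_contra hcon
      have : v = 2 ^ n - 1 := by omega
      rw [this, Nat.testBit_two_pow_sub_one] at hk'
      simp [hk] at hk'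
    refine eq_of_testBit_lt hw hlt fun l hl => ?_
    have h1 := h l hl
    have h2 := hm n l hl
    split_ifs at h1 h2
    · rw [h1.2, h2.2]
    · rw [h1.2, h2.2]
    · rw [← h1, ← h2]
  · rintro rfl
    refine ⟨m, ?_, hm n⟩
    have := hm (m + 1) m (by omega)
    simp only [lt_irrefl, if_false, if_true] at this
    by_contra hcon
    have h2 : 2 ^ n ≤ 2 ^ m := Nat.pow_le_pow_right (by norm_num) (by omega)
    rw [Nat.testBit_lt_two_pow (by omega : v + 1 < 2 ^ m)] at this
    simp at this

end Nat

/-! # Truth of the derived modalities and of the Boolean formulas on positions -/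

namespace POL.Reduction

open Formula

/-- The word of observations for a sequence of transitions. -/
def acts {Q : Type} {n : ℕ} (w : List Branch) : List (Obs Q n) := w.map .act

theorem acts_append {Q : Type} {n : ℕ} (w : List Branch) (d : Branch) :
    (acts (w ++ [d]) : List (Obs Q n)) = acts w ++ [.act d] := by simp [acts]

section Modalities

variable {Q : Type} {n : ℕ} {K : Model Atom Agent (Obs Q n)} {c : Option (List (Obs Q n))}
  {s t : K.S} {φ : F Q n}

theorem holdsAt_always : HoldsAt K (always φ) none s ↔
    ∀ v : List Branch, Survives K (acts v) s → HoldsAt K φ (some (acts v)) s := by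
  simp only [always, holdsAt_box, mem_star_step, forall_exists_index, Option.getD_none,
    List.nil_append]
  exact ⟨fun h v => h _ v rfl, fun h _ v e => e ▸ h v⟩

/-- The accessibility relation of `□`. -/
def Child (K : Model Atom Agent (Obs Q n)) (c : Option (List (Obs Q n))) (s t : K.S) : Prop :=
  ∃ m, K.R .i s m ∧ Alive K c m ∧ Atom.t ∉ K.V m ∧ K.R .j m t ∧ Alive K c t ∧ Atom.t ∈ K.V t

/-- The accessibility relation of `□^k`. -/
def Desc (K : Model Atom Agent (Obs Q n)) (c : Option (List (Obs Q n))) : ℕ → K.S → K.S → Prop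
  | 0, s, t => s = t
  | k + 1, s, t => ∃ u, Desc K c k s u ∧ Child K c u t

theorem holdsAt_nec : HoldsAt K (nec φ) c s ↔ ∀ t, Child K c s t → HoldsAt K φ c t := by
  simp only [nec, holdsAt_know, holdsAt_imp, HoldsAt]
  constructor
  · rintro h t ⟨m, h₁, h₂, h₃, h₄, h₅, h₆⟩
    exact h m h₁ h₂ h₃ t h₄ h₅ h₆
  · intro h m h₁ h₂ h₃ t h₄ h₅ h₆
    exact h t ⟨m, h₁, h₂, h₃, h₄, h₅, h₆⟩

theorem holdsAt_pos : HoldsAt K (pos φ) c s ↔ ∃ t, Child K c s t ∧ HoldsAt K φ c t := by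
  simp [pos, holdsAt_neg, holdsAt_nec]

theorem holdsAt_necIter {k : ℕ} :
    HoldsAt K (necIter k φ) c s ↔ ∀ t, Desc K c k s t → HoldsAt K φ c t := by
  induction k generalizing φ with
  | zero => simp [necIter, Desc]
  | succ k ih =>
    change HoldsAt K (necIter k (nec φ)) c s ↔ _
    simp only [ih, holdsAt_nec]
    exact ⟨fun h t ⟨u, hu, ht⟩ => h u hu t ht, fun h u hu t ht => h t ⟨u, hu, ht⟩⟩

theorem holdsAt_leaves :
    HoldsAt K (leaves φ) c s ↔ ∀ t, Desc K c (3 * n) s t → HoldsAt K φ c t :=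
  holdsAt_necIter

theorem holdsAt_posIter {k : ℕ} :
    HoldsAt K (posIter k φ) c s ↔ ∃ t, Desc K c k s t ∧ HoldsAt K φ c t := by
  induction k generalizing φ with
  | zero => simp [posIter, Desc]
  | succ k ih =>
    change HoldsAt K (posIter k (pos φ)) c s ↔ _
    simp only [ih, holdsAt_pos]
    exact ⟨fun ⟨u, hu, t, ht, h⟩ => ⟨t, ⟨u, hu, ht⟩, h⟩, fun ⟨t, ⟨u, hu, ht⟩, h⟩ => ⟨u, hu, t, ht, h⟩⟩

/-- There is a chain of `k` alternating epistemic steps, the first one for the agent `g`. -/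
def Chain (K : Model Atom Agent (Obs Q n)) (c : Option (List (Obs Q n))) (g : Agent) :
    ℕ → K.S → K.S → Prop
  | 0, s, t => s = t
  | k + 1, s, t => ∃ u, Chain K c g k s u ∧ K.R (Agent.other^[k] g) u t ∧ Alive K c t

/-- The modalities are nested from the outside, whereas chains are extended at their far end; this
splits off the innermost modality. -/
theorem knowAlt_succ (g : Agent) (k : ℕ) (φ : F Q n) :
    knowAlt g (k + 1) φ = knowAlt g k (know (Agent.other^[k] g) φ) := by
  induction k generalizing g with
  | zero => rfl
  | succ k ih => rw [knowAlt, ih]; rfl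

theorem holdsAt_knowAlt {g : Agent} {k : ℕ} :
    HoldsAt K (knowAlt g k φ) c s ↔ ∀ t, Chain K c g k s t → HoldsAt K φ c t := by
  induction k generalizing φ with
  | zero => simp [knowAlt, Chain]
  | succ k ih =>
    rw [knowAlt_succ]
    simp only [ih, holdsAt_know]
    exact ⟨fun h t ⟨u, hu, ht, ht'⟩ => h u hu t ht ht', fun h u hu t ht ht' => h t ⟨u, hu, ht, ht'⟩⟩

theorem holdsAt_within {k : ℕ} : HoldsAt K (within k φ) c s ↔
    ∀ l < k, ∀ t, Chain K c .i l s t → HoldsAt K φ c t := by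
  simp only [within, holdsAt_bigAnd_map, List.mem_range, holdsAt_knowAlt]

theorem other_iterate_even (g : Agent) (k : ℕ) : Agent.other^[2 * k] g = g := by
  rw [Function.iterate_mul]
  have : Agent.other^[2] = id := by funext g; cases g <;> rfl
  rw [this, Function.iterate_id, id]

theorem Child.chain {g : Agent} {k : ℕ} {u : K.S} (hg : Agent.other^[k] g = .i)
    (h : Child K c u t) (hu : Chain K c g k s u) : Chain K c g (k + 2) s t := by
  obtain ⟨m, h₁, h₂, -, h₄, h₅, -⟩ := h
  refine ⟨m, ⟨u, hu, hg ▸ h₁, h₂⟩, ?_, h₅⟩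
  rw [Function.iterate_succ_apply', hg]
  exact h₄

theorem Desc.chain {k : ℕ} (h : Desc K c k s t) : Chain K c .i (2 * k) s t := by
  induction k generalizing t with
  | zero => exact h
  | succ k ih =>
    obtain ⟨u, hu, ht⟩ := h
    exact ht.chain (other_iterate_even _ _) (ih hu)

theorem Desc.alive {k : ℕ} (h : Desc K c k s t) (hs : Alive K c s) : Alive K c t := by
  cases k with
  | zero => exact h ▸ hs
  | succ k => obtain ⟨u, -, m, -, -, -, -, h, -⟩ := h; exact h

theorem Chain.alive {k : ℕ} {g : Agent} (h : Chain K c g k s t) (hs : Alive K c s) :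
    Alive K c t := by
  cases k with
  | zero => exact h ▸ hs
  | succ k => obtain ⟨u, -, -, h⟩ := h; exact h

theorem Child.mono {c' : Option (List (Obs Q n))} (h : Child K c s t)
    (hm : ∀ m, K.R .i s m → Alive K c m → Alive K c' m) (ht : Alive K c t → Alive K c' t) :
    Child K c' s t := by
  obtain ⟨m, h₁, h₂, h₃, h₄, h₅, h₆⟩ := h
  exact ⟨m, h₁, hm m h₁ h₂, h₃, h₄, ht h₅, h₆⟩

/-- A descendant remains a descendant after an observation that is possible along the path. -/
theorem Desc.mono {c' : Option (List (Obs Q n))} {k : ℕ} (h : Desc K c k s t)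
    (hc : ∀ l < 2 * k, ∀ u, Chain K c .i l s u → Alive K c' u) (ht : Alive K c' t) :
    Desc K c' k s t := by
  induction k generalizing t with
  | zero => exact h
  | succ k ih =>
    obtain ⟨u, hu, hut⟩ := h
    refine ⟨u, ih hu (fun l hl => hc l (by omega)) (hc _ (by omega) _ hu.chain), hut.mono ?_ fun _ => ht⟩
    intro m hm hm'
    exact hc (2 * k + 1) (by omega) _ ⟨u, hu.chain, by rwa [other_iterate_even], hm'⟩

end Modalities

section Positions

variable {Q : Type} {n : ℕ} {K : Model Atom Agent (Obs Q n)} {c : Option (List (Obs Q n))}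
  {s : K.S} {k k' : Fin 3} {v w : ℕ}

/-- The `k`-th position of the state is `v`. -/
def HasPos (K : Model Atom Agent (Obs Q n)) (k : Fin 3) (v : ℕ) (s : K.S) : Prop :=
  ∀ m : Fin n, Atom.p (idx k m).val ∈ K.V s ↔ v.testBit m = true

theorem holdsAt_posEq : HoldsAt K (posEq k v) c s ↔ HasPos K k v s := by
  simp only [posEq, holdsAt_bigAnd_map, List.mem_finRange, true_implies, HasPos]
  refine forall_congr' fun m => ?_
  split_ifs with h <;> simp [h, pr, HoldsAt]

theorem exists_hasPos (K : Model Atom Agent (Obs Q n)) (k : Fin 3) (s : K.S) :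
    ∃ v < 2 ^ n, HasPos K k v s := by
  classical
  refine ⟨Nat.ofBits fun m : Fin n => decide (Atom.p (idx k m).val ∈ K.V s),
    Nat.ofBits_lt_two_pow _, fun m => ?_⟩
  rw [Nat.testBit_ofBits_lt _ _ m.2]
  simp

theorem HasPos.unique (h : HasPos K k v s) (h' : HasPos K k w s) (hv : v < 2 ^ n)
    (hw : w < 2 ^ n) : v = w :=
  Nat.eq_of_testBit_lt hv hw fun l hl => by
    have := (h ⟨l, hl⟩).symm.trans (h' ⟨l, hl⟩)
    exact Bool.eq_iff_iff.2 this

theorem holdsAt_posSame (h : HasPos K k v s) (h' : HasPos K k' w s) (hv : v < 2 ^ n)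
    (hw : w < 2 ^ n) : HoldsAt K (posSame k k') c s ↔ v = w := by
  simp only [posSame, holdsAt_bigAnd_map, List.mem_finRange, true_implies, holdsAt_iff, pr,
    HoldsAt, h _, h' _]
  constructor
  · exact fun hm => Nat.eq_of_testBit_lt hv hw fun l hl => Bool.eq_iff_iff.2 (hm ⟨l, hl⟩)
  · rintro rfl m
    rfl

theorem holdsAt_posSucc (h : HasPos K k v s) (h' : HasPos K k' w s) (hv : v < 2 ^ n)
    (hw : w < 2 ^ n) : HoldsAt K (posSucc k k') c s ↔ w = v + 1 := by
  rw [← Nat.exists_isCarry_iff hv hw]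
  simp only [posSucc, holdsAt_bigOr_map, List.mem_finRange, true_and, holdsAt_bigAnd_map,
    true_implies, Nat.IsCarry]
  have key : ∀ m l : Fin n, HoldsAt K (if l < m then conj (pr (idx k l)) (neg (pr (idx k' l)))
      else if l = m then conj (neg (pr (idx k l))) (pr (idx k' l))
      else Formula.iff (pr (idx k l)) (pr (idx k' l)) : F Q n) c s ↔
      if l.val < m.val then v.testBit l = true ∧ w.testBit l = false
      else if l.val = m.val then v.testBit l = false ∧ w.testBit l = true
      else v.testBit l = w.testBit l := by
    intro m l
    simp only [Fin.lt_def, Fin.ext_iff]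
    split_ifs
    · simp [holdsAt_conj, pr, HoldsAt, h l, h' l]
    · simp [holdsAt_conj, pr, HoldsAt, h l, h' l]
    · rw [holdsAt_iff, Bool.eq_iff_iff]; exact iff_congr (h l) (h' l)
  simp only [key]
  constructor
  · rintro ⟨m, hm⟩
    exact ⟨m, m.2, fun l hl => hm ⟨l, hl⟩⟩
  · rintro ⟨m, hm, hl⟩
    exact ⟨⟨m, hm⟩, fun l => hl l l.2⟩

theorem holdsAt_exactlyOne {B : Type} [DecidableEq B] {l : List B} {f : B → F Q n} :
    HoldsAt K (exactlyOne l f) c s ↔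
      ∃ a ∈ l, HoldsAt K (f a) c s ∧ ∀ a' ∈ l, a' ≠ a → ¬ HoldsAt K (f a') c s := by
  simp [exactlyOne, holdsAt_bigOr_map, holdsAt_conj, holdsAt_bigAnd_map, holdsAt_neg]

end Positions

end POL.Reduction

/-! # The meaning of the conjuncts of the reduction -/

namespace POL.Reduction

open Formula

variable {Q : Type} {n : ℕ}

/-- The word of observations of the digits of `v` in the block `k`. -/
def chooseWord (k : Fin 3) (v : ℕ) : List (Obs Q n) :=
  (List.finRange n).map fun m => bit (idx k m) (v.testBit m)

theorem mem_choose_iff (k : Fin 3) (w : List (Obs Q n)) :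
    w ∈ (choose k : RegularExpression (Obs Q n)).matches' ↔ ∃ v < 2 ^ n, w = chooseWord k v := by
  rw [mem_choose]
  constructor
  · rintro ⟨f, rfl⟩
    refine ⟨Nat.ofBits f, Nat.ofBits_lt_two_pow f, List.map_congr_left fun m _ => ?_⟩
    rw [Nat.testBit_ofBits_lt _ _ m.2]
  · rintro ⟨v, -, rfl⟩
    exact ⟨_, rfl⟩

theorem isDigit_of_mem_chooseWord {k : Fin 3} {v : ℕ} {o : Obs Q n} (h : o ∈ chooseWord k v) :
    IsDigit o := by
  obtain ⟨m, -, rfl⟩ := List.mem_map.1 h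
  exact ⟨_, _, rfl⟩

/-- After the word `w`, the observation `o` can be made at `s`. -/
abbrev CanSee (K : Model Atom Agent (Obs Q n)) (w : List (Obs Q n)) (o : Obs Q n) (s : K.S) : Prop :=
  Survives K (w ++ [o]) s

/-- The state `t` is a leaf of the tree with root `s`, after the transitions `w`. -/
def Leaf (K : Model Atom Agent (Obs Q n)) (s : K.S) (w : List Branch) (t : K.S) : Prop :=
  Desc K (some (acts w)) (3 * n) s t

variable {K : Model Atom Agent (Obs Q n)} {s : K.S}

theorem holdsAt_always_leaves {φ : F Q n} : HoldsAt K (always (leaves φ)) none s ↔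
    ∀ w, Survives K (acts w) s → ∀ t, Leaf K s w t → HoldsAt K φ (some (acts w)) t := by
  simp only [holdsAt_always, holdsAt_leaves, Leaf]

theorem holdsAt_box_step {c : Option (List (Obs Q n))} {φ : F Q n} :
    HoldsAt K (box step φ) c s ↔ ∀ d, CanSee K (c.getD []) (.act d) s →
      HoldsAt K φ (some (c.getD [] ++ [.act d])) s := by
  simp only [holdsAt_box, mem_step]
  exact ⟨fun h d => h _ ⟨d, rfl⟩, fun h _ ⟨d, e⟩ => e ▸ h d⟩

theorem holdsAt_dia_step {c : Option (List (Obs Q n))} {φ : F Q n} :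
    HoldsAt K (dia step φ) c s ↔ ∃ d, CanSee K (c.getD []) (.act d) s ∧
      HoldsAt K φ (some (c.getD [] ++ [.act d])) s := by
  simp only [holdsAt_dia, mem_step]
  constructor
  · rintro ⟨_, ⟨d, rfl⟩, h⟩
    exact ⟨d, h⟩
  · rintro ⟨d, h⟩
    exact ⟨_, ⟨d, rfl⟩, h⟩

theorem holdsAt_wr {c : Option (List (Obs Q n))} {k : Fin 3} {α : CellSym Q} :
    HoldsAt K (wr k α) c s ↔ CanSee K (c.getD []) (.sym k α) s := holdsAt_obs

theorem holdsAt_tree : HoldsAt K tree none s ↔ ∀ w, Survives K (acts w) s → ∀ l : Fin (3 * n),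
    ∀ u, Desc K (some (acts w)) l s u →
      (∀ b, ∃ t, Child K (some (acts w)) u t ∧ (.p l ∈ K.V t ↔ b = true)) ∧
      ∀ m < l, ∀ t, Child K (some (acts w)) u t → (.p m ∈ K.V u ↔ .p m ∈ K.V t) := by
  simp only [tree, holdsAt_always, holdsAt_bigAnd_map, List.mem_finRange, true_implies,
    holdsAt_necIter, holdsAt_conj, holdsAt_pos, List.mem_filter, true_and, decide_eq_true_eq,
    holdsAt_imp, holdsAt_nec, pr, HoldsAt, Bool.forall_bool, Bool.false_eq_true, iff_false,
    iff_true]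
  refine forall₅_congr fun w _ l u _ => and_congr and_comm (forall₂_congr fun m _ => ?_)
  constructor
  · rintro ⟨h₁, h₂⟩ t ht
    exact ⟨fun h => h₁ h t ht, fun h => by_contra fun h' => h₂ h' t ht h⟩
  · intro h
    exact ⟨fun h₁ t ht => (h t ht).1 h₁, fun h₁ t ht h₂ => h₁ ((h t ht).2 h₂)⟩

/-- In this form the conjunct says that a leaf can follow a word of digits exactly as long as the
digits agree with its valuation. This is how observations select leaves by position. -/
theorem holdsAt_digitsLeaf [Fintype Q] [DecidableEq Q] : HoldsAt K digitsLeaf none s ↔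
    ∀ w, Survives K (acts w) s → ∀ t, Leaf K s w t → ∀ z, Survives K (acts w ++ z) t →
      ∀ m b, CanSee K (acts w ++ z) (bit m b) t ↔ (.p m.val ∈ K.V t ↔ b = true) := by
  simp only [digitsLeaf, holdsAt_bigAnd_map, List.mem_finRange, true_implies, holdsAt_conj,
    holdsAt_always_leaves, holdsAt_box, mem_anything, holdsAt_iff, holdsAt_obs,
    matches_char, forall_eq, holdsAt_bot, imp_false, Option.getD_some, pr, HoldsAt]
  constructor
  · intro h w hw t ht z hz m b
    have h₁ := (h m).1 w hw t ht z hz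
    have h₂ := (h m).2 w hw t ht z hz
    cases b <;> simp only [bit, Bool.false_eq_true, if_true, if_false, iff_false, iff_true] <;> tauto
  · intro h m
    constructor <;> intro w hw t ht z hz <;>
    · have h₁ := h w hw t ht z hz m true
      have h₂ := h w hw t ht z hz m false
      simp only [bit, Bool.false_eq_true, if_true, if_false, iff_false, iff_true] at h₁ h₂
      tauto

theorem holdsAt_digitsInner : HoldsAt K digitsInner none s ↔
    ∀ w, Survives K (acts w) s → ∀ l < 6 * n, ∀ t, Chain K (some (acts w)) .i l s t →
      ∀ z, (∀ o ∈ z, IsDigit o) → Survives K (acts w ++ z) t →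
      ∀ m b, CanSee K (acts w ++ z) (bit m b) t := by
  simp only [digitsInner, holdsAt_bigAnd_map, List.mem_finRange, true_implies, holdsAt_always,
    holdsAt_within, holdsAt_box, mem_digits, holdsAt_conj, holdsAt_obs, Option.getD_some,
    Bool.forall_bool]
  constructor
  · intro h w hw l hl t ht z hz hz' m
    exact (h m w hw l hl t ht z hz hz').symm
  · intro h m w hw l hl t ht z hz hz'
    exact (h w hw l hl t ht z hz hz' m).symm

theorem holdsAt_uniqueSym [Fintype Q] [DecidableEq Q] : HoldsAt K uniqueSym none s ↔
    ∀ w, Survives K (acts w) s → ∀ t, Leaf K s w t → ∀ k,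
      ∃! α, CanSee K (acts w) (.sym k α) t := by
  simp only [uniqueSym, holdsAt_bigAnd_map, List.mem_finRange, true_implies,
    holdsAt_always_leaves, holdsAt_exactlyOne, mem_syms, true_and, holdsAt_wr, Option.getD_some,
    ExistsUnique]
  constructor
  · intro h w hw t ht k
    obtain ⟨α, h₁, h₂⟩ := h k w hw t ht
    exact ⟨α, h₁, fun β hβ => by_contra fun hne => h₂ β hne hβ⟩
  · intro h k w hw t ht
    obtain ⟨α, h₁, h₂⟩ := h w hw t ht k
    exact ⟨α, h₁, fun β hne hβ => hne (h₂ β hβ)⟩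

theorem holdsAt_stableSym [Fintype Q] [DecidableEq Q] : HoldsAt K stableSym none s ↔
    ∀ w, Survives K (acts w) s → ∀ t, Leaf K s w t → ∀ k α z, (∀ o ∈ z, IsDigit o) →
      Survives K (acts w ++ z) t →
      (CanSee K (acts w) (.sym k α) t ↔ CanSee K (acts w ++ z) (.sym k α) t) := by
  simp only [stableSym, holdsAt_bigAnd_map, List.mem_finRange, true_implies,
    holdsAt_always_leaves, holdsAt_conj, mem_syms, holdsAt_imp, holdsAt_neg, holdsAt_box,
    mem_digits, holdsAt_wr, Option.getD_some]
  constructor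
  · intro h w hw t ht k α z hz hz'
    exact ⟨fun h' => (h k).1 w hw t ht α h' z hz hz',
      fun h' => by_contra fun h'' => (h k).2 w hw t ht α h'' z hz hz' h'⟩
  · intro h k
    exact ⟨fun w hw t ht α h' z hz hz' => (h w hw t ht k α z hz hz').1 h',
      fun w hw t ht α h' z hz hz' h'' => h' ((h w hw t ht k α z hz hz').2 h'')⟩

theorem holdsAt_coherentSym [Fintype Q] [DecidableEq Q] : HoldsAt K coherentSym none s ↔
    ∀ w, Survives K (acts w) s → ∀ k, ∀ v < 2 ^ n, Survives K (acts w ++ chooseWord k v) s →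
      ∃ α, ∀ t, Desc K (some (acts w ++ chooseWord k v)) (3 * n) s t →
        CanSee K (acts w ++ chooseWord k v) (.sym k α) t := by
  simp only [coherentSym, holdsAt_bigAnd_map, List.mem_finRange, true_implies, holdsAt_always,
    holdsAt_box, mem_choose_iff, holdsAt_bigOr_map, mem_syms, true_and, holdsAt_leaves, holdsAt_wr,
    Option.getD_some]
  constructor
  · intro h w hw k v hv hw'
    exact h k w hw _ ⟨v, hv, rfl⟩ hw'
  · rintro h k w hw _ ⟨v, hv, rfl⟩ hw'
    exact h w hw k v hv hw'

theorem holdsAt_sameConfig [Fintype Q] [DecidableEq Q] : HoldsAt K sameConfig none s ↔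
    ∀ k k', k < k' → ∀ w, Survives K (acts w) s → ∀ t, Leaf K s w t →
      ∀ v < 2 ^ n, HasPos K k v t → HasPos K k' v t →
      ∃ α, CanSee K (acts w) (.sym k α) t ∧ CanSee K (acts w) (.sym k' α) t := by
  have key : ∀ k k' : Fin 3, HoldsAt K (always (leaves (imp (posSame k k')
      (bigOr ((syms Q).map fun α => conj (wr k α) (wr k' α)))))) none s ↔
      ∀ w, Survives K (acts w) s → ∀ t, Leaf K s w t →
      ∀ v < 2 ^ n, HasPos K k v t → HasPos K k' v t →
      ∃ α, CanSee K (acts w) (.sym k α) t ∧ CanSee K (acts w) (.sym k' α) t := by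
    intro k k'
    simp only [holdsAt_always_leaves, holdsAt_imp, holdsAt_bigOr_map, mem_syms, true_and,
      holdsAt_conj, holdsAt_wr, Option.getD_some]
    refine forall₄_congr fun w _ t _ => ?_
    constructor
    · intro h v hv h₁ h₂
      exact h ((holdsAt_posSame h₁ h₂ hv hv).2 rfl)
    · intro h hs
      obtain ⟨v, hv, h₁⟩ := exists_hasPos K k t
      obtain ⟨v', hv', h₂⟩ := exists_hasPos K k' t
      obtain rfl := (holdsAt_posSame h₁ h₂ hv hv').1 hs
      exact h v hv h₁ h₂
  rw [sameConfig, holdsAt_bigAnd_map]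
  simp only [key, List.mem_cons, List.not_mem_nil, or_false, forall_eq_or_imp, forall_eq]
  constructor
  · rintro ⟨h₁, h₂, h₃⟩ k k' hk
    fin_cases k <;> fin_cases k' <;> first | exact absurd hk (by decide) | assumption
  · intro h
    exact ⟨h 0 1 (by decide), h 0 2 (by decide), h 1 2 (by decide)⟩

theorem holdsAt_uniformTrans : HoldsAt K uniformTrans none s ↔
    ∀ w, Survives K (acts w) s → ∀ l ≤ 6 * n, ∀ t, Chain K (some (acts w)) .i l s t →
      ∀ d, CanSee K (acts w) (.act d) t ↔ CanSee K (acts w) (.act d) s := by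
  simp only [uniformTrans, holdsAt_bigAnd_map, List.mem_cons, List.not_mem_nil, or_false,
    forall_eq_or_imp, forall_eq, holdsAt_always, holdsAt_imp, holdsAt_within, holdsAt_neg,
    holdsAt_obs, Option.getD_some, Nat.lt_succ_iff]
  constructor
  · rintro ⟨h₁, h₂, h₃, h₄⟩ w hw l hl t ht d
    cases d
    · exact ⟨fun h => by_contra fun h' => h₂ w hw h' l hl t ht h, fun h => h₁ w hw h l hl t ht⟩
    · exact ⟨fun h => by_contra fun h' => h₄ w hw h' l hl t ht h, fun h => h₃ w hw h l hl t ht⟩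
  · intro h
    exact ⟨fun w hw h' l hl t ht => (h w hw l hl t ht _).2 h',
      fun w hw h' l hl t ht => mt (h w hw l hl t ht _).1 h',
      fun w hw h' l hl t ht => (h w hw l hl t ht _).2 h',
      fun w hw h' l hl t ht => mt (h w hw l hl t ht _).1 h'⟩

theorem holdsAt_endMarkers : HoldsAt K endMarkers none s ↔
    ∀ w, Survives K (acts w) s → ∀ t, Leaf K s w t → ∀ v, v = 0 ∨ v = 2 ^ n - 1 →
      HasPos K 0 v t → CanSee K (acts w) (.sym 0 .hash) t := by
  simp only [endMarkers, holdsAt_conj, holdsAt_always_leaves, holdsAt_imp, holdsAt_posEq,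
    holdsAt_wr, Option.getD_some, forall_eq_or_imp, forall_eq]
  exact ⟨fun h w hw t ht => ⟨h.1 w hw t ht, h.2 w hw t ht⟩,
    fun h => ⟨fun w hw t ht => (h w hw t ht).1, fun w hw t ht => (h w hw t ht).2⟩⟩

theorem holdsAt_initInput {q₀ : Q} {x : List Bool} : HoldsAt K (initInput q₀ x) none s ↔
    ∀ t, Desc K none (3 * n) s t → ∀ v < max x.length 1, HasPos K 0 (v + 1) t →
      CanSee K [] (.sym 0 (inputSym q₀ x v)) t := by
  simp only [initInput, holdsAt_leaves, holdsAt_bigAnd_map, List.mem_range, holdsAt_imp,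
    holdsAt_posEq, holdsAt_wr, Option.getD_none]

theorem holdsAt_initBlank {x : List Bool} : HoldsAt K (initBlank x) none s ↔
    ∀ t, Desc K none (3 * n) s t → (∀ v ≤ max x.length 1, ¬ HasPos K 0 v t) →
      ¬ HasPos K 0 (2 ^ n - 1) t → CanSee K [] (.sym 0 (.letter .blank)) t := by
  simp only [initBlank, holdsAt_leaves, holdsAt_bigAnd_map, List.mem_range, holdsAt_imp,
    holdsAt_conj, holdsAt_neg, holdsAt_posEq, holdsAt_wr, Option.getD_none,
    and_imp, Nat.lt_succ_iff]

section Machine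

variable {M : ATM} {K : Model Atom Agent (Obs M.Q n)} {s : K.S}

/-- Some leaf shows that the machine has stopped in the state `q`. -/
def Stopped (K : Model Atom Agent (Obs M.Q n)) (s : K.S) (w : List Branch) (q : M.Q) : Prop :=
  ∃ t, Leaf K s w t ∧ CanSee K (acts w) (.sym 0 (.head q .blank)) t

theorem holdsAt_accepted {w : List Branch} :
    HoldsAt K (accepted M) (some (acts w)) s ↔ Stopped K s w M.qAcc := by
  simp only [accepted, holdsAt_posIter, holdsAt_wr]
  rfl

theorem holdsAt_rejected {w : List Branch} :
    HoldsAt K (rejected M) (some (acts w)) s ↔ Stopped K s w M.qRej := by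
  simp only [rejected, holdsAt_posIter, holdsAt_wr]
  rfl

theorem holdsAt_final {w : List Branch} : HoldsAt K (final M) (some (acts w)) s ↔
    Stopped K s w M.qAcc ∨ Stopped K s w M.qRej := by
  rw [final, holdsAt_or, holdsAt_accepted, holdsAt_rejected]

theorem holdsAt_transitions : HoldsAt K (transitions M) none s ↔
    ∀ w, Survives K (acts w) s → ¬ (Stopped K s w M.qAcc ∨ Stopped K s w M.qRej) →
      ∀ t, Leaf K s w t → ∀ v, v + 2 < 2 ^ n → HasPos K 0 v t → HasPos K 1 (v + 1) t →
      HasPos K 2 (v + 2) t → ∀ α β γ, CanSee K (acts w) (.sym 0 α) t →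
      CanSee K (acts w) (.sym 1 β) t → CanSee K (acts w) (.sym 2 γ) t →
      ∀ d, CanSee K (acts w) (.act d) t ∧
        CanSee K (acts w ++ [.act d]) (.sym 1 (M.succ d α β γ)) t := by
  rw [transitions, holdsAt_always]
  simp only [holdsAt_imp, holdsAt_neg, holdsAt_final, holdsAt_leaves]
  refine forall₅_congr fun w _ _ t _ => ?_
  simp only [holdsAt_conj, holdsAt_bigAnd, List.mem_flatMap, List.mem_map, mem_syms, true_and,
    forall_exists_index, and_imp]
  constructor
  · intro h v hv h₀ h₁ h₂ α β γ hα hβ hγ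
    have := h ((holdsAt_posSucc h₀ h₁ (by omega) (by omega)).2 rfl)
      ((holdsAt_posSucc h₁ h₂ (by omega) (by omega)).2 rfl) _ α β γ rfl
    simp only [holdsAt_imp, holdsAt_conj, holdsAt_dia_char, holdsAt_wr, Option.getD_some] at this
    obtain ⟨ha, hb⟩ := this ⟨hα, hβ, hγ⟩
    rintro (_ | _)
    exacts [ha, hb]
  · rintro h hs₁ hs₂ _ α β γ rfl
    -- Every state has some positions; the successor formulas force them to be `v`, `v + 1`, `v +
    -- 2`, all below `2 ^ n`.
    obtain ⟨v, hv, h₀⟩ := exists_hasPos K 0 t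
    obtain ⟨v₁, hv₁, h₁⟩ := exists_hasPos K 1 t
    obtain ⟨v₂, hv₂, h₂⟩ := exists_hasPos K 2 t
    obtain rfl := (holdsAt_posSucc h₀ h₁ hv hv₁).1 hs₁
    obtain rfl := (holdsAt_posSucc h₁ h₂ hv₁ hv₂).1 hs₂
    simp only [holdsAt_imp, holdsAt_conj, holdsAt_dia_char, holdsAt_wr, Option.getD_some]
    rintro ⟨hα, hβ, hγ⟩
    exact ⟨h v hv₂ h₀ h₁ h₂ α β γ hα hβ hγ .a, h v hv₂ h₀ h₁ h₂ α β γ hα hβ hγ .b⟩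

theorem holdsAt_halted : HoldsAt K (halted M) none s ↔
    ∀ w, Survives K (acts w) s → (Stopped K s w M.qAcc ∨ Stopped K s w M.qRej) →
      ∀ d, ¬ CanSee K (acts w) (.act d) s := by
  rw [halted, holdsAt_always]
  simp only [holdsAt_imp, holdsAt_final, holdsAt_box_step, holdsAt_bot, imp_false,
    Option.getD_some]

theorem holdsAt_alternation : HoldsAt K (alternation M : F M.Q n) none s ↔
    ∀ w, Survives K (acts w) s → ∀ d, CanSee K (acts w) (.act d) s →
      (CanSee K (acts w ++ [.act d]) .ex s ↔ ¬ CanSee K (acts w) .ex s) := by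
  simp only [alternation, holdsAt_conj, holdsAt_always, holdsAt_imp, holdsAt_obs, holdsAt_box_step,
    holdsAt_neg, Option.getD_some]
  constructor
  · rintro ⟨h₁, h₂⟩ w hw d hd
    exact ⟨fun h h' => h₁ w hw h' d hd h, fun h => h₂ w hw h d hd⟩
  · intro h
    exact ⟨fun w hw h' d hd h'' => (h w hw d hd).1 h'' h',
      fun w hw h' d hd => (h w hw d hd).2 h'⟩

theorem holdsAt_winning : HoldsAt K (winning M) none s ↔ ∀ w, Survives K (acts w) s →
    (Stopped K s w M.qAcc → CanSee K (acts w) .win s) ∧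
    (Stopped K s w M.qRej → ¬ CanSee K (acts w) .win s) ∧
    (¬ (Stopped K s w M.qAcc ∨ Stopped K s w M.qRej) → ¬ CanSee K (acts w) .ex s →
      (CanSee K (acts w) .win s ↔ ∀ d, CanSee K (acts w) (.act d) s →
        CanSee K (acts w ++ [.act d]) .win s)) ∧
    (¬ (Stopped K s w M.qAcc ∨ Stopped K s w M.qRej) → CanSee K (acts w) .ex s →
      (CanSee K (acts w) .win s ↔ ∃ d, CanSee K (acts w) (.act d) s ∧
        CanSee K (acts w ++ [.act d]) .win s)) := by
  simp only [winning, holdsAt_bigAnd, List.mem_cons, List.not_mem_nil, or_false, forall_eq_or_imp,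
    forall_eq, holdsAt_always, holdsAt_imp, holdsAt_conj, holdsAt_iff, holdsAt_neg, holdsAt_final,
    holdsAt_accepted, holdsAt_rejected, holdsAt_box_step, holdsAt_dia_step, holdsAt_obs,
    Option.getD_some, and_imp, ← forall_and]

end Machine

end POL.Reduction

/-! # If the formula is satisfiable, the input is accepted -/

namespace ATM

variable {M : ATM} {x : List Bool} {N v : ℕ}

theorem cell_init_of_lt (hv : v < max x.length 1) (hN : v + 1 + 1 ≠ N) :
    (M.init x).cell N (v + 1) = POL.Reduction.inputSym M.q₀ x v := by
  rw [Cfg.cell, if_neg (by omega), POL.Reduction.inputSym]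
  by_cases h0 : v = 0
  · subst h0
    rfl
  · rw [if_neg (by simpa [init] using h0), if_neg h0]
    rfl

theorem cell_init_of_le (hv : max x.length 1 ≤ v) (hN : v + 1 + 1 ≠ N) :
    (M.init x).cell N (v + 1) = .letter .blank := by
  rw [Cfg.cell, if_neg (by omega), if_neg (by simp only [init]; omega)]
  exact congrArg _ (List.getD_eq_default _ _ (by simp; omega))

end ATM

namespace POL.Reduction

open Formula

/-! ### One symbol for each position -/

section Tree

variable {Q : Type} {n : ℕ} {K : Model Atom Agent (Obs Q n)} {s t : K.S} {w : List Branch}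

/-- There is a leaf for each choice of the digits. -/
theorem exists_leaf (h : HoldsAt K tree none s) (hw : Survives K (acts w) s)
    (f : Fin (3 * n) → Bool) : ∃ t, Leaf K s w t ∧ ∀ m, .p m.val ∈ K.V t ↔ f m = true := by
  rw [holdsAt_tree] at h
  -- Descend digit by digit: at depth `k` both values of digit `k` are offered, and the earlier
  -- digits are inherited.
  have key : ∀ k ≤ 3 * n, ∃ t, Desc K (some (acts w)) k s t ∧
      ∀ m : Fin (3 * n), m.val < k → (.p m.val ∈ K.V t ↔ f m = true) := by
    intro k hk
    induction k with
    | zero => exact ⟨s, rfl, fun m hm => absurd hm (by omega)⟩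
    | succ k ih =>
      obtain ⟨u, hu, hf⟩ := ih (by omega)
      obtain ⟨h₁, h₂⟩ := h w hw ⟨k, hk⟩ u hu
      obtain ⟨t, ht, ht'⟩ := h₁ (f ⟨k, hk⟩)
      refine ⟨t, ⟨u, hu, ht⟩, fun m hm => ?_⟩
      rcases Nat.lt_succ_iff_lt_or_eq.1 hm with hm | rfl
      · rw [← hf m hm]
        exact (h₂ m hm t ht).symm
      · exact ht'
  obtain ⟨t, ht, hf⟩ := key _ le_rfl
  exact ⟨t, ht, fun m => hf m m.2⟩

theorem exists_leaf_hasPos (h : HoldsAt K tree none s) (hw : Survives K (acts w) s)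
    (v : Fin 3 → ℕ) : ∃ t, Leaf K s w t ∧ ∀ k, HasPos K k (v k) t := by
  obtain ⟨t, ht, hf⟩ := exists_leaf h hw fun m =>
    (v (finProdFinEquiv.symm m).1).testBit (finProdFinEquiv.symm m).2
  refine ⟨t, ht, fun k m => ?_⟩
  rw [hf, idx, Equiv.symm_apply_apply]

variable [Fintype Q] [DecidableEq Q]

/-- A leaf at which the `k`-th position is `v` remains a leaf after the observation of the digits
of `v` in the block `k`. -/
theorem Leaf.choose (h₁ : HoldsAt K digitsLeaf none s) (h₂ : HoldsAt K digitsInner none s)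
    (hw : Survives K (acts w) s) (ht : Leaf K s w t) {k : Fin 3} {v : ℕ} (hv : HasPos K k v t) :
    Desc K (some (acts w ++ chooseWord k v)) (3 * n) s t := by
  rw [holdsAt_digitsLeaf] at h₁
  rw [holdsAt_digitsInner] at h₂
  refine ht.mono (fun l hl u hu => ?_) ?_
  -- The states on the path strictly above the leaf survive all words of digits.
  · have key : ∀ z, (∀ o ∈ z, IsDigit o) → Survives K (acts w ++ z) u := by
      intro z hz
      induction z using List.reverseRecOn with
      | nil =>
        rw [List.append_nil]
        exact hu.alive hw
      | append_singleton z o ih =>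
        simp only [List.mem_append, List.mem_singleton, or_imp, forall_and, forall_eq] at hz
        obtain ⟨m, b, rfl⟩ := hz.2
        rw [← List.append_assoc]
        exact h₂ w hw l (by omega) u hu z hz.1 (ih hz.1) m b
    exact key _ fun o => isDigit_of_mem_chooseWord
  -- The leaf survives because these digits are its own.
  · have key : ∀ z, (∀ o ∈ z, ∃ m, o = bit (idx k m) (v.testBit m)) →
        Survives K (acts w ++ z) t := by
      intro z hz
      induction z using List.reverseRecOn with
      | nil =>
        rw [List.append_nil]
        exact ht.alive hw
      | append_singleton z o ih =>
        simp only [List.mem_append, List.mem_singleton, or_imp, forall_and, forall_eq] at hz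
        obtain ⟨m, rfl⟩ := hz.2
        rw [← List.append_assoc]
        exact (h₁ w hw t ht z (ih hz.1) _ _).2 (hv m)
    refine key _ fun o ho => ?_
    obtain ⟨m, -, rfl⟩ := List.mem_map.1 ho
    exact ⟨m, rfl⟩

/-- Observe the digits of `v` in block `k`. The leaves with `k`-th position `v` remain leaves,
`coherentSym` gives the remaining leaves a common symbol, and `stableSym` carries it back to the
time before the digits were observed. -/
theorem exists_sym (hn : 0 < n) (h₁ : HoldsAt K digitsLeaf none s)
    (h₂ : HoldsAt K digitsInner none s) (h₃ : HoldsAt K stableSym none s)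
    (h₄ : HoldsAt K coherentSym none s) (hw : Survives K (acts w) s) (k : Fin 3) {v : ℕ}
    (hv : v < 2 ^ n) : ∃ α, ∀ t, Leaf K s w t → HasPos K k v t →
      CanSee K (acts w) (.sym k α) t := by
  rw [holdsAt_coherentSym] at h₄
  rw [holdsAt_stableSym] at h₃
  have hs : Survives K (acts w ++ chooseWord k v) s := by
    rw [holdsAt_digitsInner] at h₂
    have key : ∀ z, (∀ o ∈ z, IsDigit o) → Survives K (acts w ++ z) s := by
      intro z hz
      induction z using List.reverseRecOn with
      | nil => rwa [List.append_nil]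
      | append_singleton z o ih =>
        simp only [List.mem_append, List.mem_singleton, or_imp, forall_and, forall_eq] at hz
        obtain ⟨m, b, rfl⟩ := hz.2
        rw [← List.append_assoc]
        -- The root has to survive as well; it has depth `0 < 6 n` because `n` is positive.
        exact h₂ w hw 0 (by omega) s rfl z hz.1 (ih hz.1) m b
    exact key _ fun o => isDigit_of_mem_chooseWord
  obtain ⟨α, hα⟩ := h₄ w hw k v hv hs
  refine ⟨α, fun t ht htv => ?_⟩
  have ht' := ht.choose h₁ h₂ hw htv
  exact (h₃ w hw t ht k α _ (fun o => isDigit_of_mem_chooseWord)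
    (ht'.alive (c := some (acts w ++ chooseWord k v)) hs)).2 (hα t ht')

/-- The symbol of a leaf depends on the position only. -/
theorem canSee_of_canSee (hn : 0 < n) (h₀ : HoldsAt K tree none s)
    (h₁ : HoldsAt K digitsLeaf none s)
    (h₂ : HoldsAt K digitsInner none s) (h₃ : HoldsAt K stableSym none s)
    (h₄ : HoldsAt K coherentSym none s) (h₅ : HoldsAt K uniqueSym none s)
    (h₆ : HoldsAt K sameConfig none s) (hw : Survives K (acts w) s) {k k' : Fin 3} {v : ℕ}
    (hv : v < 2 ^ n) {α : CellSym Q} {t' : K.S} (ht : Leaf K s w t) (htv : HasPos K k v t)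
    (hα : CanSee K (acts w) (.sym k α) t) (ht' : Leaf K s w t') (htv' : HasPos K k' v t') :
    CanSee K (acts w) (.sym k' α) t' := by
  rw [holdsAt_uniqueSym] at h₅
  rw [holdsAt_sameConfig] at h₆
  choose β hβ using fun k => exists_sym hn h₁ h₂ h₃ h₄ hw k hv
  -- At a leaf with all three positions equal to `v`, `sameConfig` applies to any two blocks, so
  -- their common symbols at `v` coincide.
  obtain ⟨u, hu, huv⟩ := exists_leaf_hasPos h₀ hw fun _ => v
  have key : ∀ k, β k = β 0 := by
    intro k
    by_cases hk : k = 0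
    · rw [hk]
    · obtain ⟨γ, h, h'⟩ := h₆ 0 k (Fin.pos_iff_ne_zero.2 hk) w hw u hu v hv (huv 0) (huv k)
      exact ((h₅ w hw u hu k).unique (hβ k u hu (huv k)) h').trans
        ((h₅ w hw u hu 0).unique h (hβ 0 u hu (huv 0)))
  rw [(h₅ w hw t ht k).unique hα (hβ k t ht htv), key k, ← key k']
  exact hβ k' t' ht' htv'

end Tree

/-! ### Following the computation in a model -/

section Machine

variable {M : ATM} {n : ℕ} {K : Model Atom Agent (Obs M.Q n)} {s : K.S} {w : List Branch}
  {c : M.Cfg}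

/-- After the transitions `w`, the leaves show the configuration `c`. -/
def Shows (K : Model Atom Agent (Obs M.Q n)) (s : K.S) (w : List Branch) (c : M.Cfg) : Prop :=
  ∀ k, ∀ v < 2 ^ n, ∀ t, Leaf K s w t → HasPos K k v t →
    CanSee K (acts w) (.sym k (c.cell (2 ^ n) v)) t

/-- A symbol with a state occurs only under the head, and a machine that stops has its head on a
blank, which is the letter that the test for final configurations looks for. -/
theorem Shows.stopped_iff (h₀ : HoldsAt K tree none s) (h₅ : HoldsAt K uniqueSym none s)
    (hw : Survives K (acts w) s) (hc : Shows K s w c) (hh : c.head + 3 ≤ 2 ^ n)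
    (hb : M.IsFinal c.state → c.tape c.head = .blank) {q : M.Q} (hq : M.IsFinal q) :
    Stopped K s w q ↔ c.state = q := by
  rw [holdsAt_uniqueSym] at h₅
  constructor
  · rintro ⟨t, ht, hq⟩
    obtain ⟨v, hv, hv'⟩ := exists_hasPos K 0 t
    have := (h₅ w hw t ht 0).unique hq (hc 0 v hv t ht hv')
    rw [ATM.Cfg.cell] at this
    split_ifs at this with h1 h2
    · exact (CellSym.head.inj this).1.symm
  · rintro rfl
    obtain ⟨t, ht, htv⟩ := exists_leaf_hasPos h₀ hw fun _ => c.head + 1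
    refine ⟨t, ht, ?_⟩
    have := hc 0 (c.head + 1) (by omega) t ht (htv 0)
    rwa [ATM.Cfg.cell, if_neg (by omega), if_pos rfl, hb hq] at this

section Formula

variable {x : List Bool} (h : HoldsAt K (formula M n x) none s)

include h

theorem holdsAt_conjuncts : HoldsAt K tree none s ∧ HoldsAt K digitsLeaf none s ∧
    HoldsAt K digitsInner none s ∧ HoldsAt K uniqueSym none s ∧ HoldsAt K stableSym none s ∧
    HoldsAt K coherentSym none s ∧ HoldsAt K sameConfig none s ∧ HoldsAt K uniformTrans none s ∧
    HoldsAt K endMarkers none s ∧ HoldsAt K (initInput M.q₀ x) none s ∧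
    HoldsAt K (initBlank x) none s ∧ HoldsAt K (transitions M) none s ∧
    HoldsAt K (halted M) none s ∧ HoldsAt K (alternation M) none s ∧
    HoldsAt K (winning M) none s ∧ CanSee K [] .win s ∧ CanSee K [] .ex s := by
  simpa only [formula, holdsAt_bigAnd, List.mem_cons, List.not_mem_nil, or_false,
    forall_eq_or_imp, forall_eq, holdsAt_conj, holdsAt_obs, Option.getD_none] using h

/-- One leaf for each position, in any of the three blocks, is enough, since symbols depend on the
position only. -/
theorem shows_of_forall (hn : 0 < n) (hw : Survives K (acts w) s)
    (hc : ∀ v < 2 ^ n, ∃ k t, Leaf K s w t ∧ HasPos K k v t ∧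
      CanSee K (acts w) (.sym k (c.cell (2 ^ n) v)) t) : Shows K s w c := by
  obtain ⟨h₀, h₁, h₂, h₅, h₃, h₄, h₆, -⟩ := holdsAt_conjuncts h
  intro k v hv t ht htv
  obtain ⟨k', t', ht', htv', hα⟩ := hc v hv
  exact canSee_of_canSee hn h₀ h₁ h₂ h₃ h₄ h₅ h₆ hw hv ht' htv' hα ht htv

theorem canSee_hash (hw : Survives K (acts w) s) {v : ℕ} (hv : v = 0 ∨ v + 1 = 2 ^ n) :
    ∃ k t, Leaf K s w t ∧ HasPos K k v t ∧ CanSee K (acts w) (.sym k (c.cell (2 ^ n) v)) t := by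
  obtain ⟨h₀, -, -, -, -, -, -, -, h₉, -⟩ := holdsAt_conjuncts h
  obtain ⟨t, ht, htv⟩ := exists_leaf_hasPos h₀ hw fun _ => v
  refine ⟨0, t, ht, htv 0, ?_⟩
  rw [ATM.Cfg.cell, if_pos hv]
  exact holdsAt_endMarkers.1 h₉ w hw t ht v (by omega) (htv 0)

theorem shows_init (hn : 0 < n) (hn' : 3 ≤ 2 ^ n) :
    Shows K s [] (M.init x) := by
  obtain ⟨h₀, -, -, -, -, -, -, -, -, h₁, h₂, -, -, -, -, h₃, -⟩ := holdsAt_conjuncts h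
  have hw : Survives K (acts []) s := Survives.of_append h₃
  refine shows_of_forall h hn hw fun v hv => ?_
  by_cases hv' : v = 0 ∨ v + 1 = 2 ^ n
  · exact canSee_hash h hw hv'
  obtain ⟨t, ht, htv⟩ := exists_leaf_hasPos h₀ hw fun _ => v
  refine ⟨0, t, ht, htv 0, ?_⟩
  -- The conjuncts on the initial configuration are evaluated in the original model, where every
  -- state is alive, so that nothing on the path is lost.
  have ht' : Desc K none (3 * n) s t := ht.mono (fun _ _ _ _ => trivial) trivial
  obtain ⟨v, rfl⟩ : ∃ u, v = u + 1 := ⟨v - 1, by omega⟩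
  by_cases hl : v < max x.length 1
  · rw [ATM.cell_init_of_lt hl (by omega)]
    exact holdsAt_initInput.1 h₁ t ht' v hl (htv 0)
  · rw [ATM.cell_init_of_le (by omega) (by omega)]
    refine holdsAt_initBlank.1 h₂ t ht' (fun u hu hu' => ?_) fun hu => ?_
    · have := hu'.unique (htv 0) (by omega) hv
      omega
    · have := hu.unique (htv 0) (by omega) hv
      omega

/-- A leaf with consecutive positions `v`, `v + 1`, `v + 2` shows the old symbols around `v + 1`;
`transitions` makes `d` observable there and yields the new symbol in the second block. By
`uniformTrans` the transition is possible at all states of the path too. -/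
theorem Shows.step (hn : 0 < n) (hn' : 3 ≤ 2 ^ n) (hw : Survives K (acts w) s)
    (hc : Shows K s w c) (hh : c.head + 3 ≤ 2 ^ n) (d : Branch)
    (hh' : (c.step d).head + 3 ≤ 2 ^ n)
    (hf : ¬ (Stopped K s w M.qAcc ∨ Stopped K s w M.qRej)) :
    Survives K (acts (w ++ [d])) s ∧ Shows K s (w ++ [d]) (c.step d) := by
  obtain ⟨h₀, -, -, -, -, -, -, h₁, -, -, -, h₂, -⟩ := holdsAt_conjuncts h
  rw [holdsAt_uniformTrans] at h₁
  rw [holdsAt_transitions] at h₂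
  have key : ∀ v, v + 2 < 2 ^ n → ∃ t, Leaf K s w t ∧ HasPos K 1 (v + 1) t ∧
      CanSee K (acts w) (.act d) t ∧
      CanSee K (acts w ++ [.act d]) (.sym 1 ((c.step d).cell (2 ^ n) (v + 1))) t := by
    intro v hv
    obtain ⟨t, ht, htv⟩ := exists_leaf_hasPos h₀ hw fun k => v + k
    refine ⟨t, ht, htv 1, ?_⟩
    have := h₂ w hw hf t ht v hv (htv 0) (htv 1) (htv 2) _ _ _
      (hc 0 v (by omega) t ht (htv 0)) (hc 1 (v + 1) (by omega) t ht (htv 1))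
      (hc 2 (v + 2) (by omega) t ht (htv 2)) d
    rwa [← ATM.succ_cell d (by omega) (by omega) hh hh']
  -- A leaf at which `d` is observable shows, by `uniformTrans`, that it is observable at the root;
  -- such a leaf exists because there are at least three positions.
  have hd : CanSee K (acts w) (.act d) s := by
    obtain ⟨t, ht, -, h', -⟩ := key 0 (by omega)
    have ht' := ht.chain
    exact (h₁ w hw _ (by omega) t ht' d).1 h'
  have hw' : Survives K (acts (w ++ [d])) s := by rwa [acts_append]
  refine ⟨hw', shows_of_forall h hn hw' fun v hv => ?_⟩
  -- The extreme positions are never in the middle of a triple; there the end markers are imposed by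
  -- a conjunct of their own.
  by_cases hv' : v = 0 ∨ v + 1 = 2 ^ n
  · exact canSee_hash h hw' hv'
  obtain ⟨v, rfl⟩ : ∃ u, v = u + 1 := ⟨v - 1, by omega⟩
  obtain ⟨t, ht, htv, h', h''⟩ := key v (by omega)
  rw [acts_append]
  refine ⟨1, t, ?_, htv, h''⟩
  rw [Leaf, acts_append]
  -- All states on the path to the leaf survive `d`, so it is still a leaf afterwards.
  exact ht.mono (fun l hl u hu => (h₁ w hw l (by omega) u hu d).2 hd) h'

end Formula

/-- Induction on termination, along the words of transitions. The invariant is that the leaves show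
the current configuration and that `ex` is observable exactly at existential ones; then `winning`
unfolds to the clauses of `Accepts`, and observability of `win` excludes rejection. -/
theorem accepts_of_holdsAt (hM : M.Normal) {x : List Bool}
    (hspace : ∀ c, (M.init x).Reaches c → c.head + 3 ≤ 2 ^ n) (hhalt : (M.init x).Halts)
    (h : HoldsAt K (formula M n x) none s) : (M.init x).Accepts := by
  have hn' : 3 ≤ 2 ^ n := (Nat.le_add_left _ _).trans (hspace _ .refl)
  have hn : 0 < n := Nat.pos_of_ne_zero fun h => by simp [h] at hn'
  obtain ⟨h₀, -, -, h₅, -, -, -, -, -, -, -, -, -, h₁, h₂, h₃, h₄⟩ := holdsAt_conjuncts h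
  rw [holdsAt_alternation] at h₁
  rw [holdsAt_winning] at h₂
  have key : ∀ c : M.Cfg, c.Halts → ∀ w, (M.init x).Reaches c → Survives K (acts w) s →
      Shows K s w c →
      -- The alternation of the machine says nothing about final states, so the correspondence is
      -- kept at non-final ones only.
      (¬ M.IsFinal c.state → (CanSee K (acts w) .ex s ↔ M.isExist c.state = true)) →
      CanSee K (acts w) .win s → c.Accepts := by
    intro c hc
    induction hc with
    | final c hf =>
      intro w hr hw hs _ hwin
      rcases hf with hf | hf
      · exact .acc c hf
      · refine absurd hwin ((h₂ w hw).2.1 ?_)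
        exact (hs.stopped_iff h₀ h₅ hw (hspace c hr) (hM.stops_on_blank x c hr) (.inr rfl)).2 hf
    | step c _ ih =>
      intro w hr hw hs hex hwin
      have hst : ∀ q, M.IsFinal q → (Stopped K s w q ↔ c.state = q) := fun q hq =>
        hs.stopped_iff h₀ h₅ hw (hspace c hr) (hM.stops_on_blank x c hr) hq
      by_cases hf : M.IsFinal c.state
      · rcases hf with hf | hf
        · exact .acc c hf
        · exact absurd hwin ((h₂ w hw).2.1 ((hst _ (.inr rfl)).2 hf))
      have hf' : ¬ (Stopped K s w M.qAcc ∨ Stopped K s w M.qRej) := by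
        rwa [hst _ (.inl rfl), hst _ (.inr rfl)]
      have hr' : ∀ d, (M.init x).Reaches (c.step d) := fun d => .tail c d hr hf
      have hstep : ∀ d, Survives K (acts (w ++ [d])) s ∧ Shows K s (w ++ [d]) (c.step d) :=
        fun d => hs.step h hn hn' hw (hspace c hr) d (hspace _ (hr' d)) hf'
      have hacc : ∀ d, CanSee K (acts (w ++ [d])) .win s → (c.step d).Accepts := by
        intro d hd
        refine ih d (w ++ [d]) (hr' d) (hstep d).1 (hstep d).2 (fun hfd => ?_) hd
        have := (hstep d).1
        rw [acts_append] at this ⊢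
        rw [h₁ w hw d this, hex hf]
        have := hM.alternates d c.state (c.tape c.head) hf hfd
        rw [show (c.step d).state = (M.δ d c.state (c.tape c.head)).1 from rfl, this]
        simp
      simp only [acts_append] at hstep hacc
      by_cases he : M.isExist c.state = true
      · obtain ⟨d, -, hd⟩ := ((h₂ w hw).2.2.2 hf' ((hex hf).2 he)).1 hwin
        exact .exist c d hf he (hacc d hd)
      · have hwin' := ((h₂ w hw).2.2.1 hf' (mt (hex hf).1 he)).1 hwin
        exact .univ c hf (by simpa using he) fun d => hacc d (hwin' d (hstep d).1)
  exact key _ hhalt [] .refl (Survives.of_append h₃) (shows_init h hn hn')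
    (fun _ => iff_of_true h₄ hM.start) h₃

end Machine

end POL.Reduction

/-! # If the input is accepted, the formula is satisfiable -/

namespace POL.Reduction

open Formula

/-- The states of the model: the nodes of the infinite binary tree (the last digit first), and
intermediate states between a node and its children. -/
inductive TreeState
  | node (l : List Bool)
  | mid (l : List Bool) (b : Bool)

namespace TreeState

/-- The equivalence classes of the epistemic relations. -/
def cls : Agent → TreeState → List Bool
  | _, node l => l
  | .i, mid l _ => l
  | .j, mid l b => b :: l

/-- The number of epistemic steps from the root. -/
def depth : TreeState → ℕ
  | node l => 2 * l.length
  | mid l _ => 2 * l.length + 1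

/-- The valuation. -/
def val : TreeState → Set Atom
  | node l => {a | a = .t ∨ ∃ m, a = .p m ∧ l.reverse[m]? = some true}
  | mid _ _ => ∅

theorem depth_le_of_cls_eq {g : Agent} {s t : TreeState} (h : s.cls g = t.cls g) :
    t.depth ≤ s.depth + 1 := by
  have h' := congrArg List.length h
  cases g <;> cases s <;> cases t <;> simp only [cls, depth, List.length_cons] at h' ⊢ <;> omega

theorem p_mem_val {l : List Bool} {m : ℕ} : .p m ∈ (node l).val ↔ l.reverse[m]? = some true := by
  simp [val]

end TreeState

/-- A configuration, and whether it is considered as existential. -/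
abbrev Pos (M : ATM) : Type := M.Cfg × Bool

variable {M : ATM} {n : ℕ}

/-- The next configuration along a transition. -/
def Pos.next (q : Pos M) (d : Branch) : Pos M := (q.1.step d, !q.2)

/-- The configuration after a sequence of transitions. -/
def Pos.after (q : Pos M) (w : List Branch) : Pos M := w.foldl Pos.next q

/-- The sequence of transitions is possible. -/
def Run : Pos M → List Branch → Prop
  | _, [] => True
  | q, d :: w => ¬ M.IsFinal q.1.state ∧ Run (q.next d) w

/-- The `k`-th position of a state. -/
noncomputable def posn (n : ℕ) (k : Fin 3) (s : TreeState) : ℕ :=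
  open Classical in Nat.ofBits fun m : Fin n => decide (.p (idx k m).val ∈ s.val)

/-- The observations that can be made at a state, apart from the transitions. -/
def Ok (s : TreeState) (q : Pos M) : Obs M.Q n → Prop
  | .act _ => False
  | .p m => s.depth < 6 * n ∨ .p m.val ∈ s.val
  | .pbar m => s.depth < 6 * n ∨ .p m.val ∉ s.val
  | .sym k α => 6 * n ≤ s.depth ∧ α = q.1.cell (2 ^ n) (posn n k s)
  | .ex => s = .node [] ∧ q.2 = true
  | .win => s = .node [] ∧ q.1.Accepts

/-- The words that can be observed at a state. -/
def Observable (s : TreeState) : Pos M → List (Obs M.Q n) → Prop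
  | _, [] => True
  | q, .act d :: u => ¬ M.IsFinal q.1.state ∧ Observable s (q.next d) u
  | q, o :: u => ∀ o' ∈ o :: u, Ok s q o'

theorem observable_of_forall {s : TreeState} {q : Pos M} {u : List (Obs M.Q n)}
    (h : ∀ o ∈ u, Ok s q o) : Observable s q u := by
  rcases u with _ | ⟨_ | _ | _ | _ | _ | _, u⟩
  · trivial
  · exact (h _ List.mem_cons_self).elim
  all_goals exact h

theorem observable_iff {s : TreeState} {q : Pos M} {u : List (Obs M.Q n)} : Observable s q u ↔
    (∀ o ∈ u, Ok s q o) ∨ ¬ M.IsFinal q.1.state ∧ ∃ d v, u = .act d :: v ∧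
      Observable s (q.next d) v := by
  constructor
  · intro h
    rcases u with _ | ⟨o, u⟩
    · simp
    · cases o with
      | act d => exact .inr ⟨h.1, d, u, rfl, h.2⟩
      | _ => exact .inl h
  · rintro (h | ⟨h, d, v, rfl, h'⟩)
    · exact observable_of_forall h
    · exact ⟨h, h'⟩

theorem observable_iff_forall {s : TreeState} {q : Pos M} {u : List (Obs M.Q n)}
    (hu : ∀ d, .act d ∉ u) : Observable s q u ↔ ∀ o ∈ u, Ok s q o := by
  rw [observable_iff, or_iff_left]
  rintro ⟨-, d, v, rfl, -⟩
  exact hu d List.mem_cons_self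

/-- Closure under prefixes makes surviving a word the same as having it in the language. -/
theorem Observable.of_append {s : TreeState} {q : Pos M} {u v : List (Obs M.Q n)}
    (h : Observable s q (u ++ v)) : Observable s q u := by
  induction u generalizing q with
  | nil => trivial
  | cons o u ih =>
    rw [observable_iff] at h ⊢
    rcases h with h | ⟨h, d, v', e, h'⟩
    · exact .inl fun o ho => h o (List.mem_append_left _ ho)
    · rw [List.cons_append, List.cons.injEq] at e
      obtain ⟨rfl, rfl⟩ := e
      exact .inr ⟨h, d, u, rfl, ih h'⟩

theorem observable_acts_append {s : TreeState} {q : Pos M} {w : List Branch}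
    {u : List (Obs M.Q n)} :
    Observable s q (acts w ++ u) ↔ Run q w ∧ Observable s (q.after w) u := by
  induction w generalizing q with
  | nil => simp [acts, Run, Pos.after]
  | cons d w ih =>
    change (¬ M.IsFinal q.1.state ∧ Observable s (q.next d) (acts w ++ u)) ↔ _
    rw [ih, ← and_assoc]
    rfl

theorem ok_bit {s : TreeState} {q : Pos M} {m : Fin (3 * n)} {b : Bool} : Ok s q (bit m b) ↔
    s.depth < 6 * n ∨ (.p m.val ∈ s.val ↔ b = true) := by
  cases b <;> simp [bit, Ok]

/-- Which digits can be observed depends on the state alone, not on what was observed before. This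
generality is needed since `digitsLeaf` quantifies over arbitrary words. -/
theorem Observable.append_bit_iff {s : TreeState} {q : Pos M} {u : List (Obs M.Q n)}
    (h : Observable s q u) {m : Fin (3 * n)} {b : Bool} : Observable s q (u ++ [bit m b]) ↔
      s.depth < 6 * n ∨ (.p m.val ∈ s.val ↔ b = true) := by
  induction u generalizing q with
  | nil =>
    rw [List.nil_append, observable_iff_forall (by cases b <;> simp [bit])]
    simp [ok_bit]
  | cons o u ih =>
    cases o with
    | act d => exact (and_iff_right h.1).trans (ih h.2)
    | _ =>
      rw [← ok_bit (q := q)]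
      constructor
      · exact fun h' => h' _ (by simp)
      · intro h' o' ho'
        rcases List.mem_append.1 (show o' ∈ (_ :: u) ++ [bit m b] from ho') with ho' | ho'
        · exact h o' ho'
        · rw [List.mem_singleton] at ho'
          exact ho' ▸ h'

/-- The words that can be observed form a regular language. -/
theorem exists_regularExpression (s : TreeState) {c : M.Cfg} (hc : c.Halts) (e : Bool) :
    ∃ E : RegularExpression (Obs M.Q n), ∀ u, u ∈ E.matches' ↔ Observable s (c, e) u := by
  classical
  have hS : ∀ q : Pos M, ∃ E : RegularExpression (Obs M.Q n),
      ∀ u, u ∈ E.matches' ↔ ∀ o ∈ u, Ok s q o := fun q =>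
    ⟨.star (unionOf (((Finset.univ.filter fun o => Ok s q o).toList).map .char)), fun u => by
      rw [mem_star_unionOf_char]; simp⟩
  induction hc generalizing e with
  | final c hf =>
    obtain ⟨E, hE⟩ := hS (c, e)
    refine ⟨E, fun u => ?_⟩
    rw [hE, observable_iff, or_iff_left]
    exact fun h => h.1 hf
  | step c _ ih =>
    obtain ⟨E, hE⟩ := hS (c, e)
    -- The constructor `step` of `Halts` does not exclude final configurations, at which no
    -- transition may be observed.
    by_cases hf : M.IsFinal c.state
    · refine ⟨E, fun u => ?_⟩
      rw [hE, observable_iff, or_iff_left]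
      exact fun h => h.1 hf
    · choose E' hE' using fun d => ih d (!e)
      -- Either no transition is observed and all letters are `Ok`, or the first letter is a
      -- transition and an expression for the successor configuration takes over.
      refine ⟨E.plus (.plus (.comp (.char (.act .a)) (E' .a)) (.comp (.char (.act .b)) (E' .b))),
        fun u => ?_⟩
      have hcomp : ∀ d, u ∈ (RegularExpression.comp (.char (.act d)) (E' d)).matches' ↔
          ∃ v, u = .act d :: v ∧ Observable s (Pos.next (c, e) d) v := by
        intro d
        constructor
        · rintro ⟨_, rfl, v, hv, rfl⟩
          exact ⟨v, rfl, (hE' d v).1 hv⟩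
        · rintro ⟨v, rfl, hv⟩
          exact ⟨[.act d], rfl, v, (hE' d v).2 hv, rfl⟩
      rw [observable_iff, ← hE, and_iff_right hf]
      change (_ ∨ u ∈ (RegularExpression.comp (.char (.act .a)) (E' .a)).matches' ∨
        u ∈ (RegularExpression.comp (.char (.act .b)) (E' .b)).matches') ↔ _
      rw [hcomp, hcomp]
      refine or_congr_right ⟨?_, ?_⟩
      · rintro (h | h)
        exacts [⟨_, h⟩, ⟨_, h⟩]
      · rintro ⟨_ | _, h⟩
        exacts [.inl h, .inr h]

/-- The model in which the words `Observable` can be observed. -/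
noncomputable abbrev treeModel (n : ℕ) {c : M.Cfg} (hc : c.Halts) :
    Model Atom Agent (Obs M.Q n) where
  S := TreeState
  R g s t := s.cls g = t.cls g
  equivalence _ := ⟨fun _ => rfl, fun h => h.symm, fun h h' => h.trans h'⟩
  V := TreeState.val
  Exp s := (exists_regularExpression s hc true).choose

/-! ### Observability in the tree model, and the conjuncts on the tree and its symbols -/

section TreeModel

variable {c : M.Cfg} {hc : c.Halts} {ctx : Option (List (Obs M.Q n))} {s t : TreeState}
  {w : List Branch}

/-- The empty continuation is always available, because the language itself is closed under
prefixes. -/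
theorem survives_treeModel {u : List (Obs M.Q n)} :
    Survives (treeModel n hc) u s ↔ Observable s (c, true) u := by
  have h := (exists_regularExpression (n := n) s hc true).choose_spec
  constructor
  · rintro ⟨v, hv⟩
    exact ((h _).1 hv).of_append
  · intro hu
    exact ⟨[], by rw [List.append_nil]; exact (h _).2 hu⟩

theorem survives_acts : Survives (treeModel n hc) (acts w) s ↔ Run (c, true) w := by
  rw [survives_treeModel, ← List.append_nil (acts w), observable_acts_append]
  exact and_iff_left trivial

theorem canSee_act {d : Branch} : CanSee (treeModel n hc) (acts w) (.act d) s ↔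
    Run (c, true) w ∧ ¬ M.IsFinal (Pos.after (c, true) w).1.state := by
  rw [CanSee, survives_treeModel, observable_acts_append]
  exact and_congr_right fun _ => and_iff_left trivial

theorem canSee_of_forall_ne {o : Obs M.Q n} (ho : ∀ d, o ≠ .act d) :
    CanSee (treeModel n hc) (acts w) o s ↔ Run (c, true) w ∧ Ok s (Pos.after (c, true) w) o := by
  rw [CanSee, survives_treeModel, observable_acts_append,
    observable_iff_forall (by simpa using fun d => (ho d).symm)]
  simp

/-- Epistemic steps may stay in place, as the relations are reflexive. The letter `t` forbids this:
the first step must end at an intermediate state and the second at a node, which is then the child.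
-/
theorem child_treeModel {l : List Bool} (h : Child (treeModel n hc) ctx (.node l) t) :
    ∃ b, t = .node (b :: l) := by
  obtain ⟨m, h₁, -, h₂, h₃, -, h₄⟩ := h
  change TreeState.cls .i (.node l) = TreeState.cls .i m at h₁
  change TreeState.cls .j m = TreeState.cls .j t at h₃
  change Atom.t ∉ TreeState.val m at h₂
  change Atom.t ∈ TreeState.val t at h₄
  rcases m with l' | ⟨l', b⟩
  · exact absurd (Or.inl rfl) h₂
  · rcases t with l'' | ⟨l'', b'⟩
    · obtain rfl : l = l' := h₁
      obtain rfl : b :: l = l'' := h₃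
      exact ⟨b, rfl⟩
    · exact h₄.elim

theorem desc_treeModel {k : ℕ} (h : Desc (treeModel n hc) ctx k (.node []) t) :
    ∃ l, t = .node l ∧ l.length = k := by
  induction k generalizing t with
  | zero => exact ⟨[], h.symm, rfl⟩
  | succ k ih =>
    obtain ⟨u, hu, ht⟩ := h
    obtain ⟨l, rfl, hl⟩ := ih hu
    obtain ⟨b, rfl⟩ := child_treeModel ht
    exact ⟨b :: l, rfl, by rw [List.length_cons, hl]⟩

theorem depth_eq_of_desc (h : Desc (treeModel n hc) ctx (3 * n) (.node []) t) :
    t.depth = 6 * n := by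
  obtain ⟨l, rfl, hl⟩ := desc_treeModel h
  simp only [TreeState.depth]
  omega

/-- One epistemic step increases the depth by at most one. So fewer than `6 n` steps never reach a
leaf, where only some of the digits are observable. -/
theorem depth_le_of_chain {k : ℕ} {g : Agent}
    (h : Chain (treeModel n hc) ctx g k (.node []) t) : t.depth ≤ k := by
  induction k generalizing t with
  | zero =>
    obtain rfl : .node [] = t := h
    exact le_rfl
  | succ k ih =>
    obtain ⟨u, hu, hut, -⟩ := h
    exact (TreeState.depth_le_of_cls_eq hut).trans (Nat.succ_le_succ (ih hu))

theorem hasPos_treeModel_iff {k : Fin 3} {v : ℕ} (hv : v < 2 ^ n) :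
    HasPos (treeModel n hc) k v t ↔ posn n k t = v := by
  classical
  have h : HasPos (treeModel n hc) k (posn n k t) t := fun m => by
    rw [posn, Nat.testBit_ofBits_lt _ _ m.2]
    simp
  constructor
  · intro h'
    exact h.unique h' (Nat.ofBits_lt_two_pow _) hv
  · rintro rfl
    exact h

theorem canSee_sym {k : Fin 3} {α : CellSym M.Q} (hw : Run (c, true) w)
    (ht : Desc (treeModel n hc) ctx (3 * n) (.node []) t) :
    CanSee (treeModel n hc) (acts w) (.sym k α) t ↔
      α = (Pos.after (c, true) w).1.cell (2 ^ n) (posn n k t) := by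
  rw [canSee_of_forall_ne (by simp), and_iff_right hw, Ok, depth_eq_of_desc ht]
  simp

theorem canSee_ex (hw : Run (c, true) w) :
    CanSee (treeModel n hc) (acts w) .ex (.node []) ↔ (Pos.after (c, true) w).2 = true := by
  rw [canSee_of_forall_ne (by simp), and_iff_right hw, Ok]
  simp

theorem canSee_win (hw : Run (c, true) w) :
    CanSee (treeModel n hc) (acts w) .win (.node []) ↔ (Pos.after (c, true) w).1.Accepts := by
  rw [canSee_of_forall_ne (by simp), and_iff_right hw, Ok]
  simp

theorem shows_treeModel (hw : Run (c, true) w) :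
    Shows (treeModel n hc) (.node []) w (Pos.after (c, true) w).1 := by
  intro k v hv t ht htv
  rw [canSee_sym hw ht, (hasPos_treeModel_iff hv).1 htv]

theorem tree_treeModel : HoldsAt (treeModel n hc) tree none (.node []) := by
  refine holdsAt_tree.2 ?_
  intro w hw ⟨k, hk⟩ u hu
  rw [survives_acts] at hw
  obtain ⟨l, rfl, rfl⟩ := desc_treeModel hu
  -- The child for the digit `b` is reached through `mid l b`; both are alive because runs of the
  -- machine are observable at every state.
  refine ⟨fun b => ⟨.node (b :: l), ⟨.mid l b, rfl, ?_, fun h => h, rfl, ?_, .inl rfl⟩, ?_⟩, ?_⟩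
  · exact survives_acts.2 hw
  · exact survives_acts.2 hw
  · refine TreeState.p_mem_val.trans ?_
    simp
  · intro m hm t ht
    obtain ⟨b, rfl⟩ := child_treeModel ht
    refine TreeState.p_mem_val.trans (Iff.trans ?_ TreeState.p_mem_val.symm)
    rw [List.reverse_cons, List.getElem?_append_left]
    rw [List.length_reverse]
    exact hm

theorem digitsLeaf_treeModel : HoldsAt (treeModel n hc) digitsLeaf none (.node []) := by
  refine holdsAt_digitsLeaf.2 ?_
  intro w _ t ht z hz m b
  rw [survives_treeModel] at hz
  rw [CanSee, survives_treeModel, hz.append_bit_iff, depth_eq_of_desc ht]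
  simp

theorem digitsInner_treeModel : HoldsAt (treeModel n hc) digitsInner none (.node []) := by
  refine holdsAt_digitsInner.2 ?_
  intro w _ l hl t ht z _ hz m b
  rw [survives_treeModel] at hz
  rw [CanSee, survives_treeModel, hz.append_bit_iff]
  exact .inl ((depth_le_of_chain ht).trans_lt hl)

theorem uniqueSym_treeModel : HoldsAt (treeModel n hc) uniqueSym none (.node []) := by
  refine holdsAt_uniqueSym.2 ?_
  intro w hw t ht k
  simp only [canSee_sym (survives_acts.1 hw) ht]
  exact ⟨_, rfl, fun _ h => h⟩

/-- Words of digits contain no transition, so the configuration whose symbols are visible is still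
the one reached by `w`. -/
theorem canSee_sym_of_isDigit {z : List (Obs M.Q n)} (hz : ∀ o ∈ z, IsDigit o)
    (hz' : Survives (treeModel n hc) (acts w ++ z) t) {k : Fin 3} {α : CellSym M.Q} :
    CanSee (treeModel n hc) (acts w) (.sym k α) t ↔
      CanSee (treeModel n hc) (acts w ++ z) (.sym k α) t := by
  have hz₀ : ∀ d, .act d ∉ z := by
    intro d hd
    obtain ⟨m, b, h⟩ := hz _ hd
    cases b <;> simp [bit] at h
  rw [survives_treeModel, observable_acts_append, observable_iff_forall hz₀] at hz'
  rw [canSee_of_forall_ne (by simp), CanSee, List.append_assoc, survives_treeModel,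
    observable_acts_append, observable_iff_forall (by simpa using hz₀)]
  simp only [List.mem_append, List.mem_singleton, or_imp, forall_and, forall_eq, hz'.1, true_and,
    and_iff_right hz'.2]

theorem stableSym_treeModel : HoldsAt (treeModel n hc) stableSym none (.node []) := by
  refine holdsAt_stableSym.2 ?_
  intro w _ t _ k α z hz hz'
  exact canSee_sym_of_isDigit hz hz'

theorem coherentSym_treeModel : HoldsAt (treeModel n hc) coherentSym none (.node []) := by
  refine holdsAt_coherentSym.2 ?_
  intro w hw k v hv hs
  refine ⟨(Pos.after (c, true) w).1.cell (2 ^ n) v, fun t ht => ?_⟩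
  have hs' := ht.alive (c := some (acts w ++ chooseWord k v)) hs
  rw [← canSee_sym_of_isDigit (fun o => isDigit_of_mem_chooseWord) hs',
    canSee_sym (survives_acts.1 hw) ht]
  -- A leaf that survives the digits of `v` in block `k` has these digits itself.
  have : HasPos (treeModel n hc) k v t := by
    intro m
    have h := (observable_acts_append.1 (survives_treeModel.1 hs')).2
    rw [observable_iff_forall] at h
    · have := h _ (List.mem_map_of_mem (List.mem_finRange m))
      rw [ok_bit, depth_eq_of_desc ht] at this
      simpa using this
    · intro d hd
      obtain ⟨m, b, h⟩ := isDigit_of_mem_chooseWord hd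
      cases b <;> simp [bit] at h
  rw [(hasPos_treeModel_iff hv).1 this]

theorem sameConfig_treeModel : HoldsAt (treeModel n hc) sameConfig none (.node []) := by
  refine holdsAt_sameConfig.2 ?_
  intro k k' _ w hw t ht v hv h h'
  have hw' := shows_treeModel (n := n) (hc := hc) (survives_acts.1 hw)
  exact ⟨_, hw' k v hv t ht h, hw' k' v hv t ht h'⟩

/-- Whether a transition is observable depends on the configuration and not on the state. -/
theorem uniformTrans_treeModel : HoldsAt (treeModel n hc) uniformTrans none (.node []) := by
  refine holdsAt_uniformTrans.2 ?_
  intro w _ l _ t _ d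
  rw [canSee_act, canSee_act]

theorem endMarkers_treeModel : HoldsAt (treeModel n hc) endMarkers none (.node []) := by
  refine holdsAt_endMarkers.2 ?_
  intro w hw t ht v hv h
  have hn : 0 < 2 ^ n := by positivity
  have := shows_treeModel (survives_acts.1 hw) 0 v (by omega) t ht h
  rwa [ATM.Cfg.cell, if_pos (by omega)] at this

end TreeModel

end POL.Reduction

/-! ### The conjuncts on the machine in the tree model, and the equivalence -/

namespace POL.Reduction

variable {M : ATM} {n : ℕ}

theorem Pos.after_append (q : Pos M) (w : List Branch) (d : Branch) :
    q.after (w ++ [d]) = (q.after w).next d := by simp [Pos.after]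

theorem Run.reaches {c : M.Cfg} {q : Pos M} {w : List Branch} (hw : Run q w)
    (hq : c.Reaches q.1) : c.Reaches (q.after w).1 := by
  induction w generalizing q with
  | nil => exact hq
  | cons d w ih => exact ih hw.2 (.tail _ d hq hw.1)

/-- The flag of a `Pos` is inverted by every transition, as `alternation` demands even when a final
configuration is entered. A machine in normal form agrees with it as long as it has not stopped. -/
theorem Run.isExist_eq (hM : M.Normal) {q : Pos M} {w : List Branch} (hw : Run q w)
    (hq : ¬ M.IsFinal q.1.state → M.isExist q.1.state = q.2) :
    ¬ M.IsFinal (q.after w).1.state → M.isExist (q.after w).1.state = (q.after w).2 := by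
  induction w generalizing q with
  | nil => exact hq
  | cons d w ih =>
    refine ih hw.2 fun hf => ?_
    rw [Pos.next, ← hq hw.1]
    exact hM.alternates d _ _ hw.1 hf

section TreeModel

variable {x : List Bool} {hc : (M.init x).Halts} {w : List Branch}

/-- The criterion from the other direction applies to every model of `tree` and `uniqueSym` whose
leaves show the configuration, and so to this one. -/
theorem stopped_treeModel_iff (hM : M.Normal)
    (hspace : ∀ c, (M.init x).Reaches c → c.head + 3 ≤ 2 ^ n)
    (hw : Run (M.init x, true) w) {q : M.Q} (hq : M.IsFinal q) :
    Stopped (treeModel n hc) (.node []) w q ↔ (Pos.after (M.init x, true) w).1.state = q := by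
  have hr := hw.reaches .refl
  exact Shows.stopped_iff tree_treeModel uniqueSym_treeModel (survives_acts.2 hw)
    (shows_treeModel hw) (hspace _ hr) (hM.stops_on_blank x _ hr) hq

theorem stopped_treeModel_iff_isFinal (hM : M.Normal)
    (hspace : ∀ c, (M.init x).Reaches c → c.head + 3 ≤ 2 ^ n)
    (hw : Run (M.init x, true) w) :
    (Stopped (treeModel n hc) (.node []) w M.qAcc ∨ Stopped (treeModel n hc) (.node []) w M.qRej) ↔
      M.IsFinal (Pos.after (M.init x, true) w).1.state :=
  or_congr (stopped_treeModel_iff hM hspace hw (.inl rfl))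
    (stopped_treeModel_iff hM hspace hw (.inr rfl))

theorem initInput_treeModel (hx : x.length + 2 ≤ 2 ^ n) (hn : 3 ≤ 2 ^ n) :
    HoldsAt (treeModel n hc) (initInput M.q₀ x) none (.node []) := by
  refine holdsAt_initInput.2 ?_
  intro t ht v hv h
  refine (canSee_sym (w := []) trivial ht).2 ?_
  rw [(hasPos_treeModel_iff (by omega)).1 h]
  exact (ATM.cell_init_of_lt hv (by omega)).symm

theorem initBlank_treeModel :
    HoldsAt (treeModel n hc) (initBlank x) none (.node []) := by
  refine holdsAt_initBlank.2 ?_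
  intro t ht h h'
  refine (canSee_sym (w := []) trivial ht).2 ?_
  obtain ⟨v, hv, hv'⟩ := exists_hasPos (treeModel n hc) 0 t
  rw [(hasPos_treeModel_iff hv).1 hv']
  have h₁ : max x.length 1 < v := by
    by_contra hcon
    exact h v (not_lt.1 hcon) hv'
  have h₂ : v + 1 ≠ 2 ^ n := by
    rintro e
    exact h' (by rwa [← e, Nat.add_sub_cancel])
  obtain ⟨v, rfl⟩ : ∃ u, v = u + 1 := ⟨v - 1, by omega⟩
  exact (ATM.cell_init_of_le (by omega) h₂).symm

theorem transitions_treeModel (hM : M.Normal)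
    (hspace : ∀ c, (M.init x).Reaches c → c.head + 3 ≤ 2 ^ n) :
    HoldsAt (treeModel n hc) (transitions M) none (.node []) := by
  refine holdsAt_transitions.2 ?_
  intro w hw hf t ht v hv h₀ h₁ h₂ α β γ hα hβ hγ d
  rw [survives_acts] at hw
  rw [stopped_treeModel_iff_isFinal hM hspace hw] at hf
  have hr := hw.reaches (c := M.init x) .refl
  have hd : CanSee (treeModel n hc) (acts w) (.act d) t := canSee_act.2 ⟨hw, hf⟩
  refine ⟨hd, ?_⟩
  have hw' : Run (M.init x, true) (w ++ [d]) := by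
    rw [CanSee, ← acts_append, survives_acts] at hd
    exact hd
  rw [canSee_sym hw ht, (hasPos_treeModel_iff (by omega)).1 h₀] at hα
  rw [canSee_sym hw ht, (hasPos_treeModel_iff (by omega)).1 h₁] at hβ
  rw [canSee_sym hw ht, (hasPos_treeModel_iff (by omega)).1 h₂] at hγ
  rw [← acts_append, canSee_sym hw' ht, (hasPos_treeModel_iff (by omega)).1 h₁, Pos.after_append,
    hα, hβ, hγ]
  exact ATM.succ_cell d (Nat.succ_ne_zero v) hv (hspace _ hr) (hspace _ (.tail _ d hr hf))

theorem halted_treeModel (hM : M.Normal)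
    (hspace : ∀ c, (M.init x).Reaches c → c.head + 3 ≤ 2 ^ n) :
    HoldsAt (treeModel n hc) (halted M) none (.node []) := by
  refine holdsAt_halted.2 ?_
  intro w hw hf d
  rw [survives_acts] at hw
  rw [stopped_treeModel_iff_isFinal hM hspace hw] at hf
  exact fun h => (canSee_act.1 h).2 hf

theorem alternation_treeModel :
    HoldsAt (treeModel n hc) (alternation M) none (.node []) := by
  refine holdsAt_alternation.2 ?_
  intro w hw d hd
  rw [survives_acts] at hw
  rw [CanSee, ← acts_append, survives_acts] at hd
  rw [← acts_append, canSee_ex hw, canSee_ex hd, Pos.after_append, Pos.next]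
  simp

/-- As `win` means acceptance at the root, the conditions are the recursive clauses of `Accepts`,
read in both directions. -/
theorem winning_treeModel (hM : M.Normal)
    (hspace : ∀ c, (M.init x).Reaches c → c.head + 3 ≤ 2 ^ n) :
    HoldsAt (treeModel n hc) (winning M) none (.node []) := by
  refine holdsAt_winning.2 ?_
  intro w hw
  rw [survives_acts] at hw
  have hq_iff := fun q hq => stopped_treeModel_iff (hc := hc) hM hspace hw (q := q) hq
  have hd : ¬ M.IsFinal (Pos.after (M.init x, true) w).1.state → ∀ d,
      CanSee (treeModel n hc) (acts w) (.act d) (.node []) := fun hf d => canSee_act.2 ⟨hw, hf⟩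
  have hwin : ¬ M.IsFinal (Pos.after (M.init x, true) w).1.state → ∀ d,
      (CanSee (treeModel n hc) (acts w ++ [.act d]) .win (.node []) ↔
        ((Pos.after (M.init x, true) w).1.step d).Accepts) := by
    intro hf d
    have := hd hf d
    rw [CanSee, ← acts_append, survives_acts] at this
    rw [← acts_append, canSee_win this, Pos.after_append]
    rfl
  have hex := hw.isExist_eq hM fun _ => hM.start
  rw [stopped_treeModel_iff_isFinal hM hspace hw, hq_iff _ (.inl rfl), hq_iff _ (.inr rfl),
    canSee_win hw, canSee_ex hw]
  refine ⟨.acc _, fun hq h => ?_, fun hf he => ?_, fun hf he => ?_⟩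
  · cases h with
    | acc _ h => exact M.acc_ne_rej (h.symm.trans hq)
    | exist _ d h => exact h (.inr hq)
    | univ _ h => exact h (.inr hq)
  · have he' := hex hf
    simp only [Bool.not_eq_true] at he
    rw [he] at he'
    simp only [hd hf, true_implies, hwin hf]
    constructor
    · intro h
      cases h with
      | acc _ h => exact absurd (.inl h) hf
      | exist _ d _ h => simp [h] at he'
      | univ _ _ _ h => exact h
    · exact .univ _ hf he'
  · have he' := hex hf
    rw [he] at he'
    simp only [hd hf, true_and, hwin hf]
    constructor
    · intro h
      cases h with
      | acc _ h => exact absurd (.inl h) hf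
      | exist _ d _ _ h => exact ⟨d, h⟩
      | univ _ _ h => simp [h] at he'
    · rintro ⟨d, h⟩
      exact .exist _ d hf he' h

/-- All conjuncts but the last hold in the tree model whether or not the input is accepted;
acceptance makes `win` observable before any transition. -/
theorem holdsAt_formula_of_accepts (hM : M.Normal) (hx : x.length + 2 ≤ 2 ^ n)
    (hspace : ∀ c, (M.init x).Reaches c → c.head + 3 ≤ 2 ^ n) (h : (M.init x).Accepts) :
    HoldsAt (treeModel n hc) (formula M n x) none (.node []) := by
  have hn : 3 ≤ 2 ^ n := (Nat.le_add_left _ _).trans (hspace _ .refl)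
  simp only [formula, holdsAt_bigAnd, List.mem_cons, List.not_mem_nil, or_false,
    forall_eq_or_imp, forall_eq, holdsAt_conj, holdsAt_obs, Option.getD_none]
  exact ⟨tree_treeModel, digitsLeaf_treeModel, digitsInner_treeModel, uniqueSym_treeModel,
    stableSym_treeModel, coherentSym_treeModel, sameConfig_treeModel, uniformTrans_treeModel,
    endMarkers_treeModel, initInput_treeModel hx hn, initBlank_treeModel,
    transitions_treeModel hM hspace, halted_treeModel hM hspace, alternation_treeModel,
    winning_treeModel hM hspace, (canSee_win (w := []) trivial).2 h, (canSee_ex (w := []) trivial).2 rfl⟩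

end TreeModel

/-- The formula for the input `x` is satisfiable if and only if `x` is accepted. -/
theorem satisfiable_formula_iff (hM : M.Normal) {x : List Bool} (hx : x.length + 2 ≤ 2 ^ n)
    (hspace : ∀ c, (M.init x).Reaches c → c.head + 3 ≤ 2 ^ n) (hc : (M.init x).Halts) :
    Satisfiable (formula M n x) ↔ (M.init x).Accepts := by
  simp only [Satisfiable, holds_iff_holdsAt]
  constructor
  · rintro ⟨K, s, h⟩
    exact accepts_of_holdsAt hM hspace hc h
  · intro h
    exact ⟨treeModel n hc, .node [], holdsAt_formula_of_accepts hM hx hspace h⟩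

end POL.Reduction

/-! ### The main theorem -/

theorem mainTheorem3 (M : ATM) (hM : M.Normal) (p : Polynomial ℕ)
    (hspace : M.RunsInSpace fun k => 2 ^ p.eval k)
    (L : Language Bool) (hdec : M.Decides L) :
    Nonempty (Turing.TM2ComputableInPolyTime (id : List Bool → List Bool)
      (id : List (POL.Token M.Q) → List (POL.Token M.Q))
      (fun x => POL.encFormula (POL.Reduction.tr M p x))) ∧
    ∀ x : List Bool, x ∈ L ↔ POL.Satisfiable (POL.Reduction.tr M p x) := by
  refine ⟨POL.Strings.polyTime_tr M p, fun x => ?_⟩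
  obtain ⟨hx, hreach⟩ := hspace x
  obtain ⟨hhalt, hL⟩ := hdec x
  rw [hL]
  exact (POL.Reduction.satisfiable_formula_iff hM hx hreach hhalt).symm
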